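/- Let $\mathfrak A$ be an abelian $\mathbb Q$-linear tensor category, i.e. an abelian $\mathbb Q$-linear category with a symmetric monoidal structure (associative, commutative, unital) whose tensor product $\otimes$ is $\mathbb Q$-bilinear on morphisms; assume that $\otimes$ is biexact (exact in each variable). Let $K_0(\mathfrak A)$ be the Grothendieck ring of $\mathfrak A$: the abelian group generated by the classes $\mathrm{cl}(X)$ of objects, subject to $\mathrm{cl}(Y)=\mathrm{cl}(X)+\mathrm{cl}(Z)$ for every short exact sequence $0\to X\to Y\to Z\to 0$, with product $\mathrm{cl}(X)\,\mathrm{cl}(Y)=\mathrm{cl}(X\otimes Y)$. For a partition $\pi$ of $n\ge 0$ let $e_\pi\in\mathbb Q[\Sigma_n]$ be the normalized Young symmetrizer of $\pi$, an idempotent such that $V_\pi=\mathbb Q[\Sigma_n]e_\pi$ is the irreducible representation of $\Sigma_n$ attached to $\pi$, and for an object $X$ of $\mathfrak A$ let $S_\pi(X)$ be the image of $e_\pi$ acting on $X^{\otimes n}$, where $\Sigma_n$ acts through the commutativity constraint. Let $R=\bigoplus_{n\ge 0}R_n$, where $R_n$ is the Grothendieck group of finite-dimensional $\mathbb Q$-representations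 of $\Sigma_n$, be the commutative ring with the induction product $\mathrm{cl}(V)\,\mathrm{cl}(W)=\mathrm{cl}\bigl(\mathrm{Ind}_{\Sigma_p\times\Sigma_q}^{\Sigma_{p+q}}(V\otimes W)\bigr)$, put $K_0(\mathfrak A)_R=K_0(\mathfrak A)\otimes_{\mathbb Z}R$, and set $$\lambda_\Sigma(X)=\sum_{\mu}\mathrm{cl}\bigl(S_\mu(X)\bigr)\otimes\mathrm{cl}(V_\mu)\,t^{|\mu|}\in K_0(\mathfrak A)_R[[t]],$$ the sum being over all partitions $\mu$ of all integers $|\mu|\ge 0$. Then for every short exact sequence $0\to X\to Y\to Z\to 0$ in $\mathfrak A$ and every partition $\pi$, $$\mathrm{cl}\bigl(S_\pi(Y)\bigr)=\mathrm{cl}\bigl(S_\pi(X\oplus Z)\bigr)\quad\text{in }K_0(\mathfrak A).$$ Moreover $\lambda_\Sigma$ is well defined on $K_0(\mathfrak A)$: there is a unique group homomorphism from the additive group of $K_0(\mathfrak A)$ to the group of units $\bigl(K_0(\mathfrak A)_R[[t]]\bigr)^\times$ that sends $\mathrm{cl}(X)$ to $\lambda_\Sigma(X)$ for every object $X$. 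-/

import Mathlib

open CategoryTheory MonoidalCategory Limits
open scoped ZeroObject TensorProduct MonoidAlgebra

universe v u

/-! ### Symmetric group actions on tensor powers -/

namespace PermLift
variable {M : ℕ → Type*} [∀ n, Monoid (M n)] (ι : ∀ n, M n →* M (n + 1)) (b : ∀ n, M (n + 2))

/-- The element for the cycle sending `0` to `k` and keeping the order of the other points. -/
def cyc : ∀ n : ℕ, ℕ → M (n + 1)
  | _, 0 => 1
  | 0, _ + 1 => 1
  | n + 1, k + 1 => ι (n + 1) (cyc n k) * b n

/-- The permutation induced by `σ` on the points other than `0` (source) and `σ 0` (target). -/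
def rem {n : ℕ} (σ : Equiv.Perm (Fin (n + 1))) : Equiv.Perm (Fin n) :=
  (Equiv.Perm.decomposeFin ((σ 0).cycleRange * σ)).2

theorem rem_spec {n : ℕ} (σ : Equiv.Perm (Fin (n + 1))) (i : Fin n) :
    (σ 0).succAbove (rem σ i) = σ i.succ := by
  have h0 : (((σ 0).cycleRange * σ) 0) = 0 := by simp
  have h : Equiv.Perm.decomposeFin.symm (0, rem σ) = (σ 0).cycleRange * σ := by
    rw [Equiv.symm_apply_eq]
    refine Prod.ext ?_ rfl
    have := Equiv.Perm.decomposeFin_symm_apply_zero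
      (Equiv.Perm.decomposeFin ((σ 0).cycleRange * σ)).1
      (Equiv.Perm.decomposeFin ((σ 0).cycleRange * σ)).2
    rw [Prod.mk.eta, Equiv.symm_apply_apply, h0] at this
    exact this
  have h2 := DFunLike.congr_fun h i.succ
  rw [Equiv.Perm.decomposeFin_symm_apply_succ, Equiv.swap_self, Equiv.refl_apply,
    Equiv.Perm.mul_apply] at h2
  rw [← Fin.cycleRange_symm_succ, h2, Equiv.symm_apply_apply]

theorem rem_eq {n : ℕ} (σ : Equiv.Perm (Fin (n + 1))) (p : Fin (n + 1)) (τ : Equiv.Perm (Fin n))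
    (h0 : σ 0 = p) (h : ∀ i, σ i.succ = p.succAbove (τ i)) : rem σ = τ := by
  subst h0
  ext1 i
  apply Fin.succAbove_right_injective (p := σ 0)
  rw [rem_spec, h]

/-- The element of `M n` attached to a permutation of `Fin n`. -/
def act : ∀ n : ℕ, Equiv.Perm (Fin n) → M n
  | 0, _ => 1
  | n + 1, σ => cyc ι b n (σ 0) * ι n (act n (rem σ))

/-- The relations satisfied by adjacent transpositions. -/
structure Relations : Prop where
  sq : ∀ n, b n * b n = 1
  braid : ∀ n, b (n + 1) * ι _ (b n) * b (n + 1) = ι _ (b n) * b (n + 1) * ι _ (b n)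
  comm : ∀ n (x : M n), b n * ι _ (ι _ x) = ι _ (ι _ x) * b n

variable {ι b} in
theorem cyc_rel (R : Relations ι b) : ∀ (n p q : ℕ), p ≤ q → q ≤ n →
    cyc ι b (n + 1) p * ι _ (cyc ι b n q) * b n = cyc ι b (n + 1) (q + 1) * ι _ (cyc ι b n p)
  | n, 0, q, _, _ => by simp [cyc]
  | 0, p + 1, q, h, h' => by omega
  | n + 1, p + 1, 0, h, h' => by omega
  | n + 1, p + 1, q + 1, h, h' => by
    have ih := congrArg (ι _) (cyc_rel R n p q (by omega) (by omega))
    have h1 := R.braid n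
    have h2 := R.comm (n + 1) (cyc ι b n p)
    have h3 := R.comm (n + 1) (cyc ι b n q)
    simp only [cyc, map_mul] at ih ⊢
    calc _ = ι _ (cyc ι b (n + 1) p) * (b (n + 1) * ι _ (ι _ (cyc ι b n q))) * ι _ (b n)
          * b (n + 1) := by simp only [mul_assoc]
      _ = ι _ (cyc ι b (n + 1) p) * ι _ (ι _ (cyc ι b n q)) * (b (n + 1) * ι _ (b n)
          * b (n + 1)) := by rw [h3]; simp only [mul_assoc]
      _ = (ι _ (cyc ι b (n + 1) p) * ι _ (ι _ (cyc ι b n q)) * ι _ (b n)) * b (n + 1)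
          * ι _ (b n) := by rw [h1]; simp only [mul_assoc]
      _ = ι _ (ι _ (cyc ι b n q)) * ι _ (b n) * (ι _ (ι _ (cyc ι b n p)) * b (n + 1))
          * ι _ (b n) := by rw [ih]; simp only [mul_assoc]
      _ = _ := by rw [← h2]; simp only [mul_assoc]

variable {ι b} in
theorem cyc_rel' (R : Relations ι b) (n : ℕ) (p : Fin (n + 2)) (q : Fin (n + 1)) :
    cyc ι b (n + 1) p * ι _ (cyc ι b n q) * b n =
      cyc ι b (n + 1) (p.succAbove q) * ι _ (cyc ι b n (q.predAbove p)) := by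
  rcases Fin.lt_or_ge q.castSucc p with h | h
  · rw [Fin.succAbove_of_castSucc_lt _ _ h, Fin.predAbove_of_castSucc_lt _ _ h]
    obtain ⟨p, rfl⟩ := Fin.exists_succ_eq.2 (Fin.ne_zero_of_lt h)
    have := cyc_rel R n q p (by simp [Fin.lt_def] at h; omega) (by omega)
    simp only [Fin.val_castSucc, Fin.pred_succ, Fin.val_succ] at this ⊢
    rw [← this, mul_assoc, R.sq, mul_one]
  · rw [Fin.succAbove_of_le_castSucc _ _ h, Fin.predAbove_of_le_castSucc _ _ h]
    have := cyc_rel R n p q h (by omega)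
    simpa using this

theorem act_one : ∀ n, act ι b n 1 = 1
  | 0 => rfl
  | n + 1 => by
    have : rem (1 : Equiv.Perm (Fin (n + 1))) = 1 := rem_eq _ 0 _ rfl (by simp)
    simp [act, this, act_one n, cyc]

theorem act_swap_succ (n : ℕ) (i : Fin n) :
    act ι b (n + 2) (Equiv.swap i.succ.castSucc i.succ.succ) =
      ι _ (act ι b (n + 1) (Equiv.swap i.castSucc i.succ)) := by
  have h0 : Equiv.swap i.succ.castSucc i.succ.succ 0 = 0 :=
    Equiv.swap_apply_of_ne_of_ne (by simp [Fin.ext_iff]) (by simp [Fin.ext_iff])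
  have : rem (Equiv.swap i.succ.castSucc i.succ.succ) = Equiv.swap i.castSucc i.succ :=
    rem_eq _ 0 _ h0 (fun j => by
      rw [← Fin.succ_castSucc, Fin.zero_succAbove]
      exact (Fin.succ_injective _).swap_apply _ _ _)
  rw [act, this, h0]
  simp [cyc]

theorem act_swap_zero (n : ℕ) :
    act ι b (n + 2) (Equiv.swap 0 1) = b n := by
  have : rem (Equiv.swap (0 : Fin (n + 2)) 1) = 1 :=
    rem_eq _ 1 _ (by simp) (fun j => by
      refine Fin.cases ?_ (fun j => ?_) j
      · simp
      · rw [Equiv.swap_apply_of_ne_of_ne (by simp [Fin.ext_iff]) (by simp [Fin.ext_iff])]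
        rw [Equiv.Perm.one_apply, Fin.succAbove_of_lt_succ]
        simp [Fin.lt_def])
  rw [act, this, act_one]
  simp [cyc]

variable {ι b} in
theorem act_mul_swap (R : Relations ι b) : ∀ (n : ℕ) (σ : Equiv.Perm (Fin (n + 1))) (i : Fin n),
    act ι b (n + 1) (σ * Equiv.swap i.castSucc i.succ) =
      act ι b (n + 1) σ * act ι b (n + 1) (Equiv.swap i.castSucc i.succ)
  | 0, _, i => i.elim0
  | n + 1, σ, i => by
    refine Fin.cases ?_ (fun i => ?_) i
    · change act ι b (n + 2) (σ * Equiv.swap 0 1) = _ * act ι b (n + 2) (Equiv.swap 0 1)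
      rw [act_swap_zero]
      set p := σ 0 with hp
      set τ := rem σ with hτ
      set q := τ 0 with hq
      have h1 : σ 1 = p.succAbove q := by rw [hp, hq, hτ, rem_spec]; rfl
      have hr : rem (rem (σ * Equiv.swap 0 1)) = rem τ ∧
          (rem (σ * Equiv.swap 0 1)) 0 = q.predAbove p := by
        have hs : ∀ i, (p.succAbove q).succAbove (rem (σ * Equiv.swap 0 1) i) =
            σ (Equiv.swap 0 1 i.succ) := by
          intro i
          have := rem_spec (σ * Equiv.swap 0 1) i
          rw [Equiv.Perm.mul_apply, Equiv.swap_apply_left, h1] at this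
          rw [this]; rfl
        have hz : (rem (σ * Equiv.swap 0 1)) 0 = q.predAbove p := by
          apply Fin.succAbove_right_injective (p := p.succAbove q)
          rw [hs, Fin.succAbove_succAbove_predAbove, hp]
          simp
        refine ⟨rem_eq _ _ _ hz (fun i => ?_), hz⟩
        apply Fin.succAbove_right_injective (p := p.succAbove q)
        rw [hs, Equiv.swap_apply_of_ne_of_ne (by simp [Fin.ext_iff]) (by simp [Fin.ext_iff]),
          Fin.succAbove_succAbove_succAbove_predAbove, hq, rem_spec, hτ, rem_spec]
      rw [act, act, hr.1, hr.2, act, act, ← hp, ← hτ, ← hq, Equiv.Perm.mul_apply,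
        Equiv.swap_apply_left, h1, map_mul, map_mul, ← mul_assoc, ← mul_assoc,
        ← cyc_rel' R, mul_assoc (_ * _) (b n), R.comm, mul_assoc (_ * _) _ (b n)]
    · have hz : (Equiv.swap i.succ.castSucc i.succ.succ) 0 = 0 :=
        Equiv.swap_apply_of_ne_of_ne (by simp [Fin.ext_iff]) (by simp [Fin.ext_iff])
      have hr : rem (σ * Equiv.swap i.succ.castSucc i.succ.succ) =
          rem σ * Equiv.swap i.castSucc i.succ := by
        refine rem_eq _ (σ 0) _ (by rw [Equiv.Perm.mul_apply, hz]) (fun j => ?_)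
        rw [Equiv.Perm.mul_apply, Equiv.Perm.mul_apply, rem_spec, ← Fin.succ_castSucc,
          (Fin.succ_injective _).swap_apply]
      rw [act_swap_succ, act.eq_2 ι b (n + 1) (σ * _), hr, act_mul_swap R n, Equiv.Perm.mul_apply,
        hz, map_mul, act.eq_2 ι b (n + 1) σ, mul_assoc]

variable {ι b} in
theorem act_mul (R : Relations ι b) : ∀ (n : ℕ) (σ τ : Equiv.Perm (Fin n)),
    act ι b n (σ * τ) = act ι b n σ * act ι b n τ
  | 0, _, _ => by simp [act]
  | n + 1, σ, τ => by
    have hτ : τ ∈ Submonoid.closure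
        (Set.range fun i : Fin n => Equiv.swap i.castSucc i.succ) := by
      rw [Equiv.Perm.mclosure_swap_castSucc_succ]; trivial
    induction hτ using Submonoid.closure_induction generalizing σ with
    | mem x hx => obtain ⟨i, rfl⟩ := hx; exact act_mul_swap R n σ i
    | one => simp [act_one]
    | mul x y _ _ hx hy => rw [← mul_assoc, hy, hx, hy x, mul_assoc]

variable {ι b} in
/-- The homomorphism from the symmetric group sending adjacent transpositions to the `b`s. -/
def hom (R : Relations ι b) (n : ℕ) : Equiv.Perm (Fin n) →* M n where
  toFun := act ι b n
  map_one' := act_one ι b n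
  map_mul' := act_mul R n

end PermLift

section
variable {C : Type u} [Category.{v} C] [MonoidalCategory C] [SymmetricCategory C]


/-- The symmetry exchanging the first two factors of `X ⊗ X ⊗ T`. -/
def braidFirst (X T : C) : X ⊗ X ⊗ T ⟶ X ⊗ X ⊗ T :=
  (α_ X X T).inv ≫ (β_ X X).hom ▷ T ≫ (α_ X X T).hom

theorem braidFirst_comp_self (X T : C) : braidFirst X T ≫ braidFirst X T = 𝟙 _ := by
  simp [braidFirst, ← comp_whiskerRight_assoc]

theorem braidFirst_naturality (X : C) {T T' : C} (f : T ⟶ T') :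
    X ◁ X ◁ f ≫ braidFirst X T' = braidFirst X T ≫ X ◁ X ◁ f := by
  simp only [braidFirst, Category.assoc, ← associator_naturality_right]
  rw [← whisker_exchange_assoc, associator_inv_naturality_right_assoc]

theorem braidFirst_yang_baxter (X T : C) :
    braidFirst X (X ⊗ T) ≫ X ◁ braidFirst X T ≫ braidFirst X (X ⊗ T) =
      X ◁ braidFirst X T ≫ braidFirst X (X ⊗ T) ≫ X ◁ braidFirst X T := by
  have h := congrArg (fun f : X ⊗ X ⊗ X ⟶ X ⊗ X ⊗ X => X ◁ (α_ X X T).inv ≫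
    (α_ X (X ⊗ X) T).inv ≫ f ▷ T ≫ (α_ X (X ⊗ X) T).hom ≫ X ◁ (α_ X X T).hom)
    (BraidedCategory.yang_baxter X X X)
  simp only [braidFirst]
  simp only [comp_whiskerRight, Category.assoc] at h
  convert h using 1
  · monoidal
  · monoidal

/-- The `n`-th tensor power, `X ⊗ (X ⊗ (⋯ ⊗ 𝟙))`. -/
def tensorPow (X : C) : ℕ → C
  | 0 => 𝟙_ C
  | n + 1 => X ⊗ tensorPow X n

/-- An endomorphism of `X^{⊗n}` acting on the last `n` factors of `X^{⊗(n+1)}`. -/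
def tensorPow.whisker (X : C) (n : ℕ) : End (tensorPow X n) →* End (tensorPow X (n + 1)) where
  toFun f := X ◁ (show tensorPow X n ⟶ tensorPow X n from f)
  map_one' := whiskerLeft_id _ _
  map_mul' _ _ := whiskerLeft_comp _ _ _

/-- The action of the symmetric group on `X^{⊗n}` by the symmetry constraint: the homomorphism
sending the transposition of the `i`-th and `(i+1)`-st factors to the symmetry of these factors
(see the two theorems below). Multiplication in `End` is composition `f * g = f ∘ g`. -/
def tensorPow.permHom (X : C) (n : ℕ) : Equiv.Perm (Fin n) →* End (tensorPow X n) :=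
  PermLift.hom (M := fun n => End (tensorPow X n)) (ι := tensorPow.whisker X)
    (b := fun n => braidFirst X (tensorPow X n))
    ⟨fun n => braidFirst_comp_self X (tensorPow X n),
      fun n => braidFirst_yang_baxter X (tensorPow X n),
      fun _ x => braidFirst_naturality X x⟩ n

theorem tensorPow.permHom_swap_zero_one (X : C) (n : ℕ) :
    tensorPow.permHom X (n + 2) (Equiv.swap 0 1) = braidFirst X (tensorPow X n) :=
  PermLift.act_swap_zero (M := fun n => End (tensorPow X n)) _ _ n

theorem tensorPow.permHom_swap_succ (X : C) (n : ℕ) (i : Fin n) :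
    tensorPow.permHom X (n + 2) (Equiv.swap i.succ.castSucc i.succ.succ) =
      tensorPow.whisker X (n + 1) (tensorPow.permHom X (n + 1) (Equiv.swap i.castSucc i.succ)) :=
  PermLift.act_swap_succ (M := fun n => End (tensorPow X n)) _ _ n i

end

/-! ### Grothendieck groups -/

section
variable (C : Type u) [Category.{v} C] [Abelian C]

/-- The relations `[S.X₂] - [S.X₁] - [S.X₃]` for all short exact sequences `S`. -/
def K0.relations : AddSubgroup (FreeAbelianGroup C) :=
  AddSubgroup.closure {x | ∃ S : ShortComplex C, S.ShortExact ∧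
    x = FreeAbelianGroup.of S.X₂ - FreeAbelianGroup.of S.X₁ - FreeAbelianGroup.of S.X₃}

/-- The Grothendieck group of an abelian category, with respect to exact sequences. -/
def K0 : Type u := FreeAbelianGroup C ⧸ K0.relations C

noncomputable instance : AddCommGroup (K0 C) :=
  inferInstanceAs (AddCommGroup (FreeAbelianGroup C ⧸ K0.relations C))
end

namespace K0
variable {C : Type u} [Category.{v} C] [Abelian C]

/-- The class of an object. -/
def cl (X : C) : K0 C := QuotientAddGroup.mk (FreeAbelianGroup.of X)

theorem cl_eq_add (S : ShortComplex C) (hS : S.ShortExact) : cl S.X₂ = cl S.X₁ + cl S.X₃ := by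
  have h : FreeAbelianGroup.of S.X₂ - FreeAbelianGroup.of S.X₁ - FreeAbelianGroup.of S.X₃ ∈
    K0.relations C := AddSubgroup.subset_closure ⟨S, hS, rfl⟩
  have h2 := (QuotientAddGroup.eq_zero_iff _).2 h
  rw [sub_sub, QuotientAddGroup.mk_sub, sub_eq_zero] at h2
  exact h2

theorem cl_eq_of_iso {X Y : C} (e : X ≅ Y) : cl X = cl Y := by
  have h0 : cl (0 : C) = 0 := by
    have := cl_eq_add (ShortComplex.mk (0 : (0 : C) ⟶ 0) (0 : (0 : C) ⟶ 0) (by simp))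
      (ShortComplex.Splitting.shortExact ⟨0, 0, by simp, by simp, by simp⟩)
    simpa using this
  have h := cl_eq_add (ShortComplex.mk (0 : (0 : C) ⟶ X) e.hom (by simp))
    (ShortComplex.Splitting.shortExact ⟨0, e.inv, by simp, by simp, by simp⟩)
  simpa [h0] using h

def lift {G : Type*} [AddCommGroup G] (f : C → G)
    (hf : ∀ S : ShortComplex C, S.ShortExact → f S.X₂ = f S.X₁ + f S.X₃) : K0 C →+ G :=
  QuotientAddGroup.lift (K0.relations C) (FreeAbelianGroup.lift f) (by
    rw [relations, AddSubgroup.closure_le]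
    rintro _ ⟨S, hS, rfl⟩
    simp [hf S hS])

@[simp] theorem lift_cl {G : Type*} [AddCommGroup G] (f : C → G)
    (hf : ∀ S : ShortComplex C, S.ShortExact → f S.X₂ = f S.X₁ + f S.X₃) (X : C) :
    lift f hf (cl X) = f X := FreeAbelianGroup.lift_apply_of f X

@[ext] theorem hom_ext {G : Type*} [AddCommGroup G] {f g : K0 C →+ G}
    (h : ∀ X, f (cl X) = g (cl X)) : f = g :=
  QuotientAddGroup.addMonoidHom_ext _ (FreeAbelianGroup.lift_ext _ _ h)

@[elab_as_elim]
theorem induction_on {p : K0 C → Prop} (x : K0 C) (h : ∀ X, p (cl X))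
    (hadd : ∀ a b, p a → p b → p (a + b)) (hneg : ∀ a, p a → p (-a)) : p x := by
  obtain ⟨x, rfl⟩ := QuotientAddGroup.mk_surjective x
  have h0 : p 0 := by simpa using hadd _ _ (h 0) (hneg _ (h 0))
  exact FreeAbelianGroup.induction_on x h0 h (fun X _ => hneg _ (h X)) (fun a b => hadd _ _)

end K0

/-- The tensor product is exact in each variable. -/
class BiexactTensor (C : Type*) [Category C] [MonoidalCategory C] : Prop where
  left_lim : ∀ X : C, PreservesFiniteLimits (tensorLeft X)
  left_colim : ∀ X : C, PreservesFiniteColimits (tensorLeft X)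
  right_lim : ∀ X : C, PreservesFiniteLimits (tensorRight X)
  right_colim : ∀ X : C, PreservesFiniteColimits (tensorRight X)

namespace K0
variable {C : Type u} [Category.{v} C] [Abelian C] [MonoidalCategory C] [MonoidalPreadditive C]
  [BiexactTensor C]

theorem cl_tensor_left (X : C) (S : ShortComplex C) (hS : S.ShortExact) :
    cl (X ⊗ S.X₂) = cl (X ⊗ S.X₁) + cl (X ⊗ S.X₃) := by
  have := BiexactTensor.left_lim X
  have := BiexactTensor.left_colim X
  exact cl_eq_add _ (hS.map_of_exact (tensorLeft X))

theorem cl_tensor_right (S : ShortComplex C) (hS : S.ShortExact) (X : C) :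
    cl (S.X₂ ⊗ X) = cl (S.X₁ ⊗ X) + cl (S.X₃ ⊗ X) := by
  have := BiexactTensor.right_lim X
  have := BiexactTensor.right_colim X
  exact cl_eq_add _ (hS.map_of_exact (tensorRight X))

/-- The product on `K0`, induced by the tensor product. -/
noncomputable def mulHom : K0 C →+ K0 C →+ K0 C :=
  lift (fun X => lift (fun Y => cl (X ⊗ Y)) (cl_tensor_left X)) fun S hS => by
    ext Y
    rw [AddMonoidHom.add_apply, lift_cl, lift_cl, lift_cl]
    exact cl_tensor_right S hS Y

noncomputable instance : Mul (K0 C) := ⟨fun x y => mulHom x y⟩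
noncomputable instance : One (K0 C) := ⟨cl (𝟙_ C)⟩

theorem cl_mul_cl (X Y : C) : cl X * cl Y = cl (X ⊗ Y) := by
  change mulHom _ _ = _
  rw [mulHom, lift_cl, lift_cl]


noncomputable instance [BraidedCategory C] : CommRing (K0 C) where
  __ := (inferInstance : AddCommGroup (K0 C))
  left_distrib x y z := map_add (mulHom x) y z
  right_distrib x y z := DFunLike.congr_fun (map_add mulHom x y) z
  zero_mul x := DFunLike.congr_fun (map_zero mulHom) x
  mul_zero x := map_zero (mulHom x)
  mul_assoc x y z := by
    change mulHom (mulHom x y) z = mulHom x (mulHom y z)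
    induction x using induction_on with
    | h X =>
      induction y using induction_on with
      | h Y =>
        induction z using induction_on with
        | h Z =>
          change cl X * cl Y * cl Z = cl X * (cl Y * cl Z)
          simp only [cl_mul_cl]
          exact cl_eq_of_iso (α_ X Y Z)
        | hadd a b ha hb => simp [ha, hb]
        | hneg a ha => simp [ha]
      | hadd a b ha hb => simp [ha, hb]
      | hneg a ha => simp [ha]
    | hadd a b ha hb => simp [ha, hb]
    | hneg a ha => simp [ha]
  one_mul x := by
    change mulHom 1 x = x
    induction x using induction_on with
    | h X =>
      change cl (𝟙_ C) * cl X = cl X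
      rw [cl_mul_cl]
      exact cl_eq_of_iso (λ_ X)
    | hadd a b ha hb => simp [ha, hb]
    | hneg a ha => simp [ha]
  mul_one x := by
    change mulHom x 1 = x
    induction x using induction_on with
    | h X =>
      change cl X * cl (𝟙_ C) = cl X
      rw [cl_mul_cl]
      exact cl_eq_of_iso (ρ_ X)
    | hadd a b ha hb => simp [ha, hb]
    | hneg a ha => simp [ha]
  mul_comm x y := by
    change mulHom x y = mulHom y x
    induction x using induction_on with
    | h X =>
      induction y using induction_on with
      | h Y =>
        change cl X * cl Y = cl Y * cl X
        rw [cl_mul_cl, cl_mul_cl]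
        exact cl_eq_of_iso (β_ X Y)
      | hadd a b ha hb => simp [ha, hb]
      | hneg a ha => simp [ha]
    | hadd a b ha hb => simp [ha, hb]
    | hneg a ha => simp [ha]

end K0
/-! ### Induction products and the ring of representations of symmetric groups -/

namespace IndProd
section
variable {G H K V W M : Type*} [Group G] [Group H] [Group K]
  [AddCommGroup V] [Module ℚ V] [AddCommGroup W] [Module ℚ W] [AddCommGroup M] [Module ℚ M]
  (φ : G × H →* K) (ρ : Representation ℚ G V) (σ : Representation ℚ H W)

/-- External tensor product of representations. -/
noncomputable def box : Representation ℚ (G × H) (V ⊗[ℚ] W) :=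
  Representation.tprod (ρ.comp (MonoidHom.fst G H)) (σ.comp (MonoidHom.snd G H))

/-- The underlying space of the representation induced along `φ` from an external tensor product. -/
def carrier := Representation.IndV φ (box ρ σ)

noncomputable instance : AddCommGroup (carrier φ ρ σ) :=
  inferInstanceAs (AddCommGroup (Representation.IndV φ (box ρ σ)))

noncomputable instance : Module ℚ (carrier φ ρ σ) :=
  inferInstanceAs (Module ℚ (Representation.IndV φ (box ρ σ)))

/-- The representation induced along `φ` from an external tensor product. -/
noncomputable def rep : Representation ℚ K (carrier φ ρ σ) := Representation.ind φ (box ρ σ)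

instance [Finite K] [Module.Finite ℚ V] [Module.Finite ℚ W] :
    Module.Finite ℚ (carrier φ ρ σ) := by
  have : Module.Finite ℚ (MonoidAlgebra ℚ K) :=
    Module.Finite.equiv (MonoidAlgebra.coeffLinearEquiv (S := ℚ) (M := K) ℚ).symm
  exact Module.Finite.of_surjective (P := Representation.IndV φ (box ρ σ))
    (Representation.Coinvariants.mk _)
    (Representation.Coinvariants.mk_surjective _)

noncomputable def ι : V →ₗ[ℚ] W →ₗ[ℚ] carrier φ ρ σ :=
  (TensorProduct.mk ℚ V W).compr₂ (Representation.IndV.mk φ (box ρ σ) 1)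

theorem rep_ι (g : G) (h : H) (v : V) (w : W) :
    rep φ ρ σ (φ (g, h)) (ι φ ρ σ v w) = ι φ ρ σ (ρ g v) (σ h w) := by
  have := Representation.Coinvariants.mk_inv_tmul ((Representation.leftRegular ℚ K).comp φ)
    (box ρ σ) (MonoidAlgebra.single 1 1) (v ⊗ₜ w) (g, h)
  have h2 : rep φ ρ σ (φ (g, h)) (ι φ ρ σ v w) =
      Representation.IndV.mk φ (box ρ σ) (1 * (φ (g, h))⁻¹) (v ⊗ₜ w) :=
    Representation.ind_mk φ (box ρ σ) _ _ _
  rw [h2]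
  refine Eq.trans ?_ this
  simp [-Prod.inv_mk]
  rfl

variable {φ ρ σ}
theorem hom_ext (τ : Representation ℚ K M) {F F' : carrier φ ρ σ →ₗ[ℚ] M}
    (hF : ∀ k x, F (rep φ ρ σ k x) = τ k (F x)) (hF' : ∀ k x, F' (rep φ ρ σ k x) = τ k (F' x))
    (h : ∀ v w, F (ι φ ρ σ v w) = F' (ι φ ρ σ v w)) : F = F' := by
  refine Representation.IndV.hom_ext _ _ fun k => TensorProduct.ext' fun v w => ?_
  have h1 : Representation.IndV.mk φ (box ρ σ) k (v ⊗ₜ w) = rep φ ρ σ k⁻¹ (ι φ ρ σ v w) := by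
    have h2 : rep φ ρ σ k⁻¹ (ι φ ρ σ v w) =
        Representation.IndV.mk φ (box ρ σ) (1 * k⁻¹⁻¹) (v ⊗ₜ w) :=
      Representation.ind_mk φ (box ρ σ) _ _ _
    rw [h2, one_mul, inv_inv]
  change F (Representation.IndV.mk φ (box ρ σ) k (v ⊗ₜ w)) =
    F' (Representation.IndV.mk φ (box ρ σ) k (v ⊗ₜ w))
  rw [h1, hF, hF', h]

variable (φ ρ σ) in
noncomputable def liftAux (τ : Representation ℚ K M) (B : V →ₗ[ℚ] W →ₗ[ℚ] M)
    (hB : ∀ g h v w, B (ρ g v) (σ h w) = τ (φ (g, h)) (B v w)) :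
    Representation.IndV φ (box ρ σ) →ₗ[ℚ] M :=
  Representation.Coinvariants.lift _
    (TensorProduct.lift <| (Finsupp.lift _ _ _ fun h => τ h⁻¹ ∘ₗ TensorProduct.lift B) ∘ₗ
      (MonoidAlgebra.coeffLinearEquiv ℚ).toLinearMap)
    fun g ↦ by
      ext h v w
      simp [box, hB]

theorem liftAux_mk (τ : Representation ℚ K M) (B : V →ₗ[ℚ] W →ₗ[ℚ] M)
    (hB : ∀ g h v w, B (ρ g v) (σ h w) = τ (φ (g, h)) (B v w)) (k : K) (v : V) (w : W) :
    liftAux φ ρ σ τ B hB (Representation.IndV.mk φ (box ρ σ) k (v ⊗ₜ w)) = τ k⁻¹ (B v w) := by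
  simp [liftAux]

variable (φ ρ σ) in
noncomputable def lift (τ : Representation ℚ K M) (B : V →ₗ[ℚ] W →ₗ[ℚ] M)
    (hB : ∀ g h v w, B (ρ g v) (σ h w) = τ (φ (g, h)) (B v w)) : carrier φ ρ σ →ₗ[ℚ] M :=
  liftAux φ ρ σ τ B hB

theorem lift_ι (τ : Representation ℚ K M) (B : V →ₗ[ℚ] W →ₗ[ℚ] M)
    (hB : ∀ g h v w, B (ρ g v) (σ h w) = τ (φ (g, h)) (B v w)) (v : V) (w : W) :
    lift φ ρ σ τ B hB (ι φ ρ σ v w) = B v w :=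
  (liftAux_mk τ B hB 1 v w).trans (by simp)

theorem lift_rep (τ : Representation ℚ K M) (B : V →ₗ[ℚ] W →ₗ[ℚ] M)
    (hB : ∀ g h v w, B (ρ g v) (σ h w) = τ (φ (g, h)) (B v w)) (k : K) (x : carrier φ ρ σ) :
    lift φ ρ σ τ B hB (rep φ ρ σ k x) = τ k (lift φ ρ σ τ B hB x) := by
  have : liftAux φ ρ σ τ B hB ∘ₗ Representation.ind φ (box ρ σ) k =
      τ k ∘ₗ liftAux φ ρ σ τ B hB := by
    refine Representation.IndV.hom_ext _ _ fun l => TensorProduct.ext' fun v w => ?_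
    change liftAux φ ρ σ τ B hB (Representation.ind φ (box ρ σ) k
      (Representation.IndV.mk φ (box ρ σ) l (v ⊗ₜ w))) = τ k (liftAux φ ρ σ τ B hB
      (Representation.IndV.mk φ (box ρ σ) l (v ⊗ₜ w)))
    rw [Representation.ind_mk, liftAux_mk, liftAux_mk, mul_inv_rev, inv_inv, map_mul,
      Module.End.mul_apply]
  exact DFunLike.congr_fun this x
end

section
variable {G H K K' V W : Type*} [Group G] [Group H] [Group K] [Group K']
  [AddCommGroup V] [Module ℚ V] [AddCommGroup W] [Module ℚ W]

/-- Functoriality. -/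
noncomputable def map {V' W' : Type*} [AddCommGroup V'] [Module ℚ V'] [AddCommGroup W']
    [Module ℚ W'] (φ : G × H →* K) {ρ : Representation ℚ G V} {σ : Representation ℚ H W}
    {ρ' : Representation ℚ G V'} {σ' : Representation ℚ H W'}
    (f : V →ₗ[ℚ] V') (hf : ∀ g v, f (ρ g v) = ρ' g (f v))
    (f' : W →ₗ[ℚ] W') (hf' : ∀ g w, f' (σ g w) = σ' g (f' w)) :
    carrier φ ρ σ →ₗ[ℚ] carrier φ ρ' σ' :=
  lift φ ρ σ (rep φ ρ' σ') ((ι φ ρ' σ').compl₁₂ f f') (fun g h v w => by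
    rw [LinearMap.compl₁₂_apply, LinearMap.compl₁₂_apply, rep_ι, hf, hf'])

theorem map_ι {V' W' : Type*} [AddCommGroup V'] [Module ℚ V'] [AddCommGroup W']
    [Module ℚ W'] (φ : G × H →* K) {ρ : Representation ℚ G V} {σ : Representation ℚ H W}
    {ρ' : Representation ℚ G V'} {σ' : Representation ℚ H W'}
    (f : V →ₗ[ℚ] V') (hf : ∀ g v, f (ρ g v) = ρ' g (f v))
    (f' : W →ₗ[ℚ] W') (hf' : ∀ g w, f' (σ g w) = σ' g (f' w)) (v : V) (w : W) :
    map φ f hf f' hf' (ι φ ρ σ v w) = ι φ ρ' σ' (f v) (f' w) := lift_ι _ _ _ v w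

theorem map_rep {V' W' : Type*} [AddCommGroup V'] [Module ℚ V'] [AddCommGroup W']
    [Module ℚ W'] (φ : G × H →* K) {ρ : Representation ℚ G V} {σ : Representation ℚ H W}
    {ρ' : Representation ℚ G V'} {σ' : Representation ℚ H W'}
    (f : V →ₗ[ℚ] V') (hf : ∀ g v, f (ρ g v) = ρ' g (f v))
    (f' : W →ₗ[ℚ] W') (hf' : ∀ g w, f' (σ g w) = σ' g (f' w)) (k : K) (x : carrier φ ρ σ) :
    map φ f hf f' hf' (rep φ ρ σ k x) = rep φ ρ' σ' k (map φ f hf f' hf' x) := lift_rep _ _ _ k x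

theorem exists_comm (φ : G × H →* K) (φ' : H × G →* K') (e : K ≃* K')
    (he : ∀ g h, e (φ (g, h)) = φ' (h, g))
    (ρ : Representation ℚ G V) (σ : Representation ℚ H W) :
    ∃ E : carrier φ ρ σ ≃ₗ[ℚ] carrier φ' σ ρ,
      ∀ k x, E (rep φ ρ σ k x) = rep φ' σ ρ (e k) (E x) := by
  have he' : ∀ g h, e.symm (φ' (h, g)) = φ (g, h) := fun g h => by rw [← he, e.symm_apply_apply]
  let F := lift φ ρ σ ((rep φ' σ ρ).comp e.toMonoidHom) (ι φ' σ ρ).flip (fun g h v w => by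
    change ι φ' σ ρ _ _ = rep φ' σ ρ (e (φ (g, h))) (ι φ' σ ρ _ _)
    rw [he, rep_ι])
  let F' := lift φ' σ ρ ((rep φ ρ σ).comp e.symm.toMonoidHom) (ι φ ρ σ).flip (fun h g w v => by
    change ι φ ρ σ _ _ = rep φ ρ σ (e.symm (φ' (h, g))) (ι φ ρ σ _ _)
    rw [he', rep_ι])
  have hF : ∀ k x, F (rep φ ρ σ k x) = rep φ' σ ρ (e k) (F x) := fun k x => lift_rep _ _ _ k x
  have hF' : ∀ k x, F' (rep φ' σ ρ k x) = rep φ ρ σ (e.symm k) (F' x) :=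
    fun k x => lift_rep _ _ _ k x
  have ι_F : ∀ v w, F (ι φ ρ σ v w) = ι φ' σ ρ w v := fun v w => lift_ι _ _ _ v w
  have ι_F' : ∀ w v, F' (ι φ' σ ρ w v) = ι φ ρ σ v w := fun w v => lift_ι _ _ _ w v
  have h1 : F ∘ₗ F' = LinearMap.id := hom_ext (rep φ' σ ρ) (fun k x => by simp [hF, hF'])
    (fun k x => rfl) (fun w v => by simp [ι_F, ι_F'])
  have h2 : F' ∘ₗ F = LinearMap.id := hom_ext (rep φ ρ σ) (fun k x => by simp [hF, hF'])
    (fun k x => rfl) (fun w v => by simp [ι_F, ι_F'])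
  exact ⟨LinearEquiv.ofLinearMap F F' h1 h2, hF⟩

theorem exists_unit [Subsingleton G] (φ : G × H →* K) (e : K ≃* H)
    (he : ∀ g h, e (φ (g, h)) = h) (σ : Representation ℚ H W) :
    ∃ E : carrier φ (1 : Representation ℚ G ℚ) σ ≃ₗ[ℚ] W,
      ∀ k x, E (rep φ 1 σ k x) = σ (e k) (E x) := by
  let F := lift φ (1 : Representation ℚ G ℚ) σ (σ.comp e.toMonoidHom) (LinearMap.lsmul ℚ W)
    (fun g h c w => by
      change c • σ h w = σ (e (φ (g, h))) (c • w)
      rw [he, map_smul])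
  have hF : ∀ k x, F (rep φ 1 σ k x) = σ (e k) (F x) := fun k x => lift_rep _ _ _ k x
  have ι_F : ∀ c w, F (ι φ 1 σ c w) = c • w := fun c w => lift_ι _ _ _ c w
  let F' : W →ₗ[ℚ] carrier φ (1 : Representation ℚ G ℚ) σ := ι φ 1 σ 1
  have hF' : ∀ h w, F' (σ h w) = rep φ 1 σ (e.symm h) (F' w) := fun h w => by
    have : e.symm h = φ (1, h) := by rw [MulEquiv.symm_apply_eq, he]
    rw [this]
    exact (rep_ι φ (1 : Representation ℚ G ℚ) σ 1 h 1 w).symm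
  refine ⟨LinearEquiv.ofLinearMap F F' ?_ ?_, hF⟩
  · ext w
    simp [F', ι_F]
  · refine hom_ext (rep φ 1 σ) (fun k x => by simp [hF, hF']) (fun k x => rfl) (fun c w => ?_)
    simp only [LinearMap.comp_apply, ι_F, F', LinearMap.id_apply]
    rw [map_smul, ← LinearMap.smul_apply, ← map_smul, smul_eq_mul, mul_one]

end

section assoc
variable {G₁ G₂ G₃ G₁₂ G₂₃ K K' V W U M : Type*} [Group G₁] [Group G₂] [Group G₃] [Group G₁₂]
  [Group G₂₃] [Group K] [Group K'] [AddCommGroup V] [Module ℚ V] [AddCommGroup W] [Module ℚ W]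
  [AddCommGroup U] [Module ℚ U] [AddCommGroup M] [Module ℚ M]

def post (U : Type*) [AddCommGroup U] [Module ℚ U] (τ : Representation ℚ K M) :
    Representation ℚ K (U →ₗ[ℚ] M) where
  toFun k := LinearMap.compRight ℚ (τ k)
  map_one' := by ext; simp
  map_mul' _ _ := by ext; simp

theorem exists_lift₃ (φ₁₂ : G₁ × G₂ →* G₁₂) (φ : G₁₂ × G₃ →* K)
    (ρ : Representation ℚ G₁ V) (σ : Representation ℚ G₂ W) (θ : Representation ℚ G₃ U)
    (τ : Representation ℚ K M) (T : V →ₗ[ℚ] W →ₗ[ℚ] U →ₗ[ℚ] M)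
    (hT : ∀ a b c v w u, T (ρ a v) (σ b w) (θ c u) = τ (φ (φ₁₂ (a, b), c)) (T v w u)) :
    ∃ F : carrier φ (rep φ₁₂ ρ σ) θ →ₗ[ℚ] M,
      (∀ k x, F (rep φ (rep φ₁₂ ρ σ) θ k x) = τ k (F x)) ∧
      ∀ v w u, F (ι φ (rep φ₁₂ ρ σ) θ (ι φ₁₂ ρ σ v w) u) = T v w u := by
  let τ' := (post U τ).comp (φ.comp (MonoidHom.inl G₁₂ G₃))
  let B := lift φ₁₂ ρ σ τ' T (fun a b v w => by
    ext u
    have := hT a b 1 v w u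
    rw [map_one] at this
    exact this)
  have hB : ∀ g x, B (rep φ₁₂ ρ σ g x) = τ' g (B x) := fun g x => lift_rep _ _ _ g x
  have ι_B : ∀ v w, B (ι φ₁₂ ρ σ v w) = T v w := fun v w => lift_ι _ _ _ v w
  have hc : ∀ c x u, B x (θ c u) = τ (φ (1, c)) (B x u) := fun c => by
    have : LinearMap.lcomp ℚ M (θ c) ∘ₗ B = LinearMap.compRight ℚ (τ (φ (1, c))) ∘ₗ B := by
      refine hom_ext τ' (fun g x => ?_) (fun g x => ?_) (fun v w => ?_)
      · ext u
        simp only [LinearMap.comp_apply, hB]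
        rfl
      · ext u
        simp only [LinearMap.comp_apply, hB]
        change τ (φ (1, c)) (τ (φ (g, 1)) (B x u)) = τ (φ (g, 1)) (τ (φ (1, c)) (B x u))
        rw [← Module.End.mul_apply, ← Module.End.mul_apply, ← map_mul, ← map_mul, ← map_mul,
          ← map_mul]
        simp
      · ext u
        have := hT 1 1 c v w u
        simp only [← Prod.one_eq_mk, map_one, Module.End.one_apply] at this
        simpa [ι_B] using this
    intro x u
    exact LinearMap.congr_fun (LinearMap.congr_fun this x) u
  refine ⟨lift φ _ θ τ B (fun g c x u => ?_), fun k x => lift_rep _ _ _ k x, fun v w u => ?_⟩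
  · rw [hB]
    change τ (φ (g, 1)) (B x (θ c u)) = _
    rw [hc, ← Module.End.mul_apply, ← map_mul, ← map_mul]
    simp
  · rw [lift_ι, ι_B]

theorem exists_lift₃' (φ₂₃ : G₂ × G₃ →* G₂₃) (φ : G₁ × G₂₃ →* K)
    (ρ : Representation ℚ G₁ V) (σ : Representation ℚ G₂ W) (θ : Representation ℚ G₃ U)
    (τ : Representation ℚ K M) (T : V →ₗ[ℚ] W →ₗ[ℚ] U →ₗ[ℚ] M)
    (hT : ∀ a b c v w u, T (ρ a v) (σ b w) (θ c u) = τ (φ (a, φ₂₃ (b, c))) (T v w u)) :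
    ∃ F : carrier φ ρ (rep φ₂₃ σ θ) →ₗ[ℚ] M,
      (∀ k x, F (rep φ ρ (rep φ₂₃ σ θ) k x) = τ k (F x)) ∧
      ∀ v w u, F (ι φ ρ (rep φ₂₃ σ θ) v (ι φ₂₃ σ θ w u)) = T v w u := by
  let ψ : G₂₃ × G₁ →* K := φ.comp ((MonoidHom.snd G₂₃ G₁).prod (MonoidHom.fst G₂₃ G₁))
  let T' : W →ₗ[ℚ] U →ₗ[ℚ] V →ₗ[ℚ] M :=
    { toFun w := (T.flip w).flip
      map_add' _ _ := by ext; simp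
      map_smul' _ _ := by ext; simp }
  obtain ⟨F, hF, ι_F⟩ := exists_lift₃ φ₂₃ ψ σ θ ρ τ T' (fun b c a w u v => hT a b c v w u)
  let F' := lift φ ρ (rep φ₂₃ σ θ) (rep ψ (rep φ₂₃ σ θ) ρ) (ι ψ (rep φ₂₃ σ θ) ρ).flip
    (fun a b v w => (rep_ι ψ (rep φ₂₃ σ θ) ρ b a w v).symm)
  have hF'' : ∀ k x, F' (rep φ ρ (rep φ₂₃ σ θ) k x) = rep ψ (rep φ₂₃ σ θ) ρ k (F' x) :=
    fun k x => lift_rep _ _ _ k x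
  have ι_F' : ∀ v x, F' (ι φ ρ (rep φ₂₃ σ θ) v x) = ι ψ (rep φ₂₃ σ θ) ρ x v :=
    fun v x => lift_ι _ _ _ v x
  refine ⟨F ∘ₗ F', fun k x => ?_, fun v w u => ?_⟩
  · rw [LinearMap.comp_apply, hF'', hF, LinearMap.comp_apply]
  · rw [LinearMap.comp_apply, ι_F', ι_F]
    rfl

theorem hom_ext₃ (φ₁₂ : G₁ × G₂ →* G₁₂) (φ : G₁₂ × G₃ →* K)
    (ρ : Representation ℚ G₁ V) (σ : Representation ℚ G₂ W) (θ : Representation ℚ G₃ U)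
    (τ : Representation ℚ K M) {F F' : carrier φ (rep φ₁₂ ρ σ) θ →ₗ[ℚ] M}
    (hF : ∀ k x, F (rep φ (rep φ₁₂ ρ σ) θ k x) = τ k (F x))
    (hF' : ∀ k x, F' (rep φ (rep φ₁₂ ρ σ) θ k x) = τ k (F' x))
    (h : ∀ v w u, F (ι φ _ θ (ι φ₁₂ ρ σ v w) u) = F' (ι φ _ θ (ι φ₁₂ ρ σ v w) u)) : F = F' := by
  refine hom_ext τ hF hF' fun x u => ?_
  have key : ∀ F : carrier φ (rep φ₁₂ ρ σ) θ →ₗ[ℚ] M,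
      (∀ k x, F (rep φ (rep φ₁₂ ρ σ) θ k x) = τ k (F x)) → ∀ (g : G₁₂) (y : carrier φ₁₂ ρ σ),
      (F ∘ₗ (ι φ (rep φ₁₂ ρ σ) θ).flip u) (rep φ₁₂ ρ σ g y) =
        τ (φ (g, 1)) ((F ∘ₗ (ι φ (rep φ₁₂ ρ σ) θ).flip u) y) := by
    intro F hF g y
    have := rep_ι φ (rep φ₁₂ ρ σ) θ g 1 y u
    rw [map_one, Module.End.one_apply] at this
    rw [LinearMap.comp_apply, LinearMap.flip_apply, ← this, hF]
    rfl
  exact LinearMap.congr_fun (hom_ext (τ.comp (φ.comp (MonoidHom.inl G₁₂ G₃)))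
    (F := F ∘ₗ (ι φ (rep φ₁₂ ρ σ) θ).flip u) (F' := F' ∘ₗ (ι φ (rep φ₁₂ ρ σ) θ).flip u)
    (key F hF) (key F' hF') (fun v w => h v w u)) x

theorem hom_ext₃' (φ₂₃ : G₂ × G₃ →* G₂₃) (φ : G₁ × G₂₃ →* K)
    (ρ : Representation ℚ G₁ V) (σ : Representation ℚ G₂ W) (θ : Representation ℚ G₃ U)
    (τ : Representation ℚ K M) {F F' : carrier φ ρ (rep φ₂₃ σ θ) →ₗ[ℚ] M}
    (hF : ∀ k x, F (rep φ ρ (rep φ₂₃ σ θ) k x) = τ k (F x))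
    (hF' : ∀ k x, F' (rep φ ρ (rep φ₂₃ σ θ) k x) = τ k (F' x))
    (h : ∀ v w u, F (ι φ ρ _ v (ι φ₂₃ σ θ w u)) = F' (ι φ ρ _ v (ι φ₂₃ σ θ w u))) : F = F' := by
  refine hom_ext τ hF hF' fun v x => ?_
  have key : ∀ F : carrier φ ρ (rep φ₂₃ σ θ) →ₗ[ℚ] M,
      (∀ k x, F (rep φ ρ (rep φ₂₃ σ θ) k x) = τ k (F x)) → ∀ (g : G₂₃) (y : carrier φ₂₃ σ θ),
      (F ∘ₗ ι φ ρ (rep φ₂₃ σ θ) v) (rep φ₂₃ σ θ g y) =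
        τ (φ (1, g)) ((F ∘ₗ ι φ ρ (rep φ₂₃ σ θ) v) y) := by
    intro F hF g y
    have := rep_ι φ ρ (rep φ₂₃ σ θ) 1 g v y
    rw [map_one, Module.End.one_apply] at this
    rw [LinearMap.comp_apply, ← this, hF]
    rfl
  exact LinearMap.congr_fun (hom_ext (τ.comp (φ.comp (MonoidHom.inr G₁ G₂₃)))
    (F := F ∘ₗ ι φ ρ (rep φ₂₃ σ θ) v) (F' := F' ∘ₗ ι φ ρ (rep φ₂₃ σ θ) v)
    (key F hF) (key F' hF') (fun w u => h v w u)) x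

theorem exists_assoc (φ₁₂ : G₁ × G₂ →* G₁₂) (φ : G₁₂ × G₃ →* K) (φ₂₃ : G₂ × G₃ →* G₂₃)
    (φ' : G₁ × G₂₃ →* K') (e : K ≃* K')
    (he : ∀ a b c, e (φ (φ₁₂ (a, b), c)) = φ' (a, φ₂₃ (b, c)))
    (ρ : Representation ℚ G₁ V) (σ : Representation ℚ G₂ W) (θ : Representation ℚ G₃ U) :
    ∃ E : carrier φ (rep φ₁₂ ρ σ) θ ≃ₗ[ℚ] carrier φ' ρ (rep φ₂₃ σ θ),
      ∀ k x, E (rep φ (rep φ₁₂ ρ σ) θ k x) = rep φ' ρ (rep φ₂₃ σ θ) (e k) (E x) := by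
  have he' : ∀ a b c, e.symm (φ' (a, φ₂₃ (b, c))) = φ (φ₁₂ (a, b), c) := fun a b c => by
    rw [← he, e.symm_apply_apply]
  let T : V →ₗ[ℚ] W →ₗ[ℚ] U →ₗ[ℚ] carrier φ' ρ (rep φ₂₃ σ θ) :=
    { toFun v := (ι φ₂₃ σ θ).compr₂ (ι φ' ρ (rep φ₂₃ σ θ) v)
      map_add' _ _ := by ext; simp
      map_smul' _ _ := by ext; simp }
  obtain ⟨F, hF, ι_F⟩ := exists_lift₃ φ₁₂ φ ρ σ θ
    ((rep φ' ρ (rep φ₂₃ σ θ)).comp e.toMonoidHom) T (fun a b c v w u => by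
      change ι φ' ρ (rep φ₂₃ σ θ) (ρ a v) (ι φ₂₃ σ θ (σ b w) (θ c u)) =
        rep φ' ρ (rep φ₂₃ σ θ) (e (φ (φ₁₂ (a, b), c)))
          (ι φ' ρ (rep φ₂₃ σ θ) v (ι φ₂₃ σ θ w u))
      rw [he, rep_ι, rep_ι])
  obtain ⟨F', hF', ι_F'⟩ := exists_lift₃' φ₂₃ φ' ρ σ θ
    ((rep φ (rep φ₁₂ ρ σ) θ).comp e.symm.toMonoidHom)
    ((ι φ₁₂ ρ σ).compr₂ (ι φ (rep φ₁₂ ρ σ) θ)) (fun a b c v w u => by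
      change ι φ (rep φ₁₂ ρ σ) θ (ι φ₁₂ ρ σ (ρ a v) (σ b w)) (θ c u) =
        rep φ (rep φ₁₂ ρ σ) θ (e.symm (φ' (a, φ₂₃ (b, c))))
          (ι φ (rep φ₁₂ ρ σ) θ (ι φ₁₂ ρ σ v w) u)
      rw [he', rep_ι, rep_ι])
  replace hF : ∀ k x, F (rep φ (rep φ₁₂ ρ σ) θ k x) = rep φ' ρ (rep φ₂₃ σ θ) (e k) (F x) := hF
  replace hF' : ∀ k x, F' (rep φ' ρ (rep φ₂₃ σ θ) k x) =
    rep φ (rep φ₁₂ ρ σ) θ (e.symm k) (F' x) := hF'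
  replace ι_F : ∀ v w u, F (ι φ (rep φ₁₂ ρ σ) θ (ι φ₁₂ ρ σ v w) u) =
    ι φ' ρ (rep φ₂₃ σ θ) v (ι φ₂₃ σ θ w u) := ι_F
  replace ι_F' : ∀ v w u, F' (ι φ' ρ (rep φ₂₃ σ θ) v (ι φ₂₃ σ θ w u)) =
    ι φ (rep φ₁₂ ρ σ) θ (ι φ₁₂ ρ σ v w) u := ι_F'
  refine ⟨LinearEquiv.ofLinearMap F F' ?_ ?_, hF⟩
  · exact hom_ext₃' φ₂₃ φ' ρ σ θ (rep φ' ρ (rep φ₂₃ σ θ))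
      (fun k x => by rw [LinearMap.comp_apply, hF', hF, e.apply_symm_apply, LinearMap.comp_apply])
      (fun k x => rfl)
      (fun v w u => by rw [LinearMap.comp_apply, ι_F', ι_F, LinearMap.id_apply])
  · exact hom_ext₃ φ₁₂ φ ρ σ θ (rep φ (rep φ₁₂ ρ σ) θ)
      (fun k x => by rw [LinearMap.comp_apply, hF, hF', e.symm_apply_apply, LinearMap.comp_apply])
      (fun k x => rfl)
      (fun v w u => by rw [LinearMap.comp_apply, ι_F, ι_F', LinearMap.id_apply])

end assoc
end IndProd

namespace FDRep
variable {G : Type} [Group G]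

/-- The underlying linear map of a morphism of representations. -/
def linMap {V W : FDRep ℚ G} (f : V ⟶ W) : V →ₗ[ℚ] W := f.hom.hom.hom

theorem linMap_comm {V W : FDRep ℚ G} (f : V ⟶ W) (g : G) (v : V) :
    linMap f (V.ρ g v) = W.ρ g (linMap f v) :=
  ConcreteCategory.congr_hom ((forget (FGModuleCat ℚ)).congr_map (f.comm g)) v

/-- A morphism of representations from an equivariant linear map. -/
def mkHom {V W : FDRep ℚ G} (L : V →ₗ[ℚ] W) (hL : ∀ g v, L (V.ρ g v) = W.ρ g (L v)) : V ⟶ W :=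
  ⟨InducedCategory.homMk (ModuleCat.ofHom L), fun g => by
    ext v
    exact hL g v⟩

theorem linMap_injective {V W : FDRep ℚ G} {f g : V ⟶ W} (h : linMap f = linMap g) : f = g := by
  ext v
  exact LinearMap.congr_fun h v

theorem linMap_id {V : FDRep ℚ G} (v : V) : linMap (𝟙 V) v = v := rfl

theorem linMap_comp {V W U : FDRep ℚ G} (f : V ⟶ W) (g : W ⟶ U) (v : V) :
    linMap (f ≫ g) v = linMap g (linMap f v) := rfl

theorem linMap_add {V W : FDRep ℚ G} (f g : V ⟶ W) (v : V) :
    linMap (f + g) v = linMap f v + linMap g v := rfl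

def mkIso {V W : FDRep ℚ G} (L : V ≃ₗ[ℚ] W) (hL : ∀ g v, L (V.ρ g v) = W.ρ g (L v)) : V ≅ W where
  hom := mkHom L.toLinearMap hL
  inv := mkHom L.symm.toLinearMap (fun g w => by
    change L.symm (W.ρ g w) = V.ρ g (L.symm w)
    rw [LinearEquiv.symm_apply_eq, hL, L.apply_symm_apply])
  hom_inv_id := linMap_injective (LinearMap.ext fun v => L.symm_apply_apply v)
  inv_hom_id := linMap_injective (LinearMap.ext fun v => L.apply_symm_apply v)

end FDRep

/-- The inclusion of the product of two symmetric groups by acting on two consecutive blocks. -/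
def blockHom (p q : ℕ) :
    Equiv.Perm (Fin p) × Equiv.Perm (Fin q) →* Equiv.Perm (Fin (p + q)) :=
  finSumFinEquiv.permCongrHom.toMonoidHom.comp (Equiv.Perm.sumCongrHom (Fin p) (Fin q))

theorem blockHom_castAdd {p q : ℕ} (g : Equiv.Perm (Fin p)) (h : Equiv.Perm (Fin q)) (i : Fin p) :
    blockHom p q (g, h) (Fin.castAdd q i) = Fin.castAdd q (g i) := by
  simp [blockHom, Equiv.permCongrHom, Equiv.permCongr_apply]

theorem blockHom_natAdd {p q : ℕ} (g : Equiv.Perm (Fin p)) (h : Equiv.Perm (Fin q)) (i : Fin q) :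
    blockHom p q (g, h) (Fin.natAdd p i) = Fin.natAdd p (h i) := by
  simp [blockHom, Equiv.permCongrHom, Equiv.permCongr_apply]

theorem finCongr_permCongr_blockHom_zero {q : ℕ} (g : Equiv.Perm (Fin 0))
    (h : Equiv.Perm (Fin q)) : (finCongr (zero_add q)).permCongr (blockHom 0 q (g, h)) = h := by
  ext i
  rw [Equiv.permCongr_apply, show (finCongr (zero_add q)).symm i = Fin.natAdd 0 i by
    ext; simp, blockHom_natAdd]
  simp

theorem finAddFlip_permCongr_blockHom {p q : ℕ} (g : Equiv.Perm (Fin p))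
    (h : Equiv.Perm (Fin q)) :
    finAddFlip.permCongr (blockHom p q (g, h)) = blockHom q p (h, g) := by
  ext1 i
  rw [Equiv.permCongr_apply]
  induction i using Fin.addCases with
  | left i =>
    rw [blockHom_castAdd, show finAddFlip.symm (Fin.castAdd p i) = Fin.natAdd p i by
      rw [Equiv.symm_apply_eq, finAddFlip_apply_natAdd], blockHom_natAdd, finAddFlip_apply_natAdd]
  | right i =>
    rw [blockHom_natAdd, show finAddFlip.symm (Fin.natAdd q i) = Fin.castAdd q i by
      rw [Equiv.symm_apply_eq, finAddFlip_apply_castAdd], blockHom_castAdd,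
      finAddFlip_apply_castAdd]

theorem finCongr_permCongr_blockHom_assoc {p q r : ℕ} (a : Equiv.Perm (Fin p))
    (b : Equiv.Perm (Fin q)) (c : Equiv.Perm (Fin r)) :
    (finCongr (add_assoc p q r)).permCongr (blockHom (p + q) r (blockHom p q (a, b), c)) =
      blockHom p (q + r) (a, blockHom q r (b, c)) := by
  ext i : 1
  obtain ⟨i, rfl⟩ := (finCongr (add_assoc p q r)).surjective i
  rw [Equiv.permCongr_apply, Equiv.symm_apply_apply]
  induction i using Fin.addCases with
  | left i =>
    induction i using Fin.addCases with
    | left i =>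
      have hj : ∀ j : Fin p, finCongr (add_assoc p q r) (Fin.castAdd r (Fin.castAdd q j)) =
          Fin.castAdd (q + r) j := fun j => by ext; simp
      rw [blockHom_castAdd, blockHom_castAdd, hj, hj, blockHom_castAdd]
    | right i =>
      have hj : ∀ j : Fin q, finCongr (add_assoc p q r) (Fin.castAdd r (Fin.natAdd p j)) =
          Fin.natAdd p (Fin.castAdd r j) := fun j => by ext; simp
      rw [blockHom_castAdd, blockHom_natAdd, hj, hj, blockHom_natAdd, blockHom_castAdd]
  | right i =>
    have hj : ∀ j : Fin r, finCongr (add_assoc p q r) (Fin.natAdd (p + q) j) =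
        Fin.natAdd p (Fin.natAdd q j) := fun j => by ext; simp [add_assoc]
    rw [blockHom_natAdd, hj, hj, blockHom_natAdd, blockHom_natAdd]

/-- The induction product `Ind (V ⊗ W)` of representations of two symmetric groups. -/
noncomputable def indProd {p q : ℕ} (V : FDRep ℚ (Equiv.Perm (Fin p)))
    (W : FDRep ℚ (Equiv.Perm (Fin q))) : FDRep ℚ (Equiv.Perm (Fin (p + q))) :=
  FDRep.of (IndProd.rep (blockHom p q) V.ρ W.ρ)

namespace indProd
variable {p q : ℕ}

noncomputable def ι (V : FDRep ℚ (Equiv.Perm (Fin p))) (W : FDRep ℚ (Equiv.Perm (Fin q))) :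
    V →ₗ[ℚ] W →ₗ[ℚ] (indProd V W) := IndProd.ι (blockHom p q) V.ρ W.ρ

theorem hom_ext {V : FDRep ℚ (Equiv.Perm (Fin p))} {W : FDRep ℚ (Equiv.Perm (Fin q))}
    {M : FDRep ℚ (Equiv.Perm (Fin (p + q)))} {F F' : indProd V W ⟶ M}
    (h : ∀ v w, FDRep.linMap F (ι V W v w) = FDRep.linMap F' (ι V W v w)) : F = F' :=
  FDRep.linMap_injective (IndProd.hom_ext M.ρ (FDRep.linMap_comm F) (FDRep.linMap_comm F') h)

variable {V V' V'' : FDRep ℚ (Equiv.Perm (Fin p))} {W W' W'' : FDRep ℚ (Equiv.Perm (Fin q))}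

noncomputable def mapLin (f : V ⟶ V') (g : W ⟶ W') : (indProd V W) →ₗ[ℚ] (indProd V' W') :=
  IndProd.map (blockHom p q) (FDRep.linMap f) (FDRep.linMap_comm f)
    (FDRep.linMap g) (FDRep.linMap_comm g)

noncomputable def map (f : V ⟶ V') (g : W ⟶ W') : indProd V W ⟶ indProd V' W' :=
  FDRep.mkHom (mapLin f g) (IndProd.map_rep (blockHom p q) _ (FDRep.linMap_comm f) _ (FDRep.linMap_comm g))

theorem linMap_map (f : V ⟶ V') (g : W ⟶ W') (v : V) (w : W) :
    FDRep.linMap (map f g) (ι V W v w) = ι V' W' (FDRep.linMap f v) (FDRep.linMap g w) :=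
  IndProd.map_ι (blockHom p q) _ (FDRep.linMap_comm f) _ (FDRep.linMap_comm g) v w

theorem map_id : map (𝟙 V) (𝟙 W) = 𝟙 (indProd V W) :=
  hom_ext fun v w => by simp only [linMap_map, FDRep.linMap_id]

theorem map_comp (f : V ⟶ V') (g : W ⟶ W') (f' : V' ⟶ V'') (g' : W' ⟶ W'') :
    map (f ≫ f') (g ≫ g') = map f g ≫ map f' g' :=
  hom_ext fun v w => by simp only [linMap_map, FDRep.linMap_comp]

theorem map_add_left (f f' : V ⟶ V') (g : W ⟶ W') : map (f + f') g = map f g + map f' g :=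
  hom_ext fun v w => by simp only [linMap_map, FDRep.linMap_add, LinearMap.map_add₂]

theorem map_add_right (f : V ⟶ V') (g g' : W ⟶ W') : map f (g + g') = map f g + map f g' :=
  hom_ext fun v w => by simp only [linMap_map, FDRep.linMap_add, map_add]

/-- Induction product with a fixed left factor. -/
noncomputable def left (V : FDRep ℚ (Equiv.Perm (Fin p))) :
    FDRep ℚ (Equiv.Perm (Fin q)) ⥤ FDRep ℚ (Equiv.Perm (Fin (p + q))) where
  obj W := indProd V W
  map g := map (𝟙 V) g
  map_id _ := map_id
  map_comp f g := by rw [← map_comp, Category.comp_id]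

/-- Induction product with a fixed right factor. -/
noncomputable def right (W : FDRep ℚ (Equiv.Perm (Fin q))) :
    FDRep ℚ (Equiv.Perm (Fin p)) ⥤ FDRep ℚ (Equiv.Perm (Fin (p + q))) where
  obj V := indProd V W
  map f := map f (𝟙 W)
  map_id _ := map_id
  map_comp f g := by rw [← map_comp, Category.comp_id]

instance (V : FDRep ℚ (Equiv.Perm (Fin p))) : (left (q := q) V).Additive where
  map_add := map_add_right _ _ _

instance (W : FDRep ℚ (Equiv.Perm (Fin q))) : (right (p := p) W).Additive where
  map_add := map_add_left _ _ _

end indProd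

theorem K0.cl_map_of_additive {G H : Type} [Group G] [Finite G] [Group H] 
    (F : FDRep ℚ G ⥤ FDRep ℚ H) [F.Additive] (S : ShortComplex (FDRep ℚ G)) (hS : S.ShortExact) :
    K0.cl (F.obj S.X₂) = K0.cl (F.obj S.X₁) + K0.cl (F.obj S.X₃) :=
  K0.cl_eq_add (S.map F) (hS.splittingOfInjective.map F).shortExact

/-- The Grothendieck group of finite-dimensional rational representations of the `n`-th symmetric
group. -/
abbrev RepK0 (n : ℕ) := K0 (FDRep ℚ (Equiv.Perm (Fin n)))

namespace RepK0

theorem cl_indProd_left {p q : ℕ} (V : FDRep ℚ (Equiv.Perm (Fin p)))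
    (S : ShortComplex (FDRep ℚ (Equiv.Perm (Fin q)))) (hS : S.ShortExact) :
    K0.cl (indProd V S.X₂) = K0.cl (indProd V S.X₁) + K0.cl (indProd V S.X₃) :=
  K0.cl_map_of_additive (indProd.left V) S hS

theorem cl_indProd_right {p q : ℕ} (S : ShortComplex (FDRep ℚ (Equiv.Perm (Fin p))))
    (hS : S.ShortExact) (W : FDRep ℚ (Equiv.Perm (Fin q))) :
    K0.cl (indProd S.X₂ W) = K0.cl (indProd S.X₁ W) + K0.cl (indProd S.X₃ W) :=
  K0.cl_map_of_additive (indProd.right W) S hS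

/-- The product on representation classes, `[V] [W] = [Ind (V ⊗ W)]`. -/
noncomputable def mulHom (p q : ℕ) : RepK0 p →+ RepK0 q →+ RepK0 (p + q) :=
  K0.lift (fun V => K0.lift (fun W => K0.cl (indProd V W))
    (cl_indProd_left V)) fun S hS => by
    ext W
    rw [AddMonoidHom.add_apply, K0.lift_cl, K0.lift_cl, K0.lift_cl]
    exact cl_indProd_right S hS W

theorem mulHom_cl {p q : ℕ} (V : FDRep ℚ (Equiv.Perm (Fin p)))
    (W : FDRep ℚ (Equiv.Perm (Fin q))) :
    mulHom p q (K0.cl V) (K0.cl W) = K0.cl (indProd V W) := by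
  rw [mulHom, K0.lift_cl, K0.lift_cl]

/-- The class of the trivial representation of the symmetric group on no letters. -/
noncomputable def unit : RepK0 0 :=
  K0.cl (FDRep.of (1 : Representation ℚ (Equiv.Perm (Fin 0)) ℚ))

noncomputable def castHom {m n : ℕ} (h : m = n) : RepK0 m →+ RepK0 n := h ▸ AddMonoidHom.id _

theorem mk_eq_of_castHom {m n : ℕ} (h : m = n) {a : RepK0 m} {b : RepK0 n}
    (hab : castHom h a = b) : (GradedMonoid.mk m a : GradedMonoid RepK0) = GradedMonoid.mk n b := by
  subst h hab
  rfl

theorem castHom_cl {m n : ℕ} (h : m = n) (ε : Fin m ≃ Fin n)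
    (V : FDRep ℚ (Equiv.Perm (Fin m))) (W : FDRep ℚ (Equiv.Perm (Fin n))) (E : V ≃ₗ[ℚ] W)
    (hE : ∀ g v, E (V.ρ g v) = W.ρ (ε.permCongr g) (E v)) :
    castHom h (K0.cl V) = K0.cl W := by
  subst h
  change K0.cl V = K0.cl W
  have h1 : ∀ x, W.ρ ε.symm (W.ρ ε x) = x := fun x => by
    rw [← Module.End.mul_apply, ← map_mul, show ε.symm * ε = 1 from ε.self_trans_symm, map_one,
      Module.End.one_apply]
  have h2 : ∀ x, W.ρ ε (W.ρ ε.symm x) = x := fun x => by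
    rw [← Module.End.mul_apply, ← map_mul, show ε * ε.symm = 1 from ε.symm_trans_self, map_one,
      Module.End.one_apply]
  let L : W ≃ₗ[ℚ] W := LinearEquiv.ofLinearMap (W.ρ ε.symm) (W.ρ ε)
    (LinearMap.ext h1) (LinearMap.ext h2)
  let E' : V ≃ₗ[ℚ] W := E.trans L
  refine K0.cl_eq_of_iso (FDRep.mkIso E' (fun g v => ?_))
  change W.ρ ε.symm (E (V.ρ g v)) = W.ρ g (W.ρ ε.symm (E v))
  rw [hE, ← Module.End.mul_apply, ← Module.End.mul_apply, ← map_mul, ← map_mul]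
  refine congrArg (fun k => W.ρ k (E v)) ?_
  ext i
  simp

theorem one_mul {q : ℕ} (b : RepK0 q) : castHom (zero_add q) (mulHom 0 q unit b) = b := by
  induction b using K0.induction_on with
  | h W =>
    rw [unit, mulHom_cl]
    obtain ⟨E, hE⟩ := IndProd.exists_unit (blockHom 0 q)
      (finCongr (zero_add q)).permCongrHom finCongr_permCongr_blockHom_zero W.ρ
    exact castHom_cl _ (finCongr (zero_add q)) _ _ E hE
  | hadd a b ha hb => rw [map_add, map_add, ha, hb]
  | hneg a ha => rw [map_neg, map_neg, ha]

theorem mul_comm {p q : ℕ} (a : RepK0 p) (b : RepK0 q) :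
    castHom (add_comm p q) (mulHom p q a b) = mulHom q p b a := by
  induction a using K0.induction_on with
  | h V =>
    induction b using K0.induction_on with
    | h W =>
      rw [mulHom_cl, mulHom_cl]
      obtain ⟨E, hE⟩ := IndProd.exists_comm (blockHom p q) (blockHom q p)
        finAddFlip.permCongrHom finAddFlip_permCongr_blockHom V.ρ W.ρ
      exact castHom_cl _ finAddFlip _ _ E hE
    | hadd a b ha hb => simp only [map_add, ha, hb, AddMonoidHom.add_apply]
    | hneg a ha => simp only [map_neg, ha, AddMonoidHom.neg_apply]
  | hadd a b ha hb => simp only [map_add, ha, hb, AddMonoidHom.add_apply]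
  | hneg a ha => simp only [map_neg, ha, AddMonoidHom.neg_apply]

theorem mul_assoc {p q r : ℕ} (a : RepK0 p) (b : RepK0 q) (c : RepK0 r) :
    castHom (add_assoc p q r) (mulHom (p + q) r (mulHom p q a b) c) =
      mulHom p (q + r) a (mulHom q r b c) := by
  induction a using K0.induction_on with
  | h V =>
    induction b using K0.induction_on with
    | h W =>
      induction c using K0.induction_on with
      | h U =>
        rw [mulHom_cl, mulHom_cl, mulHom_cl, mulHom_cl]
        obtain ⟨E, hE⟩ := IndProd.exists_assoc (blockHom p q) (blockHom (p + q) r)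
          (blockHom q r) (blockHom p (q + r)) (finCongr (add_assoc p q r)).permCongrHom
          finCongr_permCongr_blockHom_assoc V.ρ W.ρ U.ρ
        exact castHom_cl _ (finCongr (add_assoc p q r)) _ _ E hE
      | hadd a b ha hb => simp only [map_add, ha, hb, AddMonoidHom.add_apply]
      | hneg a ha => simp only [map_neg, ha, AddMonoidHom.neg_apply]
    | hadd a b ha hb => simp only [map_add, ha, hb, AddMonoidHom.add_apply]
    | hneg a ha => simp only [map_neg, ha, AddMonoidHom.neg_apply]
  | hadd a b ha hb => simp only [map_add, ha, hb, AddMonoidHom.add_apply]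
  | hneg a ha => simp only [map_neg, ha, AddMonoidHom.neg_apply]

noncomputable instance : GradedMonoid.GMul RepK0 where
  mul {p q} a b := mulHom p q a b

noncomputable instance : GradedMonoid.GOne RepK0 where
  one := unit

noncomputable instance : DirectSum.GCommRing RepK0 where
  mul_zero a := map_zero (mulHom _ _ a)
  zero_mul b := DFunLike.congr_fun (map_zero (mulHom _ _)) b
  mul_add a := map_add (mulHom _ _ a)
  add_mul a b c := DFunLike.congr_fun (map_add (mulHom _ _) a b) c
  one_mul a := mk_eq_of_castHom (zero_add _) (one_mul a.2)
  mul_one a := (mk_eq_of_castHom (add_comm _ _) (mul_comm a.2 unit)).trans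
    (mk_eq_of_castHom (zero_add _) (one_mul a.2))
  mul_assoc a b c := mk_eq_of_castHom (add_assoc _ _ _) (mul_assoc a.2 b.2 c.2)
  mul_comm a b := mk_eq_of_castHom (add_comm _ _) (mul_comm a.2 b.2)
  natCast n := n • unit
  natCast_zero := zero_smul _ _
  natCast_succ n := succ_nsmul _ _
  intCast n := n • unit
  intCast_ofNat n := natCast_zsmul _ _
  intCast_negSucc_ofNat n := by simp [negSucc_zsmul]

end RepK0

/-- The ring of rational representations of all symmetric groups, with the induction product. -/
abbrev RepRing := DirectSum ℕ RepK0

/-! ### Schur functors -/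

namespace Nat.Partition
variable {n : ℕ} (π : n.Partition)

/-- The parts of a partition, as a weakly decreasing composition. -/
def toComposition : Composition n where
  blocks := π.parts.sort (· ≥ ·)
  blocks_pos {i} hi := π.parts_pos ((Multiset.mem_sort _).1 hi)
  blocks_sum := by
    rw [← Multiset.sum_coe, Multiset.sort_eq, π.parts_sum]

/-- The row of the `j`-th box of the Young diagram, boxes being numbered row by row. -/
def row (j : Fin n) : ℕ := π.toComposition.index j

/-- The column of the `j`-th box of the Young diagram, boxes being numbered row by row. -/
def col (j : Fin n) : ℕ := π.toComposition.invEmbedding j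

/-- The sum of the permutations preserving the rows. -/
noncomputable def rowSymmetrizer : MonoidAlgebra ℚ (Equiv.Perm (Fin n)) :=
  ∑ σ : Equiv.Perm (Fin n) with ∀ j, π.row (σ j) = π.row j, MonoidAlgebra.single σ 1

/-- The signed sum of the permutations preserving the columns. -/
noncomputable def colAntisymmetrizer : MonoidAlgebra ℚ (Equiv.Perm (Fin n)) :=
  ∑ σ : Equiv.Perm (Fin n) with ∀ j, π.col (σ j) = π.col j,
    MonoidAlgebra.single σ ((Equiv.Perm.sign σ : ℤ) : ℚ)

/-- The Young symmetrizer. -/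
noncomputable def youngSymmetrizer : MonoidAlgebra ℚ (Equiv.Perm (Fin n)) :=
  π.rowSymmetrizer * π.colAntisymmetrizer

/-- The left ideal generated by the Young symmetrizer. -/
noncomputable def spechtSubmodule : Submodule ℚ (MonoidAlgebra ℚ (Equiv.Perm (Fin n))) :=
  LinearMap.range (LinearMap.mulRight ℚ π.youngSymmetrizer)

theorem mul_mem_spechtSubmodule (a : MonoidAlgebra ℚ (Equiv.Perm (Fin n)))
    {x : MonoidAlgebra ℚ (Equiv.Perm (Fin n))} (hx : x ∈ π.spechtSubmodule) :
    a * x ∈ π.spechtSubmodule := by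
  obtain ⟨y, rfl⟩ := hx
  exact ⟨a * y, by simp [mul_assoc]⟩

/-- The action of the symmetric group on this left ideal, by left multiplication. -/
noncomputable def spechtRep : Representation ℚ (Equiv.Perm (Fin n)) π.spechtSubmodule where
  toFun g := (LinearMap.mulLeft ℚ (MonoidAlgebra.single g 1)).restrict
    fun _ hx => π.mul_mem_spechtSubmodule _ hx
  map_one' := by
    ext x
    simp [← MonoidAlgebra.one_def]
  map_mul' g h := by
    ext1 x
    apply Subtype.ext
    change MonoidAlgebra.single (g * h) 1 * x.1 =
      MonoidAlgebra.single g 1 * (MonoidAlgebra.single h 1 * x.1)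
    rw [← mul_assoc, MonoidAlgebra.single_mul_single, mul_one]

instance : Module.Finite ℚ π.spechtSubmodule := by
  have : Module.Finite ℚ (MonoidAlgebra ℚ (Equiv.Perm (Fin n))) :=
    Module.Finite.equiv (MonoidAlgebra.coeffLinearEquiv (S := ℚ) (M := Equiv.Perm (Fin n)) ℚ).symm
  exact Module.Finite.range _

/-- The irreducible representation `V_π` of the symmetric group. -/
noncomputable def specht : FDRep ℚ (Equiv.Perm (Fin n)) := FDRep.of π.spechtRep

/-- The primitive idempotent `e_π` of the group algebra with `ℚ[Σ_n] e_π = V_π`: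
the Young symmetrizer multiplied by `dim V_π / n!`. -/
noncomputable def youngIdempotent : MonoidAlgebra ℚ (Equiv.Perm (Fin n)) :=
  ((Module.finrank ℚ π.spechtSubmodule : ℚ) / (n.factorial : ℚ)) • π.youngSymmetrizer

end Nat.Partition

section
variable {A : Type u} [Category.{v} A] [Abelian A] [Linear ℚ A] [MonoidalCategory A]
  [SymmetricCategory A]

/-- The action of the group algebra of the symmetric group on `X^{⊗n}`. -/
noncomputable def tensorPow.algHom (X : A) (n : ℕ) :
    MonoidAlgebra ℚ (Equiv.Perm (Fin n)) →ₐ[ℚ] End (tensorPow X n) :=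
  MonoidAlgebra.lift ℚ _ _ (tensorPow.permHom X n)

/-- The Schur functor `S_π` on objects: the image of `e_π` acting on `X^{⊗n}`. -/
noncomputable def schurObj {n : ℕ} (π : n.Partition) (X : A) : A :=
  image (show tensorPow X n ⟶ tensorPow X n from tensorPow.algHom X n π.youngIdempotent)

/-- `λ_Σ(X) = ∑_μ cl (S_μ X) ⊗ cl (V_μ) t^{|μ|}`, the sum being over all partitions of all `n`. -/
noncomputable def lambdaSigma [MonoidalPreadditive A] [BiexactTensor A] (X : A) :
    PowerSeries (K0 A ⊗[ℤ] RepRing) :=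
  PowerSeries.mk fun n => ∑ μ : n.Partition,
    K0.cl (schurObj μ X) ⊗ₜ[ℤ] DirectSum.of RepK0 n (K0.cl μ.specht)

end

/-! ### Combinatorics of Young diagrams -/

namespace Nat.Partition
variable {n : ℕ} (π : n.Partition)

/-! The tensor power `Y^{⊗n}` has a `Σ_n`-stable filtration by the number of tensor factors lying in
`X`. Because `⊗` is biexact, its graded pieces are the weight pieces of `(X ⊕ Z)^{⊗n}`, the `k`-th
one being the sum of the tensor words with `k` letters `X` and `n - k` letters `Z`. Cutting with an
idempotent `e` of `ℚ[Σ_n]` is exact, so the class of the `e`-part of `Y^{⊗n}` is the sum of the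
classes of the `e`-parts of the weight pieces (`K0.clIm_act_eq_sum`). That sum involves only `X` and
`Z`, and the split sequence gives the same sum; this is the equality of the classes of Schur
functors.

The weight `k` piece is induced from `X^{⊗k} ⊗ Z^{⊗l}` along `Σ_k × Σ_l ⊆ Σ_n`. Hence its `e_π`-part
contains `S_α(X) ⊗ S_β(Z)` with multiplicity `dim e_π ℚ[Σ_n] (e_α e_β)` (`K0.clIm_wt_comp_act`). The
same number is the multiplicity of `V_π` in `Ind (V_α ⊗ V_β)` (`cl_indProd_specht`). This is
Frobenius reciprocity, and the numbers themselves never have to be computed. Tensoring with `cl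
(V_π)` and summing over `π` gives the multiplicativity of `λ_Σ` on exact sequences
(`lambdaSigma_eq_mul`). The constant coefficient is `1`, so the series are units, and the universal
property of `K0` yields the homomorphism.

Both multiplicities come from one statement on algebras. If the `f s` form an `IsSplitFamily` in a
finite-dimensional algebra `D`, every idempotent `e` is a sum of orthogonal idempotents equivalent
to the `f s`, with `dim e D f_s` of them equivalent to `f s` (`IsSplitFamily.exists_decomposition`).
In any action of `D` the class of the image of `e` is then the corresponding combination of the
classes of the images of the `f s` (`K0.clIm_eq_sum_finrank`).

The Young idempotents form such a family (`Nat.Partition.isSplitFamily_youngIdempotent`).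
Orthogonality and primitivity follow from the combinatorics of rows and columns; that they generate
the unit ideal follows because there are as many of them as conjugacy classes. -/

theorem blocksFun_antitone : Antitone π.toComposition.blocksFun := by
  have h : (π.parts.sort (· ≥ ·)).Pairwise (· ≥ ·) := Multiset.pairwise_sort _ _
  intro r s hrs
  rcases hrs.eq_or_lt with rfl | hlt
  · exact le_rfl
  · exact List.pairwise_iff_getElem.1 h r s _ _ hlt

theorem eq_of_row_of_col {i j : Fin n} (hr : π.row i = π.row j) (hc : π.col i = π.col j) :
    i = j := by
  have hr' : π.toComposition.index i = π.toComposition.index j := Fin.ext hr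
  have h := π.toComposition.coe_invEmbedding i
  have h' := π.toComposition.coe_invEmbedding j
  have h1 := π.toComposition.sizeUpTo_index_le i
  have h2 := π.toComposition.sizeUpTo_index_le j
  have h3 := congrArg (fun k : Fin _ => π.toComposition.sizeUpTo k) hr'
  have hc' : (π.toComposition.invEmbedding i : ℕ) = π.toComposition.invEmbedding j := hc
  ext
  omega

/-- Rows weakly decrease in length, so the diagram contains every box above and to the left of one
of its boxes. -/
theorem exists_row_col {j : Fin n} {r c : ℕ} (hr : r ≤ π.row j) (hc : c ≤ π.col j) :
    ∃ i, π.row i = r ∧ π.col i = c := by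
  have hj : π.row j < π.toComposition.length := (π.toComposition.index j).2
  have hcj : π.col j < π.toComposition.blocksFun (π.toComposition.index j) :=
    (π.toComposition.invEmbedding j).2
  let r' : Fin π.toComposition.length := ⟨r, hr.trans_lt hj⟩
  have hle : π.toComposition.blocksFun (π.toComposition.index j) ≤ π.toComposition.blocksFun r' :=
    π.blocksFun_antitone hr
  let c' : Fin (π.toComposition.blocksFun r') := ⟨c, by omega⟩
  refine ⟨π.toComposition.embedding r' c', ?_, ?_⟩
  · change ((π.toComposition.index _ : Fin _) : ℕ) = r
    rw [Composition.index_embedding]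
  · exact π.toComposition.invEmbedding_comp r' c'

theorem card_row_eq (r : ℕ) :
    (Finset.univ.filter fun j => π.row j = r).card = (π.toComposition.blocks[r]?).getD 0 := by
  rcases lt_or_ge r π.toComposition.length with h | h
  · have h0 : r < π.toComposition.blocks.length := h
    rw [List.getElem?_eq_getElem h0, Option.getD_some]
    have : (Finset.univ.filter fun j => π.row j = r) =
        Finset.univ.map (π.toComposition.embedding ⟨r, h⟩).toEmbedding := by
      ext j
      simp only [Finset.mem_filter, Finset.mem_univ, true_and, Finset.mem_map]
      constructor
      · intro hj
        have h2 : π.toComposition.index j = ⟨r, h⟩ := Fin.ext hj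
        have := π.toComposition.mem_range_embedding j
        rw [h2] at this
        obtain ⟨a, ha⟩ := this
        exact ⟨a, ha⟩
      · rintro ⟨a, rfl⟩
        exact congrArg Fin.val (π.toComposition.index_embedding ⟨r, h⟩ a)
    rw [this, Finset.card_map, Finset.card_univ, Fintype.card_fin]
    rfl
  · have h0 : π.toComposition.blocks.length ≤ r := h
    rw [List.getElem?_eq_none h0, Option.getD_none, Finset.card_eq_zero, Finset.filter_eq_empty_iff]
    intro j _ hj
    have : π.row j < π.toComposition.length := (π.toComposition.index j).2
    omega

theorem eq_of_card_row_lt {π ρ : n.Partition}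
    (h : ∀ m, (Finset.univ.filter fun j => π.row j < m).card =
      (Finset.univ.filter fun j => ρ.row j < m).card) : π = ρ := by
  have key : ∀ (σ : n.Partition) (m : ℕ), (Finset.univ.filter fun j => σ.row j < m + 1).card =
      (Finset.univ.filter fun j => σ.row j < m).card +
        (Finset.univ.filter fun j => σ.row j = m).card := by
    intro σ m
    rw [← Finset.card_union_of_disjoint, ← Finset.filter_or]
    · simp only [Nat.lt_succ_iff_lt_or_eq]
    · rw [Finset.disjoint_filter]
      intro j _ h1 h2
      omega
  have h1 : ∀ m : ℕ, (π.toComposition.blocks[m]?).getD 0 = (ρ.toComposition.blocks[m]?).getD 0 := by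
    intro m
    rw [← card_row_eq, ← card_row_eq]
    have := h (m + 1)
    rw [key, key, h m] at this
    omega
  have h2 : π.toComposition.blocks = ρ.toComposition.blocks := by
    refine List.ext_getElem? fun m => ?_
    -- Blocks are positive, so the default value `0` of `getD` occurs only past the end of the list.
    have pos : ∀ (σ : n.Partition) (x : ℕ), σ.toComposition.blocks[m]? = some x → 0 < x :=
      fun σ x hx => σ.toComposition.blocks_pos (List.mem_of_getElem? (l := σ.toComposition.blocks) (i := m) hx)
    have := h1 m
    cases ha : π.toComposition.blocks[m]? with
    | none =>
      cases hb : ρ.toComposition.blocks[m]? with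
      | none => rfl
      | some y =>
        have := pos ρ y hb
        simp_all
    | some x =>
      have h3 := pos π x ha
      cases hb : ρ.toComposition.blocks[m]? with
      | none => simp_all
      | some y => simp_all
  have h3 : ((π.parts.sort (· ≥ ·) : List ℕ) : Multiset ℕ) = (ρ.parts.sort (· ≥ ·) : List ℕ) :=
    congrArg _ h2
  rw [Multiset.sort_eq, Multiset.sort_eq] at h3
  exact Nat.Partition.ext h3

end Nat.Partition

/-! ### Counting boxes column by column. -/

section columns
variable {ι : Type*} [Fintype ι] {c r R : ι → ℕ}

/-- `R` and `c` are the row and column numbers of a diagram, whose columns are initial segments by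
`hdown`; `r` is another labelling without repetition inside a column. A column reaching row `m` has
at least `m` boxes with `R < m`, while `r` takes at most `m` values below `m`. A column not reaching
row `m` is counted entirely by `R`. -/
theorem card_column_lt_le (hr : ∀ i j, r i = r j → c i = c j → i = j)
    (hdown : ∀ j, ∀ x ≤ R j, ∃ i, R i = x ∧ c i = c j) (x m : ℕ) :
    (Finset.univ.filter fun i => c i = x ∧ r i < m).card ≤
      (Finset.univ.filter fun i => c i = x ∧ R i < m).card := by
  by_cases h : ∃ j, c j = x ∧ m ≤ R j
  · obtain ⟨j, hj, hm⟩ := h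
    calc (Finset.univ.filter fun i => c i = x ∧ r i < m).card
        = ((Finset.univ.filter fun i => c i = x ∧ r i < m).image r).card := by
          refine (Finset.card_image_of_injOn fun a ha b hb hab => ?_).symm
          simp only [Finset.coe_filter, Finset.mem_univ, true_and, Set.mem_ofPred_eq] at ha hb
          exact hr a b hab (ha.1.trans hb.1.symm)
      _ ≤ (Finset.range m).card := by
          refine Finset.card_le_card fun y hy => ?_
          simp only [Finset.mem_image, Finset.mem_filter, Finset.mem_univ, true_and] at hy
          obtain ⟨a, ha, rfl⟩ := hy
          exact Finset.mem_range.2 ha.2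
      _ ≤ ((Finset.univ.filter fun i => c i = x ∧ R i < m).image R).card := by
          refine Finset.card_le_card fun y hy => ?_
          rw [Finset.mem_range] at hy
          obtain ⟨i, hi, hi'⟩ := hdown j y (by omega)
          simp only [Finset.mem_image, Finset.mem_filter, Finset.mem_univ, true_and]
          exact ⟨i, ⟨hi'.trans hj, by omega⟩, hi⟩
      _ ≤ _ := Finset.card_image_le
  · push Not at h
    refine Finset.card_le_card fun i hi => ?_
    simp only [Finset.mem_filter, Finset.mem_univ, true_and] at hi ⊢
    exact ⟨hi.1, h i hi.1⟩

theorem card_lt_eq_sum_columns (f : ι → ℕ) (m : ℕ) :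
    (Finset.univ.filter fun i => f i < m).card =
      ∑ x ∈ Finset.univ.image c, (Finset.univ.filter fun i => c i = x ∧ f i < m).card := by
  rw [Finset.card_eq_sum_card_fiberwise (f := c) (t := Finset.univ.image c)
    (fun i _ => Finset.mem_coe.2 (Finset.mem_image_of_mem c (Finset.mem_univ i)))]
  refine Finset.sum_congr rfl fun x _ => ?_
  rw [Finset.filter_filter]
  simp only [and_comm]

/-- This is the dominance inequality between partial sums of row lengths, obtained by summing over
the columns. -/
theorem card_lt_le (hr : ∀ i j, r i = r j → c i = c j → i = j)
    (hdown : ∀ j, ∀ x ≤ R j, ∃ i, R i = x ∧ c i = c j) (m : ℕ) :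
    (Finset.univ.filter fun i => r i < m).card ≤ (Finset.univ.filter fun i => R i < m).card := by
  rw [card_lt_eq_sum_columns (c := c) r, card_lt_eq_sum_columns (c := c) R]
  exact Finset.sum_le_sum fun x _ => card_column_lt_le hr hdown x m

/-- Equality of the partial sums forces equality in every column. If the column of `i` had no box in
row `r i`, it would end above that row, and `R` would count all its boxes, `i` included, whereas `r`
does not count `i`. -/
theorem exists_box_of_card_lt_eq (hr : ∀ i j, r i = r j → c i = c j → i = j)
    (hdown : ∀ j, ∀ x ≤ R j, ∃ i, R i = x ∧ c i = c j)
    (h : ∀ m, (Finset.univ.filter fun i => r i < m).card =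
      (Finset.univ.filter fun i => R i < m).card) (i : ι) :
    ∃ k, R k = r i ∧ c k = c i := by
  by_contra! hk
  have hlt : ∀ k, c k = c i → R k < r i := by
    intro k hck
    by_contra! hle
    obtain ⟨k', h1, h2⟩ := hdown k _ hle
    exact hk k' h1 (h2.trans hck)
  have heq := h (r i)
  rw [card_lt_eq_sum_columns (c := c) r, card_lt_eq_sum_columns (c := c) R] at heq
  have h2 := (Finset.sum_eq_sum_iff_of_le
    (fun x _ => card_column_lt_le hr hdown x (r i))).1 heq (c i)
    (Finset.mem_image_of_mem c (Finset.mem_univ i))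
  have h3 : (Finset.univ.filter fun k => c k = c i ∧ r k < r i) =
      Finset.univ.filter fun k => c k = c i ∧ R k < r i := by
    refine Finset.eq_of_subset_of_card_le (fun k hk => ?_) h2.ge
    simp only [Finset.mem_filter, Finset.mem_univ, true_and] at hk ⊢
    exact ⟨hk.1, hlt k hk.1⟩
  have h4 : i ∈ Finset.univ.filter fun k => c k = c i ∧ R k < r i := by
    simp [hlt i rfl]
  rw [← h3] at h4
  simp at h4

end columns

/-! ### Permutations separating rows by columns. -/

namespace Nat.Partition
variable {n : ℕ}

/-- Each of the two hypotheses gives one dominance inequality, and dominance is antisymmetric. -/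
theorem eq_of_separated {π ρ : n.Partition} (g h : Equiv.Perm (Fin n))
    (hg : ∀ i j, π.row i = π.row j → ρ.col (g i) = ρ.col (g j) → i = j)
    (hh : ∀ i j, ρ.row i = ρ.row j → π.col (h i) = π.col (h j) → i = j) : π = ρ := by
  have key : ∀ {π ρ : n.Partition} (g : Equiv.Perm (Fin n))
      (_ : ∀ i j, π.row i = π.row j → ρ.col (g i) = ρ.col (g j) → i = j) (m : ℕ),
      (Finset.univ.filter fun j => π.row j < m).card ≤
        (Finset.univ.filter fun j => ρ.row j < m).card := by
    intro π ρ g hg m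
    have h1 := card_lt_le (c := fun i => ρ.col (g i)) (r := π.row) (R := fun i => ρ.row (g i)) hg
      (fun j x hx => by
        obtain ⟨i, hi⟩ := ρ.exists_row_col hx le_rfl
        exact ⟨g.symm i, by simpa using hi⟩) m
    refine h1.trans (le_of_eq ?_)
    exact Finset.card_equiv g (by simp)
  exact eq_of_card_row_lt fun m => le_antisymm (key g hg m) (key h hh m)

/-- Von Neumann's lemma on tableaux. The permutation `p` moves `i` to the box in the row of `i` and
the column of `g i`; that box exists because the dominance inequality is an equality here. Then `g *
p⁻¹` preserves columns. -/
theorem exists_mul_eq_of_separated (π : n.Partition) (g : Equiv.Perm (Fin n))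
    (hg : ∀ i j, π.row i = π.row j → π.col (g i) = π.col (g j) → i = j) :
    ∃ p q : Equiv.Perm (Fin n), (∀ j, π.row (p j) = π.row j) ∧ (∀ j, π.col (q j) = π.col j) ∧
      q * p = g := by
  have h1 := exists_box_of_card_lt_eq (c := fun i => π.col (g i)) (r := π.row)
    (R := fun i => π.row (g i)) hg
    (fun j x hx => by
      obtain ⟨i, hi⟩ := π.exists_row_col hx le_rfl
      exact ⟨g.symm i, by simpa using hi⟩)
    (fun m => Finset.card_equiv g.symm (by simp))
  choose k hk hk' using h1
  have inj : Function.Injective fun i => g (k i) := by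
    intro i j hij
    have hij' : k i = k j := g.injective hij
    exact hg i j (by rw [← hk i, ← hk j, hij']) (by rw [← hk' i, ← hk' j, hij'])
  let p : Equiv.Perm (Fin n) := Equiv.ofBijective _ (Finite.injective_iff_bijective.1 inj)
  refine ⟨p, g * p⁻¹, hk, fun j => ?_, by simp⟩
  have := hk' (p⁻¹ j)
  have h2 : g (k (p⁻¹ j)) = j := p.apply_symm_apply j
  rw [h2] at this
  rw [Equiv.Perm.mul_apply, ← this]

end Nat.Partition

/-- A family of pairwise non-equivalent absolutely primitive idempotents generating the unit
ideal: the algebra is then split semisimple, and the family represents all simple modules. -/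
structure IsSplitFamily {D σ : Type*} [Ring D] [Algebra ℚ D] (f : σ → D) : Prop where
  idem : ∀ s, f s * f s = f s
  orth : ∀ s t, s ≠ t → ∀ a, f s * a * f t = 0
  prim : ∀ s a, ∃ k : ℚ, f s * a * f s = k • f s
  full : (1 : D) ∈ Submodule.span ℚ {x | ∃ s a b, x = a * f s * b}

/-! ### Group algebras -/

namespace MonoidAlgebra

/-- The basis of the group algebra given by the group elements. -/
noncomputable def groupBasis (G : Type*) : Module.Basis G ℚ (MonoidAlgebra ℚ G) :=
  ⟨MonoidAlgebra.coeffLinearEquiv ℚ⟩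

theorem groupBasis_apply {G : Type*} (g : G) : groupBasis G g = MonoidAlgebra.single g (1 : ℚ) := rfl

theorem groupBasis_repr {G : Type*} (x : MonoidAlgebra ℚ G) (g : G) : (groupBasis G).repr x g = x.coeff g := rfl

variable {G : Type*} [Group G]

instance module_finite [Finite G] : Module.Finite ℚ (MonoidAlgebra ℚ G) :=
  Module.Finite.of_basis (groupBasis G)

/-- In the basis of group elements every diagonal entry of the matrix is the coefficient of `x` at
`1`. -/
theorem trace_mulRight [Fintype G] (x : MonoidAlgebra ℚ G) :
    LinearMap.trace ℚ _ (LinearMap.mulRight ℚ x) = Fintype.card G * x.coeff 1 := by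
  classical
  rw [LinearMap.trace_eq_matrix_trace ℚ (groupBasis G), Matrix.trace]
  have : ∀ g, (LinearMap.toMatrix (groupBasis G) (groupBasis G) (LinearMap.mulRight ℚ x)).diag g =
      x.coeff 1 := by
    intro g
    rw [Matrix.diag_apply, LinearMap.toMatrix_apply, groupBasis_repr, groupBasis_apply,
      LinearMap.mulRight_apply, coeff_single_mul_apply]
    simp
  rw [Finset.sum_congr rfl fun g _ => this g]
  simp

/-- By Maschke's theorem the left ideal generated by `z` has a complement `J`. Writing `1 = a z + j`
gives `z = z j`, because `z a z = a z z = 0`, so `z` lies in both summands. -/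
theorem eq_zero_of_central_of_mul_self [Finite G] {z : MonoidAlgebra ℚ G} (hz : ∀ x, x * z = z * x)
    (h : z * z = 0) : z = 0 := by
  have : NeZero (Nat.card G : ℚ) := ⟨Nat.cast_ne_zero.2 Nat.card_pos.ne'⟩
  obtain ⟨J, hJ⟩ := exists_isCompl (Ideal.span {z})
  have h1 : (1 : MonoidAlgebra ℚ G) ∈ Ideal.span {z} ⊔ J := by rw [hJ.sup_eq_top]; trivial
  obtain ⟨y, hy, j, hj, hyj⟩ := Submodule.mem_sup.1 h1
  obtain ⟨a, rfl⟩ := Ideal.mem_span_singleton'.1 hy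
  have h2 : z = z * j := by
    calc z = z * (a * z + j) := by rw [hyj, mul_one]
      _ = z * j := by rw [mul_add, ← mul_assoc, ← hz a, mul_assoc a, h, mul_zero, zero_add]
  have h3 : z ∈ J := by rw [h2]; exact J.mul_mem_left z hj
  have h4 := Submodule.disjoint_def.1 hJ.disjoint z (Ideal.mem_span_singleton_self z) h3
  exact h4

theorem central_of_single {z : MonoidAlgebra ℚ G} (h : ∀ g : G, single g 1 * z = z * single g 1)
    (x : MonoidAlgebra ℚ G) : x * z = z * x := by
  induction x using MonoidAlgebra.induction_linear with
  | zero => simp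
  | add x y hx hy => rw [add_mul, mul_add, hx, hy]
  | single g r =>
    have : single g r = r • single g (1 : ℚ) := by simp
    rw [this, smul_mul_assoc, mul_smul_comm, h]

theorem central_sum_conj [Fintype G] (x : MonoidAlgebra ℚ G) (y : MonoidAlgebra ℚ G) :
    y * (∑ g : G, single g (1 : ℚ) * x * single g⁻¹ 1) =
      (∑ g : G, single g (1 : ℚ) * x * single g⁻¹ 1) * y := by
  refine central_of_single (fun h => ?_) y
  rw [Finset.mul_sum, Finset.sum_mul]
  refine Fintype.sum_equiv (Equiv.mulLeft h) _ _ fun g => ?_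
  simp [← mul_assoc, single_mul_single]
  simp [mul_assoc, single_mul_single]

end MonoidAlgebra

namespace Equiv.Perm
variable {n : ℕ}

/-- Central elements of the group algebra of a symmetric group, from functions on partitions. -/
noncomputable def classFunction (n : ℕ) :
    ((Fintype.card (Fin n)).Partition → ℚ) →ₗ[ℚ] MonoidAlgebra ℚ (Equiv.Perm (Fin n)) where
  toFun F := ∑ g : Equiv.Perm (Fin n), MonoidAlgebra.single g (F g.partition)
  map_add' _ _ := by simp [MonoidAlgebra.single_add, Finset.sum_add_distrib]
  map_smul' _ _ := by simp [Finset.smul_sum]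

/-- A central element is constant on conjugacy classes, which are classified by cycle type. This
bounds the dimension of the centre by the number of partitions. -/
theorem mem_range_classFunction {z : MonoidAlgebra ℚ (Equiv.Perm (Fin n))}
    (hz : ∀ x, x * z = z * x) : z ∈ LinearMap.range (classFunction n) := by
  have hconj : ∀ g h : Equiv.Perm (Fin n), g.partition = h.partition →
      z.coeff g = z.coeff h := by
    intro g h hgh
    obtain ⟨c, hc⟩ := isConj_iff.1 (Equiv.Perm.partition_eq_of_isConj.2 hgh)
    have := congrArg (fun x => MonoidAlgebra.coeff x (c * g)) (hz (MonoidAlgebra.single c 1))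
    rw [MonoidAlgebra.coeff_single_mul_apply, MonoidAlgebra.coeff_mul_single_apply, hc] at this
    simpa using this
  classical
  refine ⟨fun p => if h : ∃ g : Equiv.Perm (Fin n), g.partition = p then z.coeff h.choose else 0,
    ?_⟩
  have : ∀ g : Equiv.Perm (Fin n), (if h : ∃ h : Equiv.Perm (Fin n), h.partition = g.partition
      then z.coeff h.choose else 0) = z.coeff g := by
    intro g
    have h : ∃ h : Equiv.Perm (Fin n), h.partition = g.partition := ⟨g, rfl⟩
    rw [dif_pos h]
    exact hconj _ _ h.choose_spec
  change ∑ g : Equiv.Perm (Fin n), MonoidAlgebra.single g _ = z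
  simp only [this]
  conv_rhs => rw [← MonoidAlgebra.sum_coeff_single z]
  exact (Finsupp.sum_fintype _ _ (by simp)).symm

end Equiv.Perm

/-! ### Young symmetrizers -/

namespace Nat.Partition
variable {n : ℕ} (π ρ : n.Partition)

open MonoidAlgebra (single)

theorem single_mul_rowSymmetrizer {p : Equiv.Perm (Fin n)} (hp : ∀ j, π.row (p j) = π.row j) :
    single p 1 * π.rowSymmetrizer = π.rowSymmetrizer := by
  rw [rowSymmetrizer, Finset.mul_sum]
  refine Finset.sum_equiv (Equiv.mulLeft p) (fun g => ?_) fun g _ => ?_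
  · simp [hp]
  · simp [MonoidAlgebra.single_mul_single]

theorem rowSymmetrizer_mul_single {p : Equiv.Perm (Fin n)} (hp : ∀ j, π.row (p j) = π.row j) :
    π.rowSymmetrizer * single p 1 = π.rowSymmetrizer := by
  rw [rowSymmetrizer, Finset.sum_mul]
  refine Finset.sum_equiv (Equiv.mulRight p) (fun g => ?_) fun g _ => ?_
  · simp only [Finset.mem_filter, Finset.mem_univ, true_and, Equiv.coe_mulRight,
      Equiv.Perm.mul_apply]
    refine ⟨fun h j => by rw [h, hp], fun h j => ?_⟩
    have h1 := h (p⁻¹ j)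
    have h2 := hp (p⁻¹ j)
    have h3 : p (p⁻¹ j) = j := p.apply_symm_apply j
    rw [h3] at h1 h2
    rw [h1, ← h2]
  · simp [MonoidAlgebra.single_mul_single]

theorem single_mul_colAntisymmetrizer {q : Equiv.Perm (Fin n)}
    (hq : ∀ j, π.col (q j) = π.col j) :
    single q 1 * π.colAntisymmetrizer =
      ((Equiv.Perm.sign q : ℤ) : ℚ) • π.colAntisymmetrizer := by
  rw [colAntisymmetrizer, Finset.mul_sum, Finset.smul_sum]
  refine Finset.sum_equiv (Equiv.mulLeft q) (fun g => ?_) fun g _ => ?_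
  · simp [hq]
  · simp only [MonoidAlgebra.single_mul_single, Equiv.coe_mulLeft, Equiv.Perm.sign_mul,
      MonoidAlgebra.smul_single, one_mul, smul_eq_mul, ← mul_assoc,
      ← Int.cast_mul, ← Units.val_mul, Int.units_mul_self]

theorem colAntisymmetrizer_mul_single {q : Equiv.Perm (Fin n)}
    (hq : ∀ j, π.col (q j) = π.col j) :
    π.colAntisymmetrizer * single q 1 =
      ((Equiv.Perm.sign q : ℤ) : ℚ) • π.colAntisymmetrizer := by
  rw [colAntisymmetrizer, Finset.sum_mul, Finset.smul_sum]
  refine Finset.sum_equiv (Equiv.mulRight q) (fun g => ?_) fun g _ => ?_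
  · simp only [Finset.mem_filter, Finset.mem_univ, true_and, Equiv.coe_mulRight,
      Equiv.Perm.mul_apply]
    refine ⟨fun h j => by rw [h, hq], fun h j => ?_⟩
    have h1 := h (q⁻¹ j)
    have h2 := hq (q⁻¹ j)
    have h3 : q (q⁻¹ j) = j := q.apply_symm_apply j
    rw [h3] at h1 h2
    rw [h1, ← h2]
  · simp only [MonoidAlgebra.single_mul_single, Equiv.coe_mulRight, Equiv.Perm.sign_mul,
      MonoidAlgebra.smul_single, mul_one, smul_eq_mul, ← Int.cast_mul, ← Units.val_mul]
    rw [mul_comm (Equiv.Perm.sign g), ← mul_assoc, Int.units_mul_self, one_mul]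

/-- No two points in the same row for `π` are moved by `g` to the same column for `ρ`. -/
def Separated (g : Equiv.Perm (Fin n)) : Prop :=
  ∀ i j, π.row i = π.row j → ρ.col (g i) = ρ.col (g j) → i = j

variable {π ρ}

theorem row_swap {i j : Fin n} (h : π.row i = π.row j) (k : Fin n) :
    π.row (Equiv.swap i j k) = π.row k := by
  rw [Equiv.swap_apply_def]
  split_ifs with h1 h2
  · rw [h1, h]
  · rw [h2, h]
  · rfl

theorem col_swap {i j : Fin n} (h : π.col i = π.col j) (k : Fin n) :
    π.col (Equiv.swap i j k) = π.col k := by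
  rw [Equiv.swap_apply_def]
  split_ifs with h1 h2
  · rw [h1, h]
  · rw [h2, h]
  · rfl

/-- If `g` moves two points of one row to one column, their transposition is absorbed by the row
symmetrizer; carried across `g` it becomes a transposition which the column antisymmetrizer turns
into a sign. The product equals its own negative. -/
theorem colAntisymmetrizer_mul_single_mul_rowSymmetrizer {g : Equiv.Perm (Fin n)}
    (h : ¬ Separated π ρ g) : ρ.colAntisymmetrizer * single g 1 * π.rowSymmetrizer = 0 := by
  simp only [Separated, not_forall] at h
  obtain ⟨i, j, hr, hc, hij⟩ := h
  have h1 : single g (1 : ℚ) * single (Equiv.swap i j) 1 =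
      single (Equiv.swap (g i) (g j)) 1 * single g 1 := by
    rw [MonoidAlgebra.single_mul_single, MonoidAlgebra.single_mul_single,
      Equiv.mul_swap_eq_swap_mul]
  have h2 : ρ.colAntisymmetrizer * single g 1 * π.rowSymmetrizer =
      -(ρ.colAntisymmetrizer * single g 1 * π.rowSymmetrizer) := by
    conv_lhs => rw [← π.single_mul_rowSymmetrizer (row_swap hr), ← mul_assoc,
      mul_assoc _ (single g 1), h1, ← mul_assoc, ρ.colAntisymmetrizer_mul_single (col_swap hc)]
    simp [Equiv.Perm.sign_swap (fun h => hij (g.injective h))]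
  have := IsAddTorsionFree.of_module_rat (MonoidAlgebra ℚ (Equiv.Perm (Fin n)))
  exact self_eq_neg.1 h2

theorem rowSymmetrizer_mul_single_mul_colAntisymmetrizer {g : Equiv.Perm (Fin n)}
    (h : ¬ Separated π ρ g⁻¹) : π.rowSymmetrizer * single g 1 * ρ.colAntisymmetrizer = 0 := by
  simp only [Separated, not_forall] at h
  obtain ⟨i, j, hr, hc, hij⟩ := h
  have h1 : single (Equiv.swap i j) 1 * single g (1 : ℚ) =
      single g 1 * single (Equiv.swap (g⁻¹ i) (g⁻¹ j)) 1 := by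
    rw [MonoidAlgebra.single_mul_single, MonoidAlgebra.single_mul_single,
      Equiv.mul_swap_eq_swap_mul]
    simp
  have h2 : π.rowSymmetrizer * single g 1 * ρ.colAntisymmetrizer =
      -(π.rowSymmetrizer * single g 1 * ρ.colAntisymmetrizer) := by
    conv_lhs => rw [← π.rowSymmetrizer_mul_single (row_swap hr), mul_assoc π.rowSymmetrizer,
      h1, mul_assoc, mul_assoc, ρ.single_mul_colAntisymmetrizer (col_swap hc)]
    rw [Equiv.Perm.sign_swap (fun h => hij (g⁻¹.injective h))]
    simp [mul_assoc]
  have := IsAddTorsionFree.of_module_rat (MonoidAlgebra ℚ (Equiv.Perm (Fin n)))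
  exact self_eq_neg.1 h2

theorem mul_mul_eq_zero_of_single {a b : MonoidAlgebra ℚ (Equiv.Perm (Fin n))}
    (h : ∀ g, a * single g 1 * b = 0) (x : MonoidAlgebra ℚ (Equiv.Perm (Fin n))) :
    a * x * b = 0 := by
  induction x using MonoidAlgebra.induction_linear with
  | zero => simp
  | add x y hx hy => rw [mul_add, add_mul, hx, hy, add_zero]
  | single g r =>
    have : single g r = r • single g (1 : ℚ) := by simp
    rw [this, mul_smul_comm, smul_mul_assoc, h, smul_zero]

/-- By `eq_of_separated`, separating permutations cannot exist in both directions when `π ≠ ρ`. So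
either the column antisymmetrizer of `π` annihilates the row symmetrizer of `ρ`, or the row
symmetrizer of `π` annihilates the column antisymmetrizer of `ρ`, whatever is put in between. -/
theorem youngSymmetrizer_mul_mul_of_ne (h : π ≠ ρ) (x : MonoidAlgebra ℚ (Equiv.Perm (Fin n))) :
    π.youngSymmetrizer * x * ρ.youngSymmetrizer = 0 := by
  by_cases h1 : ∃ g, Separated π ρ g
  · obtain ⟨g, hg⟩ := h1
    have h2 : ∀ g, ¬ Separated ρ π g := fun g' hg' => h (eq_of_separated g g' hg hg')
    have h3 := mul_mul_eq_zero_of_single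
      (fun g => colAntisymmetrizer_mul_single_mul_rowSymmetrizer (h2 g)) x
    rw [youngSymmetrizer, youngSymmetrizer, ← mul_assoc, mul_assoc π.rowSymmetrizer,
      mul_assoc π.rowSymmetrizer, h3, mul_zero, zero_mul]
  · push Not at h1
    have h3 := mul_mul_eq_zero_of_single
      (fun g => rowSymmetrizer_mul_single_mul_colAntisymmetrizer (h1 g⁻¹))
      (π.colAntisymmetrizer * x * ρ.rowSymmetrizer)
    simpa only [youngSymmetrizer, mul_assoc] using h3

/-- A group element whose inverse is separating is a row permutation times a column permutation and
contributes a sign; every other group element contributes zero. -/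
theorem exists_rowSymmetrizer_mul_mul (x : MonoidAlgebra ℚ (Equiv.Perm (Fin n))) :
    ∃ k : ℚ, π.rowSymmetrizer * x * π.colAntisymmetrizer = k • π.youngSymmetrizer := by
  induction x using MonoidAlgebra.induction_linear with
  | zero => exact ⟨0, by simp⟩
  | add x y hx hy =>
    obtain ⟨k, hk⟩ := hx
    obtain ⟨l, hl⟩ := hy
    exact ⟨k + l, by rw [mul_add, add_mul, hk, hl, add_smul]⟩
  | single g r =>
    have hr : single g r = r • single g (1 : ℚ) := by simp
    by_cases h : Separated π π g⁻¹
    · obtain ⟨p, q, hp, hq, hpq⟩ := exists_mul_eq_of_separated π g⁻¹ h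
      have hg : g = p⁻¹ * q⁻¹ := by rw [← mul_inv_rev, hpq, inv_inv]
      have hp' : ∀ j, π.row (p⁻¹ j) = π.row j := fun j => by
        rw [← hp (p⁻¹ j), show p (p⁻¹ j) = j from p.apply_symm_apply j]
      have hq' : ∀ j, π.col (q⁻¹ j) = π.col j := fun j => by
        rw [← hq (q⁻¹ j), show q (q⁻¹ j) = j from q.apply_symm_apply j]
      refine ⟨r * ((Equiv.Perm.sign q⁻¹ : ℤ) : ℚ), ?_⟩
      have hs : single g (1 : ℚ) = single p⁻¹ 1 * single q⁻¹ 1 := by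
        rw [MonoidAlgebra.single_mul_single, hg, one_mul]
      rw [hr, hs, mul_smul_comm, smul_mul_assoc, ← mul_assoc, π.rowSymmetrizer_mul_single hp',
        mul_assoc, π.single_mul_colAntisymmetrizer hq', mul_smul_comm, smul_smul,
        youngSymmetrizer]
    · exact ⟨0, by
        rw [hr, mul_smul_comm, smul_mul_assoc,
          rowSymmetrizer_mul_single_mul_colAntisymmetrizer h, smul_zero, zero_smul]⟩

theorem exists_youngSymmetrizer_mul_mul (x : MonoidAlgebra ℚ (Equiv.Perm (Fin n))) :
    ∃ k : ℚ, π.youngSymmetrizer * x * π.youngSymmetrizer = k • π.youngSymmetrizer := by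
  obtain ⟨k, hk⟩ := exists_rowSymmetrizer_mul_mul (π := π)
    (π.colAntisymmetrizer * x * π.rowSymmetrizer)
  refine ⟨k, ?_⟩
  rw [← hk]
  simp only [youngSymmetrizer, mul_assoc]

/-- A permutation preserving both rows and columns is trivial, so only one pair of factors has
product `1`. -/
theorem youngSymmetrizer_coeff_one : π.youngSymmetrizer.coeff 1 = 1 := by
  classical
  have h : ∀ p q : Equiv.Perm (Fin n), (∀ j, π.row (p j) = π.row j) →
      (∀ j, π.col (q j) = π.col j) → (p * q = 1 ↔ p = 1 ∧ q = 1) := by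
    intro p q hp hq
    refine ⟨fun hpq => ?_, fun ⟨h1, h2⟩ => by rw [h1, h2, one_mul]⟩
    have hq1 : q = 1 := by
      ext1 j
      refine π.eq_of_row_of_col ?_ (hq j)
      rw [← hp (q j), ← Equiv.Perm.mul_apply, hpq]
    exact ⟨by rw [hq1, mul_one] at hpq; exact hpq, hq1⟩
  rw [youngSymmetrizer, rowSymmetrizer, colAntisymmetrizer, Finset.sum_mul_sum]
  simp only [MonoidAlgebra.single_mul_single, MonoidAlgebra.coeff_sum, one_mul,
    Finsupp.finsetSum_apply, MonoidAlgebra.coeff_single, Finsupp.single_apply]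
  rw [Finset.sum_eq_single 1, Finset.sum_eq_single 1]
  · simp
  · intro q hq hq1
    rw [if_neg]
    rw [one_mul]
    exact hq1
  · simp
  · intro p hp hp1
    refine Finset.sum_eq_zero fun q hq => ?_
    rw [if_neg]
    intro hpq
    exact hp1 ((h p q (by simpa using hp) (by simpa using hq)).1 hpq).1
  · simp

/-- The trace of right multiplication by the Young symmetrizer is `n!`, because the coefficient at
`1` is `1`. The range of this map is the Specht module, where it acts as the scalar `k`, so the
trace is also `k` times the dimension. -/
theorem youngSymmetrizer_mul_self_aux : ∃ k : ℚ,
    π.youngSymmetrizer * π.youngSymmetrizer = k • π.youngSymmetrizer ∧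
      k * Module.finrank ℚ π.spechtSubmodule = n.factorial := by
  obtain ⟨k, hk⟩ := exists_youngSymmetrizer_mul_mul (π := π) 1
  rw [mul_one] at hk
  refine ⟨k, hk, ?_⟩
  have h1 := MonoidAlgebra.trace_mulRight π.youngSymmetrizer
  rw [youngSymmetrizer_coeff_one, mul_one, Fintype.card_perm, Fintype.card_fin] at h1
  have hf : ∀ x, LinearMap.mulRight ℚ π.youngSymmetrizer x ∈ π.spechtSubmodule := fun x => ⟨x, rfl⟩
  have h2 := LinearMap.trace_restrict_eq_of_forall_mem π.spechtSubmodule _ hf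
  have h3 : (LinearMap.mulRight ℚ π.youngSymmetrizer).restrict (fun x _ => hf x) =
      (k • LinearMap.id : π.spechtSubmodule →ₗ[ℚ] π.spechtSubmodule) := by
    ext1 ⟨x, y, hy⟩
    apply Subtype.ext
    simp only [LinearMap.coe_restrict_apply, LinearMap.smul_apply, LinearMap.id_apply,
      LinearMap.mulRight_apply, Submodule.coe_smul] at hy ⊢
    rw [← hy, mul_assoc, hk, mul_smul_comm]
  rw [h1, h3, map_smul, LinearMap.trace_id] at h2
  exact h2

theorem finrank_spechtSubmodule_ne_zero : (Module.finrank ℚ π.spechtSubmodule : ℚ) ≠ 0 := by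
  obtain ⟨k, -, hk⟩ := youngSymmetrizer_mul_self_aux (π := π)
  intro h
  rw [h, mul_zero] at hk
  exact Nat.cast_ne_zero.2 n.factorial_ne_zero hk.symm

theorem youngIdempotent_mul_self : π.youngIdempotent * π.youngIdempotent = π.youngIdempotent := by
  obtain ⟨k, h1, h2⟩ := youngSymmetrizer_mul_self_aux (π := π)
  have h3 : (n.factorial : ℚ) ≠ 0 := Nat.cast_ne_zero.2 n.factorial_ne_zero
  rw [youngIdempotent, smul_mul_smul_comm, h1, smul_smul]
  congr 1
  field_simp
  rw [← h2]
  ring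

theorem youngSymmetrizer_eq_smul : ∃ k : ℚ, π.youngSymmetrizer = k • π.youngIdempotent := by
  have h3 : (n.factorial : ℚ) ≠ 0 := Nat.cast_ne_zero.2 n.factorial_ne_zero
  refine ⟨((Module.finrank ℚ π.spechtSubmodule : ℚ) / (n.factorial : ℚ))⁻¹, ?_⟩
  rw [youngIdempotent, smul_smul, inv_mul_cancel₀, one_smul]
  exact div_ne_zero finrank_spechtSubmodule_ne_zero h3

variable (π) in
/-- The sum of the conjugates of the Young symmetrizer. -/
noncomputable def centralYoung : MonoidAlgebra ℚ (Equiv.Perm (Fin n)) :=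
  ∑ g : Equiv.Perm (Fin n), single g (1 : ℚ) * π.youngSymmetrizer * single g⁻¹ 1

theorem centralYoung_comm (x : MonoidAlgebra ℚ (Equiv.Perm (Fin n))) :
    x * π.centralYoung = π.centralYoung * x := MonoidAlgebra.central_sum_conj _ _

/-- Conjugation does not change the coefficient at `1`, so the sum of the conjugates has coefficient
`n!` there. -/
theorem centralYoung_ne_zero : π.centralYoung ≠ 0 := by
  intro h
  have h1 := congrArg (fun x => MonoidAlgebra.coeff x 1) h
  have h2 : ∀ g : Equiv.Perm (Fin n),
      (single g (1 : ℚ) * π.youngSymmetrizer * single g⁻¹ 1).coeff 1 = 1 := by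
    intro g
    rw [MonoidAlgebra.coeff_mul_single_apply, MonoidAlgebra.coeff_single_mul_apply]
    simp [youngSymmetrizer_coeff_one]
  simp only [centralYoung, MonoidAlgebra.coeff_sum, Finsupp.finsetSum_apply, h2] at h1
  simp [Fintype.card_perm, n.factorial_ne_zero] at h1

theorem centralYoung_mul_self_ne_zero : π.centralYoung * π.centralYoung ≠ 0 := fun h =>
  centralYoung_ne_zero (MonoidAlgebra.eq_zero_of_central_of_mul_self centralYoung_comm h)

theorem centralYoung_mul_of_ne (h : π ≠ ρ) : π.centralYoung * ρ.centralYoung = 0 := by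
  rw [centralYoung, centralYoung, Finset.sum_mul_sum]
  refine Finset.sum_eq_zero fun g _ => Finset.sum_eq_zero fun g' _ => ?_
  have := youngSymmetrizer_mul_mul_of_ne h (single g⁻¹ 1 * single g' 1)
  calc _ = single g 1 * (π.youngSymmetrizer * (single g⁻¹ 1 * single g' 1) *
        ρ.youngSymmetrizer) * single g'⁻¹ 1 := by simp only [mul_assoc]
    _ = 0 := by rw [this, mul_zero, zero_mul]

theorem linearIndependent_centralYoung :
    LinearIndependent ℚ (centralYoung : n.Partition → MonoidAlgebra ℚ (Equiv.Perm (Fin n))) := by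
  rw [Fintype.linearIndependent_iff]
  intro k hk ρ
  have h := congrArg (· * ρ.centralYoung) hk
  simp only [Finset.sum_mul, zero_mul, smul_mul_assoc] at h
  rw [Finset.sum_eq_single ρ (fun π _ hπ => by rw [centralYoung_mul_of_ne hπ, smul_zero])
    (by simp)] at h
  exact (smul_eq_zero.1 h).resolve_right centralYoung_mul_self_ne_zero

/-- The elements `centralYoung` are linearly independent, one for each partition, in a space of
class functions whose dimension is at most the number of partitions. Hence they span that space,
which contains `1`. -/
theorem one_mem_span_centralYoung : (1 : MonoidAlgebra ℚ (Equiv.Perm (Fin n))) ∈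
    Submodule.span ℚ (Set.range (centralYoung (n := n))) := by
  have hle : Submodule.span ℚ (Set.range (centralYoung (n := n))) ≤
      LinearMap.range (Equiv.Perm.classFunction n) := by
    rw [Submodule.span_le]
    rintro _ ⟨π, rfl⟩
    exact Equiv.Perm.mem_range_classFunction centralYoung_comm
  have hcard : Fintype.card (Fintype.card (Fin n)).Partition = Fintype.card n.Partition :=
    Fintype.card_congr (Equiv.cast (by rw [Fintype.card_fin]))
  rw [Submodule.eq_of_le_of_finrank_le hle]
  · exact Equiv.Perm.mem_range_classFunction (by simp)
  · rw [finrank_span_eq_card linearIndependent_centralYoung, ← hcard]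
    refine (LinearMap.finrank_range_le _).trans ?_
    simp

theorem isSplitFamily_youngIdempotent (n : ℕ) :
    IsSplitFamily (youngIdempotent : n.Partition → MonoidAlgebra ℚ (Equiv.Perm (Fin n))) where
  idem _ := youngIdempotent_mul_self
  orth π ρ h a := by
    rw [youngIdempotent, youngIdempotent, smul_mul_assoc, smul_mul_assoc, mul_smul_comm,
      youngSymmetrizer_mul_mul_of_ne h, smul_zero, smul_zero]
  prim π a := by
    obtain ⟨k, hk⟩ := exists_youngSymmetrizer_mul_mul (π := π) a
    refine ⟨k * ((Module.finrank ℚ π.spechtSubmodule : ℚ) / (n.factorial : ℚ)), ?_⟩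
    rw [youngIdempotent, smul_mul_assoc, smul_mul_assoc, mul_smul_comm, hk, smul_smul, smul_smul,
      smul_smul]
    congr 1
    ring
  full := by
    refine (Submodule.span_le.2 ?_ : Submodule.span ℚ (Set.range centralYoung) ≤ _)
      one_mem_span_centralYoung
    rintro _ ⟨π, rfl⟩
    obtain ⟨k, hk⟩ := youngSymmetrizer_eq_smul (π := π)
    refine Submodule.sum_mem _ fun g _ => ?_
    rw [hk, mul_smul_comm, smul_mul_assoc]
    exact Submodule.smul_mem _ _ (Submodule.subset_span ⟨π, _, _, rfl⟩)

theorem spechtSubmodule_eq : π.spechtSubmodule =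
    LinearMap.range (LinearMap.mulRight ℚ π.youngIdempotent) := by
  obtain ⟨k, hk⟩ := youngSymmetrizer_eq_smul (π := π)
  apply le_antisymm
  · rintro _ ⟨x, rfl⟩
    exact ⟨k • x, by simp only [LinearMap.mulRight_apply, hk, mul_smul_comm, smul_mul_assoc]⟩
  · rintro _ ⟨x, rfl⟩
    refine ⟨((Module.finrank ℚ π.spechtSubmodule : ℚ) / (n.factorial : ℚ)) • x, ?_⟩
    simp only [LinearMap.mulRight_apply, youngIdempotent, mul_smul_comm, smul_mul_assoc]

end Nat.Partition

/-! ### Decomposition of idempotents in split semisimple algebras -/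

section corner
variable {D σ : Type*} [Ring D] [Algebra ℚ D]

/-- The space `e D f`. -/
noncomputable def corner (e f : D) : Submodule ℚ D :=
  LinearMap.range (LinearMap.mulLeft ℚ e ∘ₗ LinearMap.mulRight ℚ f)

theorem mem_corner {e f : D} (he : e * e = e) (hf : f * f = f) {x : D} :
    x ∈ corner e f ↔ e * x = x ∧ x * f = x := by
  constructor
  · rintro ⟨a, rfl⟩
    simp only [LinearMap.comp_apply, LinearMap.mulLeft_apply, LinearMap.mulRight_apply]
    exact ⟨by rw [← mul_assoc, he], by rw [mul_assoc, mul_assoc, hf]⟩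
  · rintro ⟨h1, h2⟩
    exact ⟨x, by simp [h1, h2]⟩

theorem mul_mul_mem_corner (e f a : D) : e * a * f ∈ corner e f := ⟨a, by simp [mul_assoc]⟩

namespace IsSplitFamily
variable {f : σ → D} (hf : IsSplitFamily f)
include hf

/-- The unit is a combination of products `a * f s * b`, so an `x` that kills all `a * f s` kills
the unit. -/
theorem eq_zero_of_mul {x : D} (h : ∀ s a, x * a * f s = 0) : x = 0 := by
  have h1 : Submodule.span ℚ {x | ∃ s a b, x = a * f s * b} ≤
      LinearMap.ker (LinearMap.mulLeft ℚ x) := by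
    rw [Submodule.span_le]
    rintro _ ⟨s, a, b, rfl⟩
    simp [← mul_assoc, h]
  simpa using h1 hf.full

theorem eq_zero_of_mul' {x : D} (h : ∀ s b, f s * b * x = 0) : x = 0 := by
  have h1 : Submodule.span ℚ {x | ∃ s a b, x = a * f s * b} ≤
      LinearMap.ker (LinearMap.mulRight ℚ x) := by
    rw [Submodule.span_le]
    rintro _ ⟨s, a, b, rfl⟩
    simp only [SetLike.mem_coe, LinearMap.mem_ker, LinearMap.mulRight_apply]
    rw [mul_assoc, mul_assoc, ← mul_assoc (f s), h, mul_zero]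
  simpa using h1 hf.full

variable [Module.Finite ℚ D]

/-- Multiplication pairs `f D e` with `e D f` into `f D f = ℚ f`, where `f = f s`. The pairing is
perfect: an element orthogonal to the whole other side is killed by `f s`, by `orth` it is also
killed by the other members, and by `full` it vanishes. The families `y` and `x` are dual bases. -/
theorem exists_dual_basis {e : D} (he : e * e = e) (s : σ) :
    ∃ x y : Fin (Module.finrank ℚ (corner e (f s))) → D,
      (∀ i, x i ∈ corner e (f s)) ∧ (∀ i, y i ∈ corner (f s) e) ∧
      (∀ i j, y i * x j = if i = j then f s else 0) ∧
      ∀ z ∈ corner e (f s), z ∈ Submodule.span ℚ (Set.range x) := by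
  -- For `f s = 0` the corner is zero and both families are empty; this case is apart because no
  -- functional takes the value `1` at `f s`.
  by_cases h0 : f s = 0
  · have : corner e (f s) = ⊥ := by
      rw [eq_bot_iff]
      rintro _ ⟨a, rfl⟩
      simp [h0]
    have hr : Module.finrank ℚ (corner e (f s)) = 0 := by rw [this]; simp
    refine ⟨fun _ => 0, fun _ => 0, fun _ => zero_mem _, fun _ => zero_mem _,
      fun i => absurd i.2 (by simp [hr]), fun z hz => ?_⟩
    rw [this, Submodule.mem_bot] at hz
    rw [hz]
    exact zero_mem _
  -- A functional with value `1` at `f s` reads off the scalar of an element of `f D f = ℚ f`.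
  obtain ⟨φ, hφ⟩ := Module.Projective.exists_dual_eq_one ℚ h0
  have hφ' : ∀ a, f s * a * f s = φ (f s * a * f s) • f s := by
    intro a
    obtain ⟨k, hk⟩ := hf.prim s a
    rw [hk, map_smul, hφ, smul_eq_mul, mul_one]
  have hmul : ∀ y ∈ corner (f s) e, ∀ x ∈ corner e (f s), y * x = φ (y * x) • f s := by
    intro y hy x hx
    have h1 : y * x = f s * (y * x) * f s := by
      rw [← mul_assoc, ((mem_corner (hf.idem s) he).1 hy).1, mul_assoc,
        ((mem_corner he (hf.idem s)).1 hx).2]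
    rw [h1]
    exact hφ' _
  let B : corner (f s) e →ₗ[ℚ] corner e (f s) →ₗ[ℚ] ℚ :=
    ((LinearMap.mul ℚ D).compr₂ φ).compl₁₂ (corner (f s) e).subtype (corner e (f s)).subtype
  have hB : ∀ y x, B y x = φ (y.1 * x.1) := fun _ _ => rfl
  have : B.IsPerfPair := by
    refine LinearMap.IsPerfPair.of_injective ?_ ?_
    · rw [injective_iff_map_eq_zero]
      intro y hy
      apply Subtype.ext
      have hy' := (mem_corner (hf.idem s) he).1 y.2
      refine hf.eq_zero_of_mul fun t a => ?_
      by_cases hst : s = t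
      · subst hst
        have h1 := hmul y.1 y.2 _ (mul_mul_mem_corner e (f s) a)
        have h2 : B y ⟨_, mul_mul_mem_corner e (f s) a⟩ = 0 := by rw [hy]; rfl
        rw [hB] at h2
        rw [h2, zero_smul, ← mul_assoc, ← mul_assoc, hy'.2] at h1
        exact h1
      · rw [← hy'.1, mul_assoc (f s), hf.orth s t hst]
    · rw [injective_iff_map_eq_zero]
      intro x hx
      apply Subtype.ext
      have hx' := (mem_corner he (hf.idem s)).1 x.2
      refine hf.eq_zero_of_mul' fun t a => ?_
      by_cases hst : s = t
      · subst hst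
        have h1 := hmul _ (mul_mul_mem_corner (f s) e a) x.1 x.2
        have h2 : B.flip x ⟨_, mul_mul_mem_corner (f s) e a⟩ = 0 := by rw [hx]; rfl
        rw [LinearMap.flip_apply, hB] at h2
        rw [h2, zero_smul, mul_assoc, hx'.1] at h1
        exact h1
      · rw [← hx'.2, ← mul_assoc, mul_assoc (f t), hf.orth t s (Ne.symm hst)]
  let b := Module.finBasis ℚ (corner e (f s))
  have hsurj := (LinearMap.IsPerfPair.bijective_left B).2
  choose y hy using fun i => hsurj (b.coord i)
  refine ⟨fun i => b i, fun i => y i, fun i => (b i).2, fun i => (y i).2, fun i j => ?_,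
    fun z hz => ?_⟩
  · rw [hmul _ (y i).2 _ (b j).2, ← hB, hy, Module.Basis.coord_apply, Module.Basis.repr_self,
      Finsupp.single_apply]
    split_ifs with h1 h2 h2
    · rw [one_smul]
    · exact absurd h1.symm h2
    · exact absurd h2.symm h1
    · rw [zero_smul]
  · have h1 := congrArg Subtype.val (b.sum_repr ⟨z, hz⟩)
    rw [Submodule.coe_sum] at h1
    change _ = z at h1
    rw [← h1]
    exact Submodule.sum_mem _ fun i _ =>
      Submodule.smul_mem _ _ (Submodule.subset_span ⟨i, rfl⟩)

/-- The `x i * y i` are orthogonal idempotents. Their sum `z` agrees with `e` under left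
multiplication on the elements `x j`, hence on every corner `e D f_s`, and by `full` the corners
detect the difference `z - e`. -/
theorem exists_decomposition [Fintype σ] [DecidableEq σ] {e : D} (he : e * e = e) :
    ∃ x y : (Σ s, Fin (Module.finrank ℚ (corner e (f s)))) → D,
      (∀ i, x i ∈ corner e (f i.1)) ∧ (∀ i, y i ∈ corner (f i.1) e) ∧
      (∀ i j, y i * x j = if i = j then f i.1 else 0) ∧ ∑ i, x i * y i = e := by
  choose x y hx hy hxy hsp using fun s => hf.exists_dual_basis he s
  have hxy' : ∀ i j : (Σ s, Fin (Module.finrank ℚ (corner e (f s)))),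
      y i.1 i.2 * x j.1 j.2 = if i = j then f i.1 else 0 := by
    rintro ⟨s, i⟩ ⟨t, j⟩
    by_cases hst : s = t
    · subst hst
      rw [hxy]
      simp
    · rw [if_neg (fun h => hst (congrArg Sigma.fst h))]
      rw [← ((mem_corner (hf.idem s) he).1 (hy s i)).1, mul_assoc,
        ← ((mem_corner he (hf.idem t)).1 (hx t j)).2, ← mul_assoc (y s i), ← mul_assoc,
        hf.orth s t hst]
  refine ⟨fun i => x i.1 i.2, fun i => y i.1 i.2, fun i => hx _ _, fun i => hy _ _, hxy', ?_⟩
  rw [← sub_eq_zero]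
  set z := ∑ i : (Σ s, Fin (Module.finrank ℚ (corner e (f s)))), x i.1 i.2 * y i.1 i.2 with hz
  have hze : z * e = z := by
    rw [hz, Finset.sum_mul]
    refine Finset.sum_congr rfl fun i _ => ?_
    rw [mul_assoc, ((mem_corner (hf.idem _) he).1 (hy i.1 i.2)).2]
  refine hf.eq_zero_of_mul fun s a => ?_
  have h1 : ∀ w ∈ corner e (f s), (z - e) * w = 0 := by
    intro w hw
    refine (Submodule.span_le.2 ?_ : _ ≤ LinearMap.ker (LinearMap.mulLeft ℚ (z - e))) (hsp s w hw)
    rintro _ ⟨j, rfl⟩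
    simp only [SetLike.mem_coe, LinearMap.mem_ker, LinearMap.mulLeft_apply]
    have hj := (mem_corner he (hf.idem s)).1 (hx s j)
    rw [sub_mul, hj.1, hz, Finset.sum_mul, Finset.sum_eq_single ⟨s, j⟩]
    · rw [mul_assoc, hxy, if_pos rfl, hj.2, sub_self]
    · intro i _ hi
      rw [mul_assoc, hxy' i ⟨s, j⟩, if_neg hi, mul_zero]
    · simp
  have h2 : (z - e) * a * f s = (z - e) * (e * a * f s) := by
    rw [← mul_assoc, ← mul_assoc, sub_mul z e e, hze, he]
  rw [h2]
  exact h1 _ (mul_mul_mem_corner _ _ _)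

end IsSplitFamily
end corner

/-! ### Classes of images of idempotents -/

namespace K0
variable {A : Type u} [Category.{v} A] [Abelian A]

/-- The class of the image of an endomorphism. -/
noncomputable def clIm {T : A} (e : T ⟶ T) : K0 A := cl (image e)

theorem image_ι_factorThruImage {T : A} {e : T ⟶ T} (he : e ≫ e = e) :
    image.ι e ≫ factorThruImage e = 𝟙 _ := by
  rw [← cancel_epi (factorThruImage e), ← cancel_mono (image.ι e)]
  simpa using he

theorem image_ι_comp {T : A} {e : T ⟶ T} (he : e ≫ e = e) : image.ι e ≫ e = image.ι e := by
  have h : image.ι e ≫ factorThruImage e ≫ image.ι e = image.ι e := by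
    rw [← Category.assoc, image_ι_factorThruImage he, Category.id_comp]
  rwa [image.fac] at h

theorem comp_factorThruImage {T : A} {e : T ⟶ T} (he : e ≫ e = e) :
    e ≫ factorThruImage e = factorThruImage e := by
  have h : factorThruImage e ≫ image.ι e ≫ factorThruImage e = factorThruImage e := by
    rw [image_ι_factorThruImage he, Category.comp_id]
  rwa [image.fac_assoc] at h

theorem clIm_eq_of_retract {T I : A} {e : T ⟶ T} (i : I ⟶ T) (p : T ⟶ I) (h : i ≫ p = 𝟙 I)
    (h' : p ≫ i = e) : clIm e = cl I := by
  have he : e ≫ e = e := by rw [← h', Category.assoc, reassoc_of% h]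
  refine cl_eq_of_iso ⟨image.ι e ≫ p, i ≫ factorThruImage e, ?_, ?_⟩
  · rw [Category.assoc, ← Category.assoc p, h', comp_factorThruImage he,
      image_ι_factorThruImage he]
  · rw [Category.assoc, ← Category.assoc (factorThruImage e), image.fac, ← h']
    simp [h]

theorem clIm_id (T : A) : clIm (𝟙 T) = cl T :=
  clIm_eq_of_retract (𝟙 T) (𝟙 T) (by simp) (by simp)

/-- The morphisms `u` and `v` make the two idempotents equivalent, and they restrict to inverse
isomorphisms of the images. -/
theorem clIm_eq_of_comp {T T' : A} {e : T ⟶ T} {f : T' ⟶ T'} (he : e ≫ e = e) (hf : f ≫ f = f)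
    (u : T ⟶ T') (v : T' ⟶ T) (huv : u ≫ v = e) (hvu : v ≫ u = f) : clIm e = clIm f := by
  have h1 : u ≫ f ≫ v = e := by
    rw [← hvu, Category.assoc, huv, ← Category.assoc, huv, he]
  have h2 : v ≫ e ≫ u = f := by
    rw [← huv, Category.assoc, hvu, ← Category.assoc, hvu, hf]
  refine cl_eq_of_iso ⟨image.ι e ≫ u ≫ factorThruImage f, image.ι f ≫ v ≫ factorThruImage e, ?_, ?_⟩
  · simp only [Category.assoc, image.fac_assoc]
    rw [reassoc_of% h1, comp_factorThruImage he, image_ι_factorThruImage he]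
  · simp only [Category.assoc, image.fac_assoc]
    rw [reassoc_of% h2, comp_factorThruImage hf, image_ι_factorThruImage hf]

/-- Cutting with compatible idempotents is exact: the images form a retract `S'` of `S` among short
complexes, so the homology of `S'` is a retract of a zero object. -/
theorem clIm_τ₂ {S : ShortComplex A} (hS : S.ShortExact) (φ : S ⟶ S) (hφ : φ ≫ φ = φ) :
    clIm φ.τ₂ = clIm φ.τ₁ + clIm φ.τ₃ := by
  have h1 : φ.τ₁ ≫ φ.τ₁ = φ.τ₁ := by rw [← ShortComplex.comp_τ₁, hφ]
  have h2 : φ.τ₂ ≫ φ.τ₂ = φ.τ₂ := by rw [← ShortComplex.comp_τ₂, hφ]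
  have h3 : φ.τ₃ ≫ φ.τ₃ = φ.τ₃ := by rw [← ShortComplex.comp_τ₃, hφ]
  have hf : (image.ι φ.τ₁ ≫ S.f ≫ factorThruImage φ.τ₂) ≫ image.ι φ.τ₂ =
      image.ι φ.τ₁ ≫ S.f := by
    rw [Category.assoc, Category.assoc, image.fac, ← φ.comm₁₂, ← Category.assoc, image_ι_comp h1]
  have hg : (image.ι φ.τ₂ ≫ S.g ≫ factorThruImage φ.τ₃) ≫ image.ι φ.τ₃ =
      image.ι φ.τ₂ ≫ S.g := by
    rw [Category.assoc, Category.assoc, image.fac, ← φ.comm₂₃, ← Category.assoc, image_ι_comp h2]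
  have hf' : factorThruImage φ.τ₁ ≫ image.ι φ.τ₁ ≫ S.f ≫ factorThruImage φ.τ₂ =
      S.f ≫ factorThruImage φ.τ₂ := by
    rw [image.fac_assoc, φ.comm₁₂_assoc, comp_factorThruImage h2]
  have hg' : factorThruImage φ.τ₂ ≫ image.ι φ.τ₂ ≫ S.g ≫ factorThruImage φ.τ₃ =
      S.g ≫ factorThruImage φ.τ₃ := by
    rw [image.fac_assoc, φ.comm₂₃_assoc, comp_factorThruImage h3]
  let S' : ShortComplex A := ShortComplex.mk (image.ι φ.τ₁ ≫ S.f ≫ factorThruImage φ.τ₂)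
    (image.ι φ.τ₂ ≫ S.g ≫ factorThruImage φ.τ₃) (by
      rw [← cancel_mono (image.ι φ.τ₃), Category.assoc, hg, ← Category.assoc, hf, Category.assoc,
        S.zero, comp_zero, zero_comp])
  let i : S' ⟶ S := ⟨image.ι φ.τ₁, image.ι φ.τ₂, image.ι φ.τ₃, hf.symm, hg.symm⟩
  let p : S ⟶ S' := ⟨factorThruImage φ.τ₁, factorThruImage φ.τ₂, factorThruImage φ.τ₃, hf', hg'⟩
  have hip : i ≫ p = 𝟙 S' := by
    ext1
    · exact image_ι_factorThruImage h1
    · exact image_ι_factorThruImage h2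
    · exact image_ι_factorThruImage h3
  have hS' : S'.ShortExact := by
    have := hS.mono_f
    have := hS.epi_g
    refine ShortComplex.ShortExact.mk' ?_ ?_ ?_
    · rw [ShortComplex.exact_iff_isZero_homology]
      have hz := S.exact_iff_isZero_homology.1 hS.exact
      rw [IsZero.iff_id_eq_zero, ← ShortComplex.homologyMap_id, ← hip,
        ShortComplex.homologyMap_comp, hz.eq_of_tgt (ShortComplex.homologyMap i) 0, zero_comp]
    · exact mono_of_mono_fac hf
    · exact epi_of_epi_fac hg'
  exact cl_eq_add S' hS'

/-- The idempotent `e + f` of `T` is equivalent to the diagonal idempotent with entries `e`, `f` on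
`T ⊞ T`, whose class is given by `clIm_τ₂` for the split sequence. -/
theorem clIm_add {T : A} {e f : T ⟶ T} (he : e ≫ e = e) (hf : f ≫ f = f) (hef : e ≫ f = 0)
    (hfe : f ≫ e = 0) : clIm (e + f) = clIm e + clIm f := by
  let S : ShortComplex A := ShortComplex.mk (biprod.inl : T ⟶ T ⊞ T) (biprod.snd : T ⊞ T ⟶ T)
    (by simp)
  have hS : S.ShortExact := (ShortComplex.Splitting.shortExact
    ⟨biprod.fst, biprod.inr, by simp [S], by simp [S], by simp [S]⟩)
  let φ : S ⟶ S := ⟨e, biprod.map e f, f, by simp [S], by simp [S]⟩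
  have h1 := clIm_τ₂ hS φ (by
    ext1
    · exact he
    · change biprod.map e f ≫ biprod.map e f = biprod.map e f
      ext <;> simp [he, hf]
    · exact hf)
  rw [← h1]
  refine clIm_eq_of_comp ?_ ?_ (biprod.lift e f) (biprod.desc e f) ?_ ?_
  · simp [he, hf, hef, hfe]
  · change biprod.map e f ≫ biprod.map e f = biprod.map e f
    ext <;> simp [he, hf]
  · simp [he, hf]
  · change _ = biprod.map e f
    ext <;> simp [he, hf, hef, hfe]

theorem clIm_zero (T : A) : clIm (0 : T ⟶ T) = 0 := by
  have := clIm_add (e := (0 : T ⟶ T)) (f := 0) (by simp) (by simp) (by simp) (by simp)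
  simpa using this

theorem clIm_sum {T : A} {ι : Type*} [DecidableEq ι] (s : Finset ι) (e : ι → (T ⟶ T))
    (h : ∀ i j, e i ≫ e j = if i = j then e i else 0) :
    clIm (∑ i ∈ s, e i) = ∑ i ∈ s, clIm (e i) := by
  induction s using Finset.induction_on with
  | empty => simpa using clIm_zero T
  | insert a s ha ih =>
    rw [Finset.sum_insert ha, Finset.sum_insert ha, ← ih]
    refine clIm_add (by simp [h]) ?_ ?_ ?_
    · rw [Preadditive.sum_comp]
      refine Finset.sum_congr rfl fun i hi => ?_
      rw [Preadditive.comp_sum]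
      simp [h, hi]
    · rw [Preadditive.comp_sum]
      refine Finset.sum_eq_zero fun i hi => ?_
      rw [h, if_neg (by rintro rfl; exact ha hi)]
    · rw [Preadditive.sum_comp]
      refine Finset.sum_eq_zero fun i hi => ?_
      rw [h, if_neg (by rintro rfl; exact ha hi)]

/-- The map `F` carries the decomposition of `e` to orthogonal idempotents of `T`, each equivalent
to some `F (f s)`. It is not required to preserve `1`, so that algebras acting only on a direct
summand of `T` are covered. -/
theorem clIm_eq_sum_finrank {D σ : Type*} [Ring D] [Algebra ℚ D] [Module.Finite ℚ D] [Fintype σ]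
    {f : σ → D} (hf : IsSplitFamily f) {T : A} (F : D →ₙ+* End T) {e : D} (he : e * e = e) :
    clIm (F e) = ∑ s, Module.finrank ℚ (corner e (f s)) • clIm (F (f s)) := by
  classical
  obtain ⟨x, y, hx, hy, hyx, hsum⟩ := hf.exists_decomposition he
  have hmul : ∀ a b, F (a * b) = F b ≫ F a := fun a b => map_mul F a b
  have hx' := fun i => (mem_corner he (hf.idem _)).1 (hx i)
  have hxy : ∀ i j, (x i * y i) * (x j * y j) = if i = j then x i * y i else 0 := by
    intro i j
    rw [mul_assoc, ← mul_assoc (y i), hyx]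
    split_ifs with hij
    · subst hij
      rw [← mul_assoc, (hx' i).2]
    · simp
  have key : ∀ i, clIm (F (x i * y i)) = clIm (F (f i.1)) := by
    intro i
    refine clIm_eq_of_comp ?_ ?_ (F (y i)) (F (x i)) (hmul _ _).symm ?_
    · rw [← hmul, hxy, if_pos rfl]
    · rw [← hmul, hf.idem]
    · rw [← hmul, hyx, if_pos rfl]
  have h1 : F e = ∑ i, F (x i * y i) := by rw [← map_sum, hsum]
  rw [h1]
  have h2 := clIm_sum Finset.univ (fun i => (F (x i * y i) : T ⟶ T)) (fun i j => by
    rw [← hmul, hxy]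
    by_cases hij : i = j
    · subst hij
      simp
    · rw [if_neg hij, if_neg (fun h => hij h.symm), map_zero])
  refine h2.trans ?_
  rw [Finset.sum_congr rfl fun i _ => key i, Fintype.sum_sigma]
  simp

end K0

/-! ### Decomposition of induction products -/

section op
variable {D σ : Type*} [Ring D] [Algebra ℚ D]

/-- The opposite algebra is needed because right multiplications on the regular representation
compose in the opposite order. -/
theorem IsSplitFamily.op {f : σ → D} (hf : IsSplitFamily f) :
    IsSplitFamily (fun s => MulOpposite.op (f s)) where
  idem s := by rw [← MulOpposite.op_mul, hf.idem]
  orth s t h a := by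
    rw [← MulOpposite.op_unop a, ← MulOpposite.op_mul, ← MulOpposite.op_mul, ← mul_assoc,
      hf.orth t s h.symm, MulOpposite.op_zero]
  prim s a := by
    obtain ⟨k, hk⟩ := hf.prim s a.unop
    refine ⟨k, ?_⟩
    rw [← MulOpposite.op_unop a, ← MulOpposite.op_mul, ← MulOpposite.op_mul, ← mul_assoc, hk,
      MulOpposite.op_smul]
  full := by
    have h : Submodule.span ℚ {x | ∃ s a b, x = a * f s * b} ≤
        (Submodule.span ℚ {x | ∃ s a b, x = a * MulOpposite.op (f s) * b}).comap
          (MulOpposite.opLinearEquiv ℚ).toLinearMap := by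
      rw [Submodule.span_le]
      rintro _ ⟨s, a, b, rfl⟩
      exact Submodule.subset_span ⟨s, MulOpposite.op b, MulOpposite.op a, by simp [mul_assoc]⟩
    exact h hf.full

theorem finrank_corner_op (e f : D) :
    Module.finrank ℚ (corner (MulOpposite.op f) (MulOpposite.op e)) =
      Module.finrank ℚ (corner e f) := by
  have : corner (MulOpposite.op f) (MulOpposite.op e) =
      (corner e f).map (MulOpposite.opLinearEquiv ℚ).toLinearMap := by
    ext x
    constructor
    · rintro ⟨a, rfl⟩
      exact ⟨_, ⟨a.unop, rfl⟩, by simp [mul_assoc]⟩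
    · rintro ⟨_, ⟨a, rfl⟩, rfl⟩
      exact ⟨MulOpposite.op a, by simp [mul_assoc]⟩
  rw [this, LinearEquiv.finrank_map_eq]

end op

/-! ### Images of right multiplications on the regular representation. -/

namespace FDRep
variable {G : Type} [Group G]

/-- The regular representation, by left multiplication on the group algebra. -/
noncomputable def regularRep (G : Type) [Group G] : Representation ℚ G (MonoidAlgebra ℚ G) where
  toFun g := LinearMap.mulLeft ℚ (MonoidAlgebra.single g 1)
  map_one' := by
    refine LinearMap.ext fun x => ?_
    rw [LinearMap.mulLeft_apply, ← MonoidAlgebra.one_def, one_mul]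
    rfl
  map_mul' g h := by
    refine LinearMap.ext fun x => ?_
    rw [Module.End.mul_apply, LinearMap.mulLeft_apply, LinearMap.mulLeft_apply,
      LinearMap.mulLeft_apply, ← mul_assoc, MonoidAlgebra.single_mul_single, one_mul]

theorem regularRep_apply (g : G) (x : MonoidAlgebra ℚ G) :
    regularRep G g x = MonoidAlgebra.single g 1 * x := rfl

/-- The regular representation as an object of `FDRep`. -/
noncomputable def regular (G : Type) [Group G] [Finite G] : FDRep ℚ G := FDRep.of (regularRep G)

/-- Right multiplication on the regular representation. -/
noncomputable def regularEnd (G : Type) [Group G] [Finite G] :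
    (MonoidAlgebra ℚ G)ᵐᵒᵖ →ₙ+* End (regular G) where
  toFun x := mkHom (V := regular G) (W := regular G) (LinearMap.mulRight ℚ x.unop)
    (fun g v => mul_assoc (MonoidAlgebra.single g 1) (show MonoidAlgebra ℚ G from v) x.unop)
  map_mul' x y := linMap_injective (LinearMap.ext fun v =>
    (mul_assoc (show MonoidAlgebra ℚ G from v) y.unop x.unop).symm)
  map_zero' := linMap_injective (LinearMap.ext fun v =>
    mul_zero (show MonoidAlgebra ℚ G from v))
  map_add' x y := linMap_injective (LinearMap.ext fun v =>
    mul_add (show MonoidAlgebra ℚ G from v) x.unop y.unop)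

/-- The maps `i` and `p` identify `ρ` with the left ideal `ℚ[G] f`, the image of right
multiplication by `f`. -/
theorem clIm_regularEnd [Finite G] {V : Type} [AddCommGroup V] [Module ℚ V] [Module.Finite ℚ V]
    (ρ : Representation ℚ G V) {f : MonoidAlgebra ℚ G} (i : V →ₗ[ℚ] MonoidAlgebra ℚ G)
    (p : MonoidAlgebra ℚ G →ₗ[ℚ] V) (hi : ∀ g v, i (ρ g v) = MonoidAlgebra.single g 1 * i v)
    (hp : ∀ g x, p (MonoidAlgebra.single g 1 * x) = ρ g (p x)) (hpi : ∀ v, p (i v) = v)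
    (hip : ∀ x, i (p x) = x * f) :
    K0.clIm (regularEnd G (MulOpposite.op f)) = K0.cl (FDRep.of ρ) :=
  K0.clIm_eq_of_retract (mkHom (V := FDRep.of ρ) (W := regular G) i hi)
    (mkHom (V := regular G) (W := FDRep.of ρ) p hp) (linMap_injective (LinearMap.ext hpi))
    (linMap_injective (LinearMap.ext hip))

end FDRep

namespace Nat.Partition
variable {n : ℕ} (π : n.Partition)

theorem mem_spechtSubmodule {x : MonoidAlgebra ℚ (Equiv.Perm (Fin n))} :
    x ∈ π.spechtSubmodule ↔ x * π.youngIdempotent = x := by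
  rw [spechtSubmodule_eq]
  constructor
  · rintro ⟨y, rfl⟩
    rw [LinearMap.mulRight_apply, mul_assoc, youngIdempotent_mul_self]
  · intro h
    exact ⟨x, h⟩

theorem clIm_regularEnd_youngIdempotent :
    K0.clIm (FDRep.regularEnd _ (MulOpposite.op π.youngIdempotent)) = K0.cl π.specht :=
  FDRep.clIm_regularEnd π.spechtRep π.spechtSubmodule.subtype
    ((LinearMap.mulRight ℚ π.youngIdempotent).codRestrict _ fun x =>
      (π.mem_spechtSubmodule).2 (by
        rw [LinearMap.mulRight_apply, mul_assoc, youngIdempotent_mul_self]))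
    (fun _ _ => rfl) (fun g x => Subtype.ext (mul_assoc _ _ _))
    (fun v => Subtype.ext ((π.mem_spechtSubmodule).1 v.2)) (fun _ => rfl)

/-- In the opposite group algebra `f` splits into idempotents equivalent to Young idempotents, and
right multiplication by a Young idempotent has a Specht module as image. -/
theorem cl_eq_sum_specht {V : Type} [AddCommGroup V] [Module ℚ V] [Module.Finite ℚ V]
    (ρ : Representation ℚ (Equiv.Perm (Fin n)) V) {f : MonoidAlgebra ℚ (Equiv.Perm (Fin n))}
    (hf : f * f = f) (i : V →ₗ[ℚ] MonoidAlgebra ℚ (Equiv.Perm (Fin n)))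
    (p : MonoidAlgebra ℚ (Equiv.Perm (Fin n)) →ₗ[ℚ] V)
    (hi : ∀ g v, i (ρ g v) = MonoidAlgebra.single g 1 * i v)
    (hp : ∀ g x, p (MonoidAlgebra.single g 1 * x) = ρ g (p x)) (hpi : ∀ v, p (i v) = v)
    (hip : ∀ x, i (p x) = x * f) :
    K0.cl (FDRep.of ρ) =
      ∑ π : n.Partition, Module.finrank ℚ (corner π.youngIdempotent f) • K0.cl π.specht := by
  have : Module.Finite ℚ (MonoidAlgebra ℚ (Equiv.Perm (Fin n)))ᵐᵒᵖ :=
    Module.Finite.equiv (MulOpposite.opLinearEquiv ℚ)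
  rw [← FDRep.clIm_regularEnd ρ i p hi hp hpi hip,
    K0.clIm_eq_sum_finrank (isSplitFamily_youngIdempotent n).op (FDRep.regularEnd _)
      (e := MulOpposite.op f) (by rw [← MulOpposite.op_mul, hf])]
  refine Finset.sum_congr rfl fun π _ => ?_
  rw [finrank_corner_op, clIm_regularEnd_youngIdempotent]

end Nat.Partition

/-! ### Group algebras of two blocks and induced Specht modules. -/

section block
variable (p q : ℕ)

/-- The group algebra of the first block. -/
noncomputable def blockLeft :
    MonoidAlgebra ℚ (Equiv.Perm (Fin p)) →ₐ[ℚ] MonoidAlgebra ℚ (Equiv.Perm (Fin (p + q))) :=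
  MonoidAlgebra.lift ℚ _ _ ((MonoidAlgebra.of ℚ _).comp ((blockHom p q).comp (MonoidHom.inl _ _)))

/-- The group algebra of the second block. -/
noncomputable def blockRight :
    MonoidAlgebra ℚ (Equiv.Perm (Fin q)) →ₐ[ℚ] MonoidAlgebra ℚ (Equiv.Perm (Fin (p + q))) :=
  MonoidAlgebra.lift ℚ _ _ ((MonoidAlgebra.of ℚ _).comp ((blockHom p q).comp (MonoidHom.inr _ _)))

variable {p q}

theorem blockLeft_single (g : Equiv.Perm (Fin p)) :
    blockLeft p q (MonoidAlgebra.single g 1) = MonoidAlgebra.single (blockHom p q (g, 1)) 1 := by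
  simp [blockLeft]

theorem blockRight_single (h : Equiv.Perm (Fin q)) :
    blockRight p q (MonoidAlgebra.single h 1) = MonoidAlgebra.single (blockHom p q (1, h)) 1 := by
  simp [blockRight]

theorem MonoidAlgebra.linear_induction {G : Type*} {P : MonoidAlgebra ℚ G → Prop}
    (x : MonoidAlgebra ℚ G) (hzero : P 0) (hadd : ∀ x y, P x → P y → P (x + y))
    (hsmul : ∀ (r : ℚ) x, P x → P (r • x)) (hsingle : ∀ g, P (MonoidAlgebra.single g 1)) : P x := by
  induction x using MonoidAlgebra.induction_linear with
  | zero => exact hzero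
  | add x y hx hy => exact hadd x y hx hy
  | single g r =>
    have : MonoidAlgebra.single g r = r • MonoidAlgebra.single g (1 : ℚ) := by simp
    rw [this]
    exact hsmul _ _ (hsingle g)

theorem blockLeft_mul_blockRight (a : MonoidAlgebra ℚ (Equiv.Perm (Fin p)))
    (b : MonoidAlgebra ℚ (Equiv.Perm (Fin q))) :
    blockLeft p q a * blockRight p q b = blockRight p q b * blockLeft p q a := by
  induction a using MonoidAlgebra.linear_induction with
  | hzero => simp
  | hadd x y hx hy => rw [map_add, add_mul, mul_add, hx, hy]
  | hsmul r x hx => rw [map_smul, smul_mul_assoc, mul_smul_comm, hx]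
  | hsingle g =>
    induction b using MonoidAlgebra.linear_induction with
    | hzero => simp
    | hadd x y hx hy => rw [map_add, add_mul, mul_add, hx, hy]
    | hsmul r x hx => rw [map_smul, smul_mul_assoc, mul_smul_comm, hx]
    | hsingle h =>
      rw [blockLeft_single, blockRight_single, MonoidAlgebra.single_mul_single,
        MonoidAlgebra.single_mul_single, ← map_mul, ← map_mul]
      simp

theorem blockLeft_single_mul_blockRight_single (g : Equiv.Perm (Fin p)) (h : Equiv.Perm (Fin q)) :
    blockLeft p q (MonoidAlgebra.single g 1) * blockRight p q (MonoidAlgebra.single h 1) =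
      MonoidAlgebra.single (blockHom p q (g, h)) 1 := by
  rw [blockLeft_single, blockRight_single, MonoidAlgebra.single_mul_single, ← map_mul]
  simp

/-- The product of elements of the group algebras of two blocks. -/
noncomputable def blockMul (a : MonoidAlgebra ℚ (Equiv.Perm (Fin p)))
    (b : MonoidAlgebra ℚ (Equiv.Perm (Fin q))) : MonoidAlgebra ℚ (Equiv.Perm (Fin (p + q))) :=
  blockLeft p q a * blockRight p q b

theorem blockMul_mul_blockMul (a a' : MonoidAlgebra ℚ (Equiv.Perm (Fin p)))
    (b b' : MonoidAlgebra ℚ (Equiv.Perm (Fin q))) :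
    blockMul a b * blockMul a' b' = blockMul (a * a') (b * b') := by
  simp only [blockMul, map_mul]
  rw [mul_assoc, ← mul_assoc (blockRight p q b), ← blockLeft_mul_blockRight]
  simp only [mul_assoc]

theorem blockMul_single (g : Equiv.Perm (Fin p)) (h : Equiv.Perm (Fin q)) :
    blockMul (MonoidAlgebra.single g 1) (MonoidAlgebra.single h 1) =
      MonoidAlgebra.single (blockHom p q (g, h)) 1 :=
  blockLeft_single_mul_blockRight_single g h

variable (p q) in
/-- The product of elements of two blocks, as a bilinear map. -/
noncomputable def blockMulLin : MonoidAlgebra ℚ (Equiv.Perm (Fin p)) →ₗ[ℚ]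
    MonoidAlgebra ℚ (Equiv.Perm (Fin q)) →ₗ[ℚ] MonoidAlgebra ℚ (Equiv.Perm (Fin (p + q))) :=
  (LinearMap.mul ℚ _).compl₁₂ (blockLeft p q).toLinearMap (blockRight p q).toLinearMap

theorem blockMulLin_apply (a : MonoidAlgebra ℚ (Equiv.Perm (Fin p)))
    (b : MonoidAlgebra ℚ (Equiv.Perm (Fin q))) : blockMulLin p q a b = blockMul a b := rfl

theorem IndProd.asAlgebraHom_blockMul_ι {V W : Type*} [AddCommGroup V] [Module ℚ V]
    [AddCommGroup W] [Module ℚ W] (ρ : Representation ℚ (Equiv.Perm (Fin p)) V)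
    (σ : Representation ℚ (Equiv.Perm (Fin q)) W) (a : MonoidAlgebra ℚ (Equiv.Perm (Fin p)))
    (b : MonoidAlgebra ℚ (Equiv.Perm (Fin q))) (v : V) (w : W) :
    (IndProd.rep (blockHom p q) ρ σ).asAlgebraHom (blockMul a b)
      (IndProd.ι (blockHom p q) ρ σ v w) =
      IndProd.ι (blockHom p q) ρ σ (ρ.asAlgebraHom a v) (σ.asAlgebraHom b w) := by
  rw [← blockMulLin_apply]
  induction a using MonoidAlgebra.linear_induction with
  | hzero => simp
  | hadd x y hx hy => simp only [map_add, LinearMap.add_apply, hx, hy]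
  | hsmul r x hx => simp only [map_smul, LinearMap.smul_apply, hx]
  | hsingle g =>
    induction b using MonoidAlgebra.linear_induction with
    | hzero => simp
    | hadd x y hx hy => simp only [map_add, LinearMap.add_apply, hx, hy]
    | hsmul r x hx => simp only [map_smul, LinearMap.smul_apply, hx]
    | hsingle h =>
      rw [blockMulLin_apply, blockMul_single, Representation.asAlgebraHom_single_one,
        Representation.asAlgebraHom_single_one, Representation.asAlgebraHom_single_one,
        IndProd.rep_ι]

theorem Nat.Partition.coe_spechtRep {n : ℕ} (π : n.Partition) (g : Equiv.Perm (Fin n))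
    (v : π.spechtSubmodule) : (π.spechtRep g v : MonoidAlgebra ℚ (Equiv.Perm (Fin n))) =
      MonoidAlgebra.single g 1 * v.1 := rfl

theorem Nat.Partition.asAlgebraHom_spechtRep {n : ℕ} (π : n.Partition)
    (a : MonoidAlgebra ℚ (Equiv.Perm (Fin n))) (v : π.spechtSubmodule) :
    (π.spechtRep.asAlgebraHom a v : MonoidAlgebra ℚ (Equiv.Perm (Fin n))) = a * v := by
  induction a using MonoidAlgebra.linear_induction with
  | hzero => simp
  | hadd x y hx hy =>
    rw [map_add, LinearMap.add_apply, Submodule.coe_add, hx, hy, add_mul]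
  | hsmul r x hx => rw [map_smul, LinearMap.smul_apply, Submodule.coe_smul, hx, smul_mul_assoc]
  | hsingle g => rw [Representation.asAlgebraHom_single_one]; rfl

/-- The induced module of a product of two left ideals is the left ideal generated by the product of
the generating idempotents: `i` multiplies the two factors in the large group algebra, and `r` lets
that algebra act on the generator. -/
theorem cl_indProd_specht (α : p.Partition) (β : q.Partition) :
    K0.cl (indProd α.specht β.specht) = ∑ π : (p + q).Partition,
      Module.finrank ℚ (corner π.youngIdempotent
        (blockMul α.youngIdempotent β.youngIdempotent)) • K0.cl π.specht := by
  let τ := IndProd.rep (blockHom p q) α.spechtRep β.spechtRep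
  let ι := IndProd.ι (blockHom p q) α.spechtRep β.spechtRep
  let B : α.spechtSubmodule →ₗ[ℚ] β.spechtSubmodule →ₗ[ℚ]
      MonoidAlgebra ℚ (Equiv.Perm (Fin (p + q))) :=
    (blockMulLin p q).compl₁₂ α.spechtSubmodule.subtype β.spechtSubmodule.subtype
  have hBapp : ∀ v w, B v w = blockMul v.1 w.1 := fun _ _ => rfl
  have hB : ∀ g h v w, B (α.spechtRep g v) (β.spechtRep h w) =
      FDRep.regularRep _ (blockHom p q (g, h)) (B v w) := by
    intro g h v w
    rw [hBapp, hBapp, Nat.Partition.coe_spechtRep, Nat.Partition.coe_spechtRep,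
      FDRep.regularRep_apply, ← blockMul_mul_blockMul, blockMul_single]
  let i := IndProd.lift (blockHom p q) α.spechtRep β.spechtRep (FDRep.regularRep _) B hB
  have hi : ∀ g v, i (τ g v) = MonoidAlgebra.single g 1 * i v :=
    fun g v => IndProd.lift_rep (FDRep.regularRep _) B hB g v
  have iι : ∀ v w, i (ι v w) = blockMul v.1 w.1 := fun v w =>
    (IndProd.lift_ι (FDRep.regularRep _) B hB v w).trans (hBapp v w)
  let a : α.spechtSubmodule :=
    ⟨α.youngIdempotent, α.mem_spechtSubmodule.2 Nat.Partition.youngIdempotent_mul_self⟩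
  let b : β.spechtSubmodule :=
    ⟨β.youngIdempotent, β.mem_spechtSubmodule.2 Nat.Partition.youngIdempotent_mul_self⟩
  let r : MonoidAlgebra ℚ (Equiv.Perm (Fin (p + q))) →ₗ[ℚ]
      IndProd.carrier (blockHom p q) α.spechtRep β.spechtRep :=
    (LinearMap.applyₗ (ι a b)) ∘ₗ τ.asAlgebraHom.toLinearMap
  have hr : ∀ x, r x = τ.asAlgebraHom x (ι a b) := fun _ => rfl
  have hrτ : ∀ g x, r (MonoidAlgebra.single g 1 * x) = τ g (r x) := by
    intro g x
    rw [hr, hr, map_mul, Representation.asAlgebraHom_single_one]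
    rfl
  have hri : ∀ v, r (i v) = v := by
    have : r ∘ₗ i = LinearMap.id := by
      refine IndProd.hom_ext τ (fun k x => ?_) (fun _ _ => rfl) fun v w => ?_
      · rw [LinearMap.comp_apply, hi, hrτ]
        rfl
      · change r (i (ι v w)) = ι v w
        rw [iι, hr]
        refine (IndProd.asAlgebraHom_blockMul_ι _ _ _ _ _ _).trans ?_
        have hv : α.spechtRep.asAlgebraHom v.1 a = v := Subtype.ext (by
          rw [Nat.Partition.asAlgebraHom_spechtRep]
          exact α.mem_spechtSubmodule.1 v.2)
        have hw : β.spechtRep.asAlgebraHom w.1 b = w := Subtype.ext (by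
          rw [Nat.Partition.asAlgebraHom_spechtRep]
          exact β.mem_spechtSubmodule.1 w.2)
        rw [hv, hw]
    exact LinearMap.congr_fun this
  have hir : ∀ x, i (r x) = x * blockMul α.youngIdempotent β.youngIdempotent := by
    intro x
    rw [hr]
    induction x using MonoidAlgebra.linear_induction with
    | hzero => simp
    | hadd x y hx hy => rw [map_add, LinearMap.add_apply, map_add, hx, hy, add_mul]
    | hsmul r x hx => rw [map_smul, LinearMap.smul_apply, map_smul, hx, smul_mul_assoc]
    | hsingle g => rw [Representation.asAlgebraHom_single_one, hi, iι]
  exact Nat.Partition.cl_eq_sum_specht τ (by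
    rw [blockMul_mul_blockMul, Nat.Partition.youngIdempotent_mul_self,
      Nat.Partition.youngIdempotent_mul_self]) i r hi hrτ hri hir

end block

/-! ### Tensor powers of families of morphisms -/

section
variable {C : Type u} [Category.{v} C] [MonoidalCategory C]

/-- The identity of the unit object, between tensor powers with exponent `0`. -/
def tensorPow.nil (X Y : C) : tensorPow X 0 ⟶ tensorPow Y 0 := 𝟙 (𝟙_ C)

theorem tensorPow.nil_comp (X Y Z : C) :
    tensorPow.nil X Y ≫ tensorPow.nil Y Z = tensorPow.nil X Z :=
  Category.comp_id (𝟙 (𝟙_ C))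

/-- The tensor product of a morphism and a morphism between `n`-th tensor powers. -/
def tensorPow.cons {X Y : C} {n : ℕ} (f : X ⟶ Y) (g : tensorPow X n ⟶ tensorPow Y n) :
    tensorPow X (n + 1) ⟶ tensorPow Y (n + 1) := f ⊗ₘ g

theorem tensorPow.cons_comp {X Y Z : C} {n : ℕ} (f : X ⟶ Y) (g : tensorPow X n ⟶ tensorPow Y n)
    (f' : Y ⟶ Z) (g' : tensorPow Y n ⟶ tensorPow Z n) :
    tensorPow.cons f g ≫ tensorPow.cons f' g' = tensorPow.cons (f ≫ f') (g ≫ g') :=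
  tensorHom_comp_tensorHom f g f' g'

theorem tensorPow.cons_id (X : C) (n : ℕ) :
    tensorPow.cons (𝟙 X) (𝟙 (tensorPow X n)) = 𝟙 (tensorPow X (n + 1)) := id_tensorHom_id _ _

theorem tensorPow.whisker_eq_cons (X : C) (n : ℕ) (f : End (tensorPow X n)) :
    tensorPow.whisker X n f = tensorPow.cons (𝟙 X) f := (id_tensorHom X _).symm

/-- The tensor product of a family of `n` morphisms `X ⟶ Y`. -/
def tensorPow.map {X Y : C} : ∀ (n : ℕ) (_ : Fin n → (X ⟶ Y)), tensorPow X n ⟶ tensorPow Y n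
  | 0, _ => tensorPow.nil X Y
  | n + 1, f => tensorPow.cons (f 0) (tensorPow.map n fun i => f i.succ)

theorem tensorPow.map_succ {X Y : C} (n : ℕ) (f : Fin (n + 1) → (X ⟶ Y)) :
    tensorPow.map (n + 1) f = tensorPow.cons (f 0) (tensorPow.map n fun i => f i.succ) := rfl

theorem tensorPow.map_comp {X Y Z : C} : ∀ (n : ℕ) (f : Fin n → (X ⟶ Y)) (g : Fin n → (Y ⟶ Z)),
    tensorPow.map n f ≫ tensorPow.map n g = tensorPow.map n fun i => f i ≫ g i
  | 0, _, _ => tensorPow.nil_comp X Y Z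
  | n + 1, f, g => by
    simp only [tensorPow.map]
    rw [← tensorPow.map_comp n, tensorPow.cons_comp]

variable [SymmetricCategory C]

theorem braidFirst_tensorHom {X Y : C} {T T' : C} (f g : X ⟶ Y) (h : T ⟶ T') :
    braidFirst X T ≫ (f ⊗ₘ g ⊗ₘ h) = (g ⊗ₘ f ⊗ₘ h) ≫ braidFirst Y T' := by
  simp only [braidFirst, Category.assoc, associator_inv_naturality_assoc]
  rw [← associator_naturality]
  simp only [← tensorHom_id, tensorHom_comp_tensorHom_assoc, Category.id_comp,
    Category.comp_id, BraidedCategory.braiding_naturality]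

theorem tensorPow.permHom_swap_comp_map {X Y : C} : ∀ (n : ℕ) (i : Fin n)
    (f : Fin (n + 1) → (X ⟶ Y)),
    (show tensorPow X (n + 1) ⟶ _ from tensorPow.permHom X (n + 1)
      (Equiv.swap i.castSucc i.succ)) ≫ tensorPow.map (n + 1) f =
      tensorPow.map (n + 1) (f ∘ Equiv.swap i.castSucc i.succ) ≫
        (show tensorPow Y (n + 1) ⟶ _ from tensorPow.permHom Y (n + 1)
          (Equiv.swap i.castSucc i.succ))
  | 0, i, _ => i.elim0
  | n + 1, i, f => by
    refine Fin.cases ?_ (fun i => ?_) i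
    · change (show tensorPow X (n + 2) ⟶ _ from tensorPow.permHom X (n + 2)
        (Equiv.swap 0 1)) ≫ _ = tensorPow.map (n + 2) (f ∘ Equiv.swap 0 1) ≫
        (show tensorPow Y (n + 2) ⟶ _ from tensorPow.permHom Y (n + 2) (Equiv.swap 0 1))
      rw [tensorPow.permHom_swap_zero_one, tensorPow.permHom_swap_zero_one]
      have h : ∀ i : Fin n, Equiv.swap (0 : Fin (n + 2)) 1 i.succ.succ = i.succ.succ := fun i =>
        Equiv.swap_apply_of_ne_of_ne (by simp [Fin.ext_iff]) (by simp [Fin.ext_iff])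
      simp only [tensorPow.map, Function.comp_apply, h, Equiv.swap_apply_left, Fin.succ_zero_eq_one,
        Equiv.swap_apply_right]
      exact braidFirst_tensorHom _ _ _
    · have ih := tensorPow.permHom_swap_comp_map n i (fun j => f j.succ)
      have h0 : Equiv.swap i.succ.castSucc i.succ.succ 0 = 0 :=
        Equiv.swap_apply_of_ne_of_ne (by simp [Fin.ext_iff]) (by simp [Fin.ext_iff])
      have h : ∀ j : Fin (n + 1), Equiv.swap i.succ.castSucc i.succ.succ j.succ =
          (Equiv.swap i.castSucc i.succ j).succ := fun j => by
        rw [← Fin.succ_castSucc]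
        exact (Fin.succ_injective _).swap_apply _ _ _
      rw [tensorPow.permHom_swap_succ, tensorPow.permHom_swap_succ]
      rw [tensorPow.map_succ (n + 1) f, tensorPow.map_succ (n + 1) (f ∘ _)]
      simp only [Function.comp_apply, h0, h]
      rw [tensorPow.whisker_eq_cons, tensorPow.whisker_eq_cons, tensorPow.cons_comp]
      refine Eq.trans ?_ (tensorPow.cons_comp _ _ _ _).symm
      rw [Category.id_comp, Category.comp_id]
      exact congrArg (tensorPow.cons (f 0)) ih

/-- Adjacent transpositions generate, and for them this is the naturality of the symmetry. -/
theorem tensorPow.permHom_comp_map {X Y : C} : ∀ (n : ℕ) (σ : Equiv.Perm (Fin n))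
    (f : Fin n → (X ⟶ Y)),
    (show tensorPow X n ⟶ _ from tensorPow.permHom X n σ) ≫ tensorPow.map n f =
      tensorPow.map n (f ∘ σ) ≫ (show tensorPow Y n ⟶ _ from tensorPow.permHom Y n σ)
  | 0, σ, f => by
    have : σ = 1 := Subsingleton.elim _ _
    subst this
    rw [map_one, map_one]
    exact (Category.id_comp _).trans (Category.comp_id _).symm
  | n + 1, σ, f => by
    have hσ : σ ∈ Submonoid.closure
        (Set.range fun i : Fin n => Equiv.swap i.castSucc i.succ) := by
      rw [Equiv.Perm.mclosure_swap_castSucc_succ]; trivial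
    induction hσ using Submonoid.closure_induction generalizing f with
    | mem x hx => obtain ⟨i, rfl⟩ := hx; exact tensorPow.permHom_swap_comp_map n i f
    | one =>
      rw [map_one, map_one]
      exact (Category.id_comp _).trans (Category.comp_id _).symm
    | mul x y _ _ hx hy =>
      rw [map_mul, map_mul, End.mul_def, End.mul_def, Category.assoc, hx, ← Category.assoc, hy,
        Category.assoc]
      rfl

end

/-! ### Weights -/

section
variable {C : Type u} [Category.{v} C] [Preadditive C] [MonoidalCategory C]

/-- The part of `(a + b)^{⊗n}` of degree `k` in `a`. -/
noncomputable def tensorPow.wt {X Y : C} (a b : X ⟶ Y) (n k : ℕ) :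
    tensorPow X n ⟶ tensorPow Y n :=
  ∑ s : Fin n → Bool, if ∑ i, (s i).toNat = k then
    tensorPow.map n (fun i => bif s i then a else b) else 0

/-- A sequence of morphisms shifted by one. -/
def shiftHom {X Y : C} (φ : ℕ → (X ⟶ Y)) : ℕ → (X ⟶ Y)
  | 0 => 0
  | k + 1 => φ k

theorem tensorPow.wt_zero {X Y : C} (a b : X ⟶ Y) (k : ℕ) :
    tensorPow.wt a b 0 k = if k = 0 then tensorPow.nil X Y else 0 := by
  rw [tensorPow.wt, Fintype.sum_unique]
  simp only [Finset.univ_eq_empty, Finset.sum_empty, tensorPow.map, eq_comm]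

/-- A permutation of the factors permutes the words having a given number of letters `a`. -/
theorem tensorPow.permHom_comp_wt [SymmetricCategory C] {X Y : C} (a b : X ⟶ Y) (n k : ℕ) (σ : Equiv.Perm (Fin n)) :
    (show tensorPow X n ⟶ _ from tensorPow.permHom X n σ) ≫ tensorPow.wt a b n k =
      tensorPow.wt a b n k ≫ (show tensorPow Y n ⟶ _ from tensorPow.permHom Y n σ) := by
  rw [tensorPow.wt, Preadditive.comp_sum, Preadditive.sum_comp]
  refine Fintype.sum_equiv (Equiv.arrowCongr σ.symm (Equiv.refl Bool)) _ _ fun s => ?_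
  have h : ∑ i, (Equiv.arrowCongr σ.symm (Equiv.refl Bool) s i).toNat = ∑ i, (s i).toNat :=
    Equiv.sum_comp σ fun i => (s i).toNat
  rw [h]
  split_ifs
  · rw [tensorPow.permHom_comp_map]
    rfl
  · simp

variable [MonoidalPreadditive C]

theorem tensorPow.cons_zero {X Y : C} {n : ℕ} (f : X ⟶ Y) :
    tensorPow.cons f (0 : tensorPow X n ⟶ tensorPow Y n) = 0 :=
  MonoidalPreadditive.tensor_zero f

theorem tensorPow.zero_cons {X Y : C} {n : ℕ} (g : tensorPow X n ⟶ tensorPow Y n) :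
    tensorPow.cons (0 : X ⟶ Y) g = 0 :=
  MonoidalPreadditive.zero_tensor g

theorem tensorPow.cons_sum {X Y : C} {n : ℕ} (f : X ⟶ Y) {ι : Type*} (s : Finset ι)
    (g : ι → (tensorPow X n ⟶ tensorPow Y n)) :
    tensorPow.cons f (∑ i ∈ s, g i) = ∑ i ∈ s, tensorPow.cons f (g i) :=
  tensor_sum s f g

/-- The words are sorted by their first letter. This recursion has the shape of
`SplitGradedFiltration.step`, where a tensor factor is added in front. -/
theorem tensorPow.wt_succ {X Y : C} (a b : X ⟶ Y) (n k : ℕ) :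
    tensorPow.wt a b (n + 1) k =
      tensorPow.cons a (shiftHom (tensorPow.wt a b n) k) +
        tensorPow.cons b (tensorPow.wt a b n k) := by
  have h : ∀ F : (Fin (n + 1) → Bool) → (tensorPow X (n + 1) ⟶ tensorPow Y (n + 1)),
      ∑ s, F s = ∑ s, F (Fin.cons true s) + ∑ s, F (Fin.cons false s) := by
    intro F
    rw [← (Fin.consEquiv fun _ => Bool).sum_comp, Fintype.sum_prod_type, Fintype.sum_bool]
    rfl
  have hsum : ∀ (c : X ⟶ Y) (l : ℕ), (∑ s : Fin n → Bool, if ∑ i, (s i).toNat = l then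
        tensorPow.cons c (tensorPow.map n (fun i => bif s i then a else b)) else 0) =
      tensorPow.cons c (tensorPow.wt a b n l) := by
    intro c l
    rw [tensorPow.wt, tensorPow.cons_sum]
    refine Finset.sum_congr rfl fun s _ => ?_
    split_ifs
    · rfl
    · rw [tensorPow.cons_zero]
  rw [tensorPow.wt, h]
  simp only [Fin.sum_univ_succ, Fin.cons_zero, Fin.cons_succ, Bool.toNat_true, Bool.toNat_false,
    tensorPow.map, zero_add, cond_true, cond_false]
  rw [hsum]
  congr 1
  cases k with
  | zero =>
    rw [shiftHom, tensorPow.cons_zero]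
    refine Finset.sum_eq_zero fun s _ => if_neg (by omega)
  | succ k =>
    rw [shiftHom, ← hsum]
    refine Finset.sum_congr rfl fun s _ => ?_
    have : 1 + ∑ i, (s i).toNat = k + 1 ↔ ∑ i, (s i).toNat = k := by omega
    simp only [this]

theorem tensorPow.wt_eq_zero {X Y : C} (a b : X ⟶ Y) : ∀ {n k : ℕ}, n < k →
    tensorPow.wt a b n k = 0
  | 0, k, h => by rw [tensorPow.wt_zero, if_neg (by omega)]
  | n + 1, 0, h => by omega
  | n + 1, k + 1, h => by
    rw [tensorPow.wt_succ, shiftHom, tensorPow.wt_eq_zero a b (by omega),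
      tensorPow.wt_eq_zero a b (by omega), tensorPow.cons_zero, tensorPow.cons_zero, add_zero]

end

/-! ### The group algebra acting on tensor powers and commuting with weights. -/

section
variable {A : Type u} [Category.{v} A] [Abelian A] [Linear ℚ A] [MonoidalCategory A]
  [SymmetricCategory A]

theorem tensorPow.algHom_single (X : A) (n : ℕ) (σ : Equiv.Perm (Fin n)) :
    tensorPow.algHom X n (MonoidAlgebra.single σ 1) = tensorPow.permHom X n σ := by
  simp [tensorPow.algHom]

/-- The action of the group algebra of the symmetric group on `X^{⊗n}`, as morphisms. -/
noncomputable def tensorPow.act (X : A) {n : ℕ} (x : MonoidAlgebra ℚ (Equiv.Perm (Fin n))) :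
    tensorPow X n ⟶ tensorPow X n := tensorPow.algHom X n x

theorem tensorPow.act_mul (X : A) {n : ℕ} (x y : MonoidAlgebra ℚ (Equiv.Perm (Fin n))) :
    tensorPow.act X (x * y) = tensorPow.act X y ≫ tensorPow.act X x :=
  map_mul (tensorPow.algHom X n) x y

theorem tensorPow.act_one (X : A) (n : ℕ) :
    tensorPow.act X (1 : MonoidAlgebra ℚ (Equiv.Perm (Fin n))) = 𝟙 _ :=
  map_one (tensorPow.algHom X n)

theorem tensorPow.act_add (X : A) {n : ℕ} (x y : MonoidAlgebra ℚ (Equiv.Perm (Fin n))) :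
    tensorPow.act X (x + y) = tensorPow.act X x + tensorPow.act X y :=
  map_add (tensorPow.algHom X n) x y

theorem tensorPow.act_smul (X : A) {n : ℕ} (r : ℚ) (x : MonoidAlgebra ℚ (Equiv.Perm (Fin n))) :
    tensorPow.act X (r • x) = r • tensorPow.act X x :=
  map_smul (tensorPow.algHom X n) r x

theorem tensorPow.act_zero (X : A) (n : ℕ) :
    tensorPow.act X (0 : MonoidAlgebra ℚ (Equiv.Perm (Fin n))) = 0 :=
  map_zero (tensorPow.algHom X n)

theorem tensorPow.act_single (X : A) {n : ℕ} (σ : Equiv.Perm (Fin n)) :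
    tensorPow.act X (MonoidAlgebra.single σ 1) = tensorPow.permHom X n σ :=
  tensorPow.algHom_single X n σ

theorem tensorPow.act_comp {X Y : A} {n : ℕ} {φ : tensorPow X n ⟶ tensorPow Y n}
    (hφ : ∀ σ, (show tensorPow X n ⟶ _ from tensorPow.permHom X n σ) ≫ φ =
      φ ≫ (show tensorPow Y n ⟶ _ from tensorPow.permHom Y n σ))
    (x : MonoidAlgebra ℚ (Equiv.Perm (Fin n))) :
    tensorPow.act X x ≫ φ = φ ≫ tensorPow.act Y x := by
  induction x using MonoidAlgebra.linear_induction with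
  | hzero => simp [tensorPow.act_zero]
  | hadd x y hx hy =>
    rw [tensorPow.act_add, tensorPow.act_add, Preadditive.add_comp, Preadditive.comp_add, hx, hy]
  | hsmul r x hx =>
    rw [tensorPow.act_smul, tensorPow.act_smul, Linear.smul_comp, Linear.comp_smul, hx]
  | hsingle g =>
    rw [tensorPow.act_single, tensorPow.act_single]
    exact hφ g

theorem tensorPow.act_comp_wt [MonoidalPreadditive A] {X Y : A} (a b : X ⟶ Y) (n k : ℕ)
    (x : MonoidAlgebra ℚ (Equiv.Perm (Fin n))) :
    tensorPow.act X x ≫ tensorPow.wt a b n k = tensorPow.wt a b n k ≫ tensorPow.act Y x :=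
  tensorPow.act_comp (tensorPow.permHom_comp_wt a b n k) x

theorem schurObj_eq {n : ℕ} (π : n.Partition) (X : A) :
    K0.cl (schurObj π X) = K0.clIm (tensorPow.act X π.youngIdempotent) := rfl

end

/-! ### Exactness of the tensor product -/

section
variable {A : Type u} [Category.{v} A] [MonoidalCategory A] [BiexactTensor A]

theorem mono_whiskerLeft (X : A) {Y Z : A} (f : Y ⟶ Z) [Mono f] : Mono (X ◁ f) := by
  have := BiexactTensor.left_lim X
  exact inferInstanceAs (Mono ((tensorLeft X).map f))

theorem epi_whiskerLeft (X : A) {Y Z : A} (f : Y ⟶ Z) [Epi f] : Epi (X ◁ f) := by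
  have := BiexactTensor.left_colim X
  exact inferInstanceAs (Epi ((tensorLeft X).map f))

theorem mono_whiskerRight (X : A) {Y Z : A} (f : Y ⟶ Z) [Mono f] : Mono (f ▷ X) := by
  have := BiexactTensor.right_lim X
  exact inferInstanceAs (Mono ((tensorRight X).map f))

theorem epi_whiskerRight (X : A) {Y Z : A} (f : Y ⟶ Z) [Epi f] : Epi (f ▷ X) := by
  have := BiexactTensor.right_colim X
  exact inferInstanceAs (Epi ((tensorRight X).map f))

variable [Abelian A] [MonoidalPreadditive A]

theorem whiskerLeft_shortExact (X : A) {S : ShortComplex A} (hS : S.ShortExact) :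
    (S.map (tensorLeft X)).ShortExact := by
  have := BiexactTensor.left_lim X
  have := BiexactTensor.left_colim X
  exact hS.map_of_exact (tensorLeft X)

theorem whiskerRight_shortExact (X : A) {S : ShortComplex A} (hS : S.ShortExact) :
    (S.map (tensorRight X)).ShortExact := by
  have := BiexactTensor.right_lim X
  have := BiexactTensor.right_colim X
  exact hS.map_of_exact (tensorRight X)

end

section
variable {A : Type u} [Category.{v} A] [Abelian A]

theorem biprod_map_comp_map {X Y Z X' Y' Z' : A} (f : X ⟶ Y) (g : X' ⟶ Y') (f' : Y ⟶ Z)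
    (g' : Y' ⟶ Z') : biprod.map f g ≫ biprod.map f' g' = biprod.map (f ≫ f') (g ≫ g') := by
  ext <;> simp

theorem biprod_lift_comp_map {T X Y X' Y' : A} (x : T ⟶ X) (y : T ⟶ Y) (f : X ⟶ X')
    (g : Y ⟶ Y') : biprod.lift x y ≫ biprod.map f g = biprod.lift (x ≫ f) (y ≫ g) := by
  ext <;> simp

end

/-! ### The filtration of a tensor power induced by a short exact sequence -/

section
variable {A : Type u} [Category.{v} A] [Abelian A]

/-- A decreasing filtration `F` of `B` whose graded pieces are direct summands of `C`, together
with compatible morphisms from `W` onto the steps of the filtration. -/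
structure SplitGradedFiltration {W B C : A} (Φ : ℕ → (W ⟶ B)) (Ψ : ℕ → (W ⟶ C))
    (ω : ℕ → (C ⟶ C)) where
  F : ℕ → A
  G : ℕ → A
  J : ∀ k, F k ⟶ B
  j : ∀ k, F (k + 1) ⟶ F k
  q : ∀ k, F k ⟶ G k
  g : ∀ k, G k ⟶ C
  r : ∀ k, C ⟶ G k
  w : ∀ k, W ⟶ F k
  mono_J : ∀ k, Mono (J k)
  epi_w : ∀ k, Epi (w k)
  isIso_J : IsIso (J 0)
  j_J : ∀ k, j k ≫ J k = J (k + 1)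
  g_r : ∀ k, g k ≫ r k = 𝟙 _
  r_g : ∀ k, r k ≫ g k = ω k
  w_J : ∀ k, w k ≫ J k = Φ k
  w_q : ∀ k, w k ≫ q k ≫ g k = Ψ k
  zero : ∀ k, j k ≫ q k = 0
  exact : ∀ k, (ShortComplex.mk (j k) (q k) (zero k)).ShortExact

namespace SplitGradedFiltration
variable {W B C : A} {Φ : ℕ → (W ⟶ B)} {Ψ : ℕ → (W ⟶ C)} {ω : ℕ → (C ⟶ C)}

section classes
variable (P : SplitGradedFiltration Φ Ψ ω) {eW : W ⟶ W} {eB : B ⟶ B} {eC : C ⟶ C}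

-- The filtration carries no action of its own. Since `F k` is the image of `W` in `B`, the
-- endomorphisms `eW` and `eB`, compatible through `Φ k`, induce an idempotent of `F k`; the one of
-- `G k` is cut out of `eC` by the summand `ω k`. Additivity along the steps telescopes from `F 0 ≅
-- B` to the index `N`, where nothing is left.
include P in
theorem clIm_eq_sum (hB : eB ≫ eB = eB) (hC : eC ≫ eC = eC)
    (hΦ : ∀ k, eW ≫ Φ k = Φ k ≫ eB) (hΨ : ∀ k, eW ≫ Ψ k = Ψ k ≫ eC)
    (hω : ∀ k, eC ≫ ω k = ω k ≫ eC) {N : ℕ} (hN : Φ N = 0) :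
    K0.clIm eB = ∑ k ∈ Finset.range N, K0.clIm (ω k ≫ eC) := by
  have hm := P.mono_J
  have hw := P.epi_w
  have hJ0 := P.isIso_J
  -- The endomorphism of `F k` is the diagonal of this square between the epimorphism `w k` and the
  -- monomorphism `J k`.
  have hsq : ∀ k, CommSq (eW ≫ P.w k) (P.w k) (P.J k) (P.J k ≫ eB) := fun k =>
    ⟨by rw [Category.assoc, P.w_J, hΦ, ← P.w_J, Category.assoc]⟩
  have hlift : ∀ k, ∃ e : P.F k ⟶ P.F k, P.w k ≫ e = eW ≫ P.w k ∧ e ≫ P.J k = P.J k ≫ eB :=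
    fun k => by
      have := hm k
      have := hw k
      have := strongEpi_of_epi (P.w k)
      have : (hsq k).HasLift := inferInstance
      exact ⟨(hsq k).lift, (hsq k).fac_left, (hsq k).fac_right⟩
  choose eF hwF hFJ using hlift
  have hFF : ∀ k, eF k ≫ eF k = eF k := fun k => by
    rw [← cancel_mono (P.J k), Category.assoc, hFJ, ← Category.assoc, hFJ, Category.assoc, hB]
  let eG : ∀ k, P.G k ⟶ P.G k := fun k => P.g k ≫ eC ≫ P.r k
  have hGG : ∀ k, eG k ≫ eG k = eG k := fun k => by
    change (P.g k ≫ eC ≫ P.r k) ≫ (P.g k ≫ eC ≫ P.r k) = P.g k ≫ eC ≫ P.r k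
    have h : P.g k ≫ eC ≫ (P.r k ≫ P.g k) ≫ eC ≫ P.r k = P.g k ≫ (eC ≫ eC) ≫ P.r k := by
      rw [P.r_g, ← Category.assoc eC (ω k), hω, ← P.r_g]
      simp only [Category.assoc]
      rw [reassoc_of% (P.g_r k)]
    simpa only [hC, Category.assoc] using h
  have hj : ∀ k, eF (k + 1) ≫ P.j k = P.j k ≫ eF k := fun k => by
    rw [← cancel_mono (P.J k), Category.assoc, P.j_J, hFJ, Category.assoc, hFJ,
      ← Category.assoc, P.j_J]
  have hgr : ∀ k, Mono (P.g k) := fun k => mono_of_mono_fac (P.g_r k)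
  have hΨω : ∀ k, Ψ k ≫ ω k = Ψ k := fun k => by
    rw [← P.w_q, ← P.r_g, Category.assoc, Category.assoc, ← Category.assoc (P.g k), P.g_r,
      Category.id_comp]
  have hq : ∀ k, eF k ≫ P.q k = P.q k ≫ eG k := fun k => by
    rw [← cancel_mono (P.g k), ← cancel_epi (P.w k)]
    change P.w k ≫ (eF k ≫ P.q k) ≫ P.g k = P.w k ≫ (P.q k ≫ P.g k ≫ eC ≫ P.r k) ≫ P.g k
    calc _ = (P.w k ≫ eF k) ≫ P.q k ≫ P.g k := by simp only [Category.assoc]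
      _ = eW ≫ Ψ k := by rw [hwF, Category.assoc, P.w_q]
      _ = Ψ k ≫ eC ≫ ω k := by
        rw [hω, ← Category.assoc, hΨω, hΨ]
      _ = _ := by rw [← P.w_q, ← P.r_g]; simp only [Category.assoc]
  have hG : ∀ k, K0.clIm (eG k) = K0.clIm (ω k ≫ eC) := fun k => by
    refine K0.clIm_eq_of_comp (hGG k) ?_ (P.g k ≫ eC) (P.r k) (by simp [eG]) ?_
    · have h : (P.r k ≫ P.g k) ≫ eC ≫ (P.r k ≫ P.g k) ≫ eC = (P.r k ≫ P.g k) ≫ eC := by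
        rw [P.r_g, ← Category.assoc eC (ω k), hω, Category.assoc, hC, ← P.r_g]
        simp only [Category.assoc]
        rw [reassoc_of% (P.g_r k)]
      simpa only [P.r_g, Category.assoc] using h
    · rw [← Category.assoc, P.r_g]
  have hstep : ∀ k, K0.clIm (eF k) = K0.clIm (eF (k + 1)) + K0.clIm (ω k ≫ eC) := fun k => by
    rw [← hG]
    exact K0.clIm_τ₂ (P.exact k) (⟨eF (k + 1), eF k, eG k, hj k, hq k⟩ :
      ShortComplex.mk (P.j k) (P.q k) (P.zero k) ⟶ ShortComplex.mk (P.j k) (P.q k) (P.zero k))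
      (by ext1; exacts [hFF _, hFF _, hGG _])
  have hsum : ∀ M, K0.clIm (eF 0) =
      K0.clIm (eF M) + ∑ k ∈ Finset.range M, K0.clIm (ω k ≫ eC) := by
    intro M
    induction M with
    | zero => simp
    | succ M ih => rw [ih, hstep, Finset.sum_range_succ, add_assoc, add_comm (K0.clIm (ω M ≫ eC))]
  have h0 : K0.clIm (eF 0) = K0.clIm eB := by
    refine K0.clIm_eq_of_comp (hFF 0) hB (P.J 0 ≫ eB) (inv (P.J 0)) ?_ ?_
    · rw [← hFJ, Category.assoc, IsIso.hom_inv_id, Category.comp_id]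
    · simp
  -- Between the epimorphism `w N` and the monomorphism `J N`, the endomorphism `eF N` becomes `Φ N
  -- ≫ eB = 0`.
  have hzero : eF N = 0 := by
    rw [← cancel_mono (P.J N), ← cancel_epi (P.w N), hFJ, ← Category.assoc, P.w_J, hN]
    simp
  rw [← h0, hsum N, hzero, K0.clIm_zero, zero_add]

end classes

/-! ### Shift of the filtration by one. -/

section shift
variable (P : SplitGradedFiltration Φ Ψ ω)

/-- The filtration shifted by one. -/
def Fm : ℕ → A
  | 0 => P.F 0
  | k + 1 => P.F k

/-- The step of index `-1` is taken to be `F 0` again, so the graded piece between these two steps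
is zero. -/
noncomputable def Gm : ℕ → A
  | 0 => 0
  | k + 1 => P.G k

def Jm : ∀ k, P.Fm k ⟶ B
  | 0 => P.J 0
  | k + 1 => P.J k

def jm : ∀ k, P.F k ⟶ P.Fm k
  | 0 => 𝟙 _
  | k + 1 => P.j k

/-- The same inclusion as `jm`, typed as a transition map of the shifted filtration; `Fm (k + 1)` is
`F k` by definition. -/
def jm' (k : ℕ) : P.Fm (k + 1) ⟶ P.Fm k := P.jm k

noncomputable def qm : ∀ k, P.Fm k ⟶ P.Gm k
  | 0 => (0 : P.F 0 ⟶ (0 : A))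
  | k + 1 => P.q k

noncomputable def gm : ∀ k, P.Gm k ⟶ C
  | 0 => (0 : (0 : A) ⟶ C)
  | k + 1 => P.g k

noncomputable def rm : ∀ k, C ⟶ P.Gm k
  | 0 => (0 : C ⟶ (0 : A))
  | k + 1 => P.r k

/-- At index `0` the map is zero, in agreement with `shiftHom Φ`, and need not be an epimorphism. In
`epi_sourceHom_factorThruImage` the other summand makes up for this. -/
noncomputable def wm : ∀ k, W ⟶ P.Fm k
  | 0 => 0
  | k + 1 => P.w k

theorem mono_Jm : ∀ k, Mono (P.Jm k)
  | 0 => P.mono_J 0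
  | k + 1 => P.mono_J k

theorem jm_Jm : ∀ k, P.jm k ≫ P.Jm k = P.J k
  | 0 => Category.id_comp _
  | k + 1 => P.j_J k

theorem gm_rm : ∀ k, P.gm k ≫ P.rm k = 𝟙 _
  | 0 => (isZero_zero A).eq_of_src _ _
  | k + 1 => P.g_r k

theorem rm_gm : ∀ k, P.rm k ≫ P.gm k = shiftHom ω k
  | 0 => zero_comp
  | k + 1 => P.r_g k

theorem wm_Jm : ∀ k, P.wm k ≫ P.Jm k = shiftHom Φ k
  | 0 => zero_comp
  | k + 1 => P.w_J k

theorem wm_qm : ∀ k, P.wm k ≫ P.qm k ≫ P.gm k = shiftHom Ψ k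
  | 0 => zero_comp
  | k + 1 => P.w_q k

theorem zero_m : ∀ k, P.jm k ≫ P.qm k = 0
  | 0 => comp_zero
  | k + 1 => P.zero k

theorem jm'_Jm (k : ℕ) : P.jm' k ≫ P.Jm k = P.Jm (k + 1) := P.jm_Jm k

theorem jm'_qm (k : ℕ) : P.jm' k ≫ P.qm k = 0 := P.zero_m k

theorem exact_m : ∀ k, (ShortComplex.mk (P.jm k) (P.qm k) (P.zero_m k)).ShortExact
  | 0 => ShortComplex.Splitting.shortExact ⟨𝟙 _, 0, (Category.id_comp _),
      (isZero_zero A).eq_of_src _ _, by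
        change 𝟙 (P.F 0) ≫ 𝟙 (P.F 0) + (0 : P.F 0 ⟶ (0 : A)) ≫ (0 : (0 : A) ⟶ P.F 0) = 𝟙 (P.F 0)
        simp⟩
  | k + 1 => P.exact k

end shift

/-! ### Tensoring a filtration with a short exact sequence. -/

section step
variable [MonoidalCategory A] [MonoidalPreadditive A] [BiexactTensor A]
  (P : SplitGradedFiltration Φ Ψ ω) (S : ShortComplex A)

/-- The morphism whose image is the `k`-th step of the filtration of `S.X₂ ⊗ B`. -/
noncomputable def stepHom (k : ℕ) : (S.X₁ ⊗ P.Fm k) ⊞ (S.X₂ ⊗ P.F k) ⟶ S.X₂ ⊗ B :=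
  biprod.desc (S.f ⊗ₘ P.Jm k) (S.X₂ ◁ P.J k)

/-- The morphism inducing the projection onto the graded piece. -/
noncomputable def gradedHom (k : ℕ) :
    (S.X₁ ⊗ P.Fm k) ⊞ (S.X₂ ⊗ P.F k) ⟶ (S.X₁ ⊗ P.Gm k) ⊞ (S.X₃ ⊗ P.G k) :=
  biprod.map (S.X₁ ◁ P.qm k) (S.g ⊗ₘ P.q k)

noncomputable def transHom (k : ℕ) :
    (S.X₁ ⊗ P.Fm (k + 1)) ⊞ (S.X₂ ⊗ P.F (k + 1)) ⟶ (S.X₁ ⊗ P.Fm k) ⊞ (S.X₂ ⊗ P.F k) :=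
  biprod.map (S.X₁ ◁ P.jm' k) (S.X₂ ◁ P.j k)

omit [MonoidalPreadditive A] [BiexactTensor A] in
theorem transHom_stepHom (k : ℕ) :
    P.transHom S k ≫ P.stepHom S k = P.stepHom S (k + 1) := by
  rw [transHom, stepHom, stepHom]
  ext
  · simp only [biprod.inl_map_assoc, biprod.inl_desc, ← P.jm'_Jm, ← id_tensorHom,
      tensorHom_comp_tensorHom, Category.id_comp]
  · simp only [biprod.inr_map_assoc, biprod.inr_desc, ← P.j_J, MonoidalCategory.whiskerLeft_comp]

omit [BiexactTensor A] in
theorem transHom_gradedHom (k : ℕ) : P.transHom S k ≫ P.gradedHom S k = 0 := by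
  rw [transHom, gradedHom, biprod_map_comp_map, ← MonoidalCategory.whiskerLeft_comp, P.jm'_qm,
    ← id_tensorHom S.X₂, tensorHom_comp_tensorHom, P.zero]
  ext <;> simp

variable {S} (hS : S.ShortExact)
include hS

/-- This makes the projection to the graded piece well defined on the image of `stepHom`. The
subobjects `X₁ ⊗ F_{k-1}` and `X₂ ⊗ F_k` of `X₂ ⊗ B` meet in `X₁ ⊗ F_k`, on which both projections
vanish. -/
theorem stepHom_zero_imp {k : ℕ} {T : A} (t : T ⟶ (S.X₁ ⊗ P.Fm k) ⊞ (S.X₂ ⊗ P.F k))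
    (ht : t ≫ P.stepHom S k = 0) : t ≫ P.gradedHom S k = 0 := by
  have := hS.mono_f
  have := P.mono_J k
  have := P.mono_Jm k
  obtain ⟨x, y, rfl⟩ : ∃ x y, t = biprod.lift x y :=
    ⟨t ≫ biprod.fst, t ≫ biprod.snd, by ext <;> simp⟩
  rw [stepHom, biprod.lift_desc] at ht
  rw [gradedHom, biprod_lift_comp_map]
  -- In `X₃ ⊗ B` the contribution of `x` vanishes because `S.f ≫ S.g = 0`, so that of `y` vanishes
  -- too.
  have h1 : y ≫ S.g ▷ P.F k = 0 := by
    have := mono_whiskerLeft S.X₃ (P.J k)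
    rw [← cancel_mono (S.X₃ ◁ P.J k), zero_comp, Category.assoc, ← whisker_exchange]
    have h2 := congrArg (· ≫ S.g ▷ B) ht
    simp only [Preadditive.add_comp, Category.assoc, zero_comp, MonoidalCategory.tensorHom_def',
      ← comp_whiskerRight, S.zero] at h2
    simpa using h2
  have hex := whiskerRight_shortExact (P.F k) hS
  have := hex.mono_f
  have ha := hex.exact.lift_f y h1
  set a : T ⟶ S.X₁ ⊗ P.F k := hex.exact.lift y h1 with ha'
  replace ha : a ≫ S.f ▷ P.F k = y := ha
  have h3 : x = -(a ≫ S.X₁ ◁ P.jm k) := by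
    have h4 : Mono (S.f ⊗ₘ P.Jm k) := by
      have := mono_whiskerRight (P.Fm k) S.f
      have := mono_whiskerLeft S.X₂ (P.Jm k)
      rw [MonoidalCategory.tensorHom_def]
      infer_instance
    rw [← cancel_mono (S.f ⊗ₘ P.Jm k), Preadditive.neg_comp, eq_neg_iff_add_eq_zero, ← ht]
    congr 1
    rw [← ha, Category.assoc, Category.assoc, ← P.jm_Jm, ← id_tensorHom, ← tensorHom_id,
      ← id_tensorHom, tensorHom_comp_tensorHom, tensorHom_comp_tensorHom, Category.id_comp,
      Category.id_comp, Category.comp_id]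
  have h5 : x ≫ S.X₁ ◁ P.qm k = 0 := by
    rw [h3, Preadditive.neg_comp, Category.assoc, ← MonoidalCategory.whiskerLeft_comp, P.zero_m]
    simp
  have h6 : y ≫ (S.g ⊗ₘ P.q k) = 0 := by
    rw [MonoidalCategory.tensorHom_def, ← Category.assoc, h1, zero_comp]
  rw [h5, h6]
  ext <;> simp

/-- Exactness in the middle, for generalized elements. By `hx`, `x` lies in `X₁ ⊗ F_k`. By `hy`, the
class of `y` in `X₂ ⊗ G_k` comes from `X₁ ⊗ G_k`; on a cover `T'` of `T` it lifts to `x2` in `X₁ ⊗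
F_k`, and `y - x2` lies in `X₂ ⊗ F_{k+1}`. -/
theorem gradedHom_exact {k : ℕ} {T : A} (x : T ⟶ S.X₁ ⊗ P.Fm k) (y : T ⟶ S.X₂ ⊗ P.F k)
    (hx : x ≫ S.X₁ ◁ P.qm k = 0) (hy : y ≫ (S.g ⊗ₘ P.q k) = 0) :
    ∃ (T' : A) (π : T' ⟶ T) (_ : Epi π)
      (t : T' ⟶ (S.X₁ ⊗ P.Fm (k + 1)) ⊞ (S.X₂ ⊗ P.F (k + 1))),
      π ≫ biprod.lift x y ≫ P.stepHom S k = t ≫ P.stepHom S (k + 1) := by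
  have hex1 := whiskerLeft_shortExact S.X₁ (P.exact_m k)
  have := hex1.mono_f
  have h1 := hex1.exact.lift_f x hx
  set x1 : T ⟶ S.X₁ ⊗ P.F k := hex1.exact.lift x hx
  replace h1 : x1 ≫ S.X₁ ◁ P.jm k = x := h1
  have hex2 := whiskerRight_shortExact (P.G k) hS
  have := hex2.mono_f
  have hy' : (y ≫ S.X₂ ◁ P.q k) ≫ S.g ▷ P.G k = 0 := by
    rw [Category.assoc, ← MonoidalCategory.tensorHom_def', hy]
  have h2 := hex2.exact.lift_f (y ≫ S.X₂ ◁ P.q k) hy'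
  set v : T ⟶ S.X₁ ⊗ P.G k := hex2.exact.lift (y ≫ S.X₂ ◁ P.q k) hy'
  replace h2 : v ≫ S.f ▷ P.G k = y ≫ S.X₂ ◁ P.q k := h2
  have : Epi (P.q k) := (P.exact k).epi_g
  have := epi_whiskerLeft S.X₁ (P.q k)
  obtain ⟨T', π, hπ, x2, hx2⟩ := surjective_up_to_refinements_of_epi (S.X₁ ◁ P.q k) v
  have hex3 := whiskerLeft_shortExact S.X₂ (P.exact k)
  have := hex3.mono_f
  have hz : (π ≫ y - x2 ≫ S.f ▷ P.F k) ≫ S.X₂ ◁ P.q k = 0 := by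
    rw [Preadditive.sub_comp, sub_eq_zero, Category.assoc, Category.assoc, ← h2,
      ← Category.assoc π, hx2, Category.assoc, whisker_exchange]
  have h3 := hex3.exact.lift_f _ hz
  set y2 : T' ⟶ S.X₂ ⊗ P.F (k + 1) := hex3.exact.lift _ hz
  replace h3 : y2 ≫ S.X₂ ◁ P.j k = π ≫ y - x2 ≫ S.f ▷ P.F k := h3
  -- The correction `x2` is moved from the second summand to the first; its two images in `X₂ ⊗ B`
  -- agree, so the total does not change.
  let t : T' ⟶ (S.X₁ ⊗ P.Fm (k + 1)) ⊞ (S.X₂ ⊗ P.F (k + 1)) := biprod.lift (π ≫ x1 + x2) y2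
  refine ⟨T', π, hπ, t, ?_⟩
  rw [← P.transHom_stepHom S k]
  have h4 : t ≫ P.transHom S k = biprod.lift (π ≫ x + x2 ≫ S.X₁ ◁ P.jm k)
      (π ≫ y - x2 ≫ S.f ▷ P.F k) := by
    rw [← h3, ← h1, ← Category.assoc π, ← Preadditive.add_comp]
    exact biprod_lift_comp_map _ _ _ _
  have h5 : x2 ≫ S.X₁ ◁ P.jm k ≫ (S.f ⊗ₘ P.Jm k) = x2 ≫ S.f ▷ P.F k ≫ S.X₂ ◁ P.J k := by
    rw [← P.jm_Jm, ← id_tensorHom, ← tensorHom_id, ← id_tensorHom, tensorHom_comp_tensorHom,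
      tensorHom_comp_tensorHom, Category.id_comp, Category.id_comp, Category.comp_id]
  rw [← Category.assoc t, h4, stepHom, biprod.lift_desc, biprod.lift_desc]
  simp only [Preadditive.add_comp, Preadditive.sub_comp, Preadditive.comp_add, Category.assoc, h5]
  abel

end step
end SplitGradedFiltration
end

/-! ### The induced filtration of a tensor product. -/

namespace SplitGradedFiltration

section
variable {A : Type u} [Category.{v} A] [Abelian A] [MonoidalCategory A] [MonoidalPreadditive A]
variable {W B C : A} {Φ : ℕ → (W ⟶ B)} {Ψ : ℕ → (W ⟶ C)} {ω : ℕ → (C ⟶ C)}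
  (P : SplitGradedFiltration Φ Ψ ω) (S : ShortComplex A)

/-- The morphism onto the source of `stepHom`. -/
noncomputable def sourceHom (k : ℕ) :
    (S.X₁ ⊞ S.X₂) ⊗ W ⟶ (S.X₁ ⊗ P.Fm k) ⊞ (S.X₂ ⊗ P.F k) :=
  biprod.lift (biprod.fst ⊗ₘ P.wm k) (biprod.snd ⊗ₘ P.w k)

omit [MonoidalPreadditive A] in
theorem sourceHom_stepHom (k : ℕ) : P.sourceHom S k ≫ P.stepHom S k =
    ((biprod.fst ≫ S.f) ⊗ₘ shiftHom Φ k) + (biprod.snd ⊗ₘ Φ k) := by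
  rw [sourceHom, stepHom, biprod.lift_desc, ← id_tensorHom, tensorHom_comp_tensorHom,
    tensorHom_comp_tensorHom, P.wm_Jm, P.w_J, Category.comp_id]

theorem inl_sourceHom (k : ℕ) :
    biprod.inl ▷ W ≫ P.sourceHom S k = S.X₁ ◁ P.wm k ≫ biprod.inl := by
  rw [sourceHom]
  ext <;> simp [← tensorHom_id, ← id_tensorHom]

theorem inr_sourceHom (k : ℕ) :
    biprod.inr ▷ W ≫ P.sourceHom S k = S.X₂ ◁ P.w k ≫ biprod.inr := by
  rw [sourceHom]
  ext <;> simp [← tensorHom_id, ← id_tensorHom]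

noncomputable def gradedι (k : ℕ) :
    (S.X₁ ⊗ P.Gm k) ⊞ (S.X₃ ⊗ P.G k) ⟶ (S.X₁ ⊞ S.X₃) ⊗ C :=
  biprod.desc (biprod.inl ⊗ₘ P.gm k) (biprod.inr ⊗ₘ P.g k)

noncomputable def gradedπ (k : ℕ) :
    (S.X₁ ⊞ S.X₃) ⊗ C ⟶ (S.X₁ ⊗ P.Gm k) ⊞ (S.X₃ ⊗ P.G k) :=
  biprod.lift (biprod.fst ⊗ₘ P.rm k) (biprod.snd ⊗ₘ P.r k)

theorem gradedι_gradedπ (k : ℕ) : P.gradedι S k ≫ P.gradedπ S k = 𝟙 _ := by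
  rw [gradedι, gradedπ]
  ext <;> simp [P.gm_rm, P.g_r]

omit [MonoidalPreadditive A] in
theorem gradedπ_gradedι (k : ℕ) : P.gradedπ S k ≫ P.gradedι S k =
    ((biprod.fst ≫ biprod.inl) ⊗ₘ shiftHom ω k) + ((biprod.snd ≫ biprod.inr) ⊗ₘ ω k) := by
  rw [gradedι, gradedπ, biprod.lift_desc, tensorHom_comp_tensorHom, tensorHom_comp_tensorHom,
    P.rm_gm, P.r_g]

omit [MonoidalPreadditive A] in
theorem sourceHom_gradedHom (k : ℕ) : P.sourceHom S k ≫ P.gradedHom S k ≫ P.gradedι S k =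
    ((biprod.fst ≫ biprod.inl) ⊗ₘ shiftHom Ψ k) + ((biprod.snd ≫ S.g ≫ biprod.inr) ⊗ₘ Ψ k) := by
  rw [sourceHom, gradedHom, gradedι, ← Category.assoc, biprod_lift_comp_map, biprod.lift_desc,
    ← id_tensorHom]
  simp only [tensorHom_comp_tensorHom, Category.comp_id, Category.assoc, P.wm_qm, P.w_q]

variable [BiexactTensor A]

-- The summand `X₂ ⊗ F_0` alone is already all of `X₂ ⊗ B`.
omit [MonoidalPreadditive A] [BiexactTensor A] in
theorem isIso_image_ι_zero : IsIso (image.ι (P.stepHom S 0)) := by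
  have := P.isIso_J
  have h : (biprod.inr ≫ factorThruImage (P.stepHom S 0)) ≫ image.ι (P.stepHom S 0) =
      S.X₂ ◁ P.J 0 := by
    rw [Category.assoc, image.fac, stepHom, biprod.inr_desc]
  have : IsIso (S.X₂ ◁ P.J 0) := inferInstance
  have : Epi (image.ι (P.stepHom S 0)) := by
    have : Epi ((biprod.inr ≫ factorThruImage (P.stepHom S 0)) ≫ image.ι (P.stepHom S 0)) := by
      rw [h]; infer_instance
    exact epi_of_epi (biprod.inr ≫ factorThruImage (P.stepHom S 0)) _
  exact isIso_of_mono_of_epi _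

theorem epi_sourceHom_factorThruImage (k : ℕ) :
    Epi (P.sourceHom S k ≫ factorThruImage (P.stepHom S k)) := by
  refine Preadditive.epi_of_cancel_zero _ fun h hh => ?_
  rw [Category.assoc] at hh
  have := P.epi_w k
  have := epi_whiskerLeft S.X₂ (P.w k)
  have h2 : biprod.inr ≫ factorThruImage (P.stepHom S k) ≫ h = 0 := by
    rw [← cancel_epi (S.X₂ ◁ P.w k), comp_zero, ← Category.assoc, ← P.inr_sourceHom,
      Category.assoc, hh, comp_zero]
  cases k with
  | zero =>
    -- Since `wm 0 = 0`, the first summand gives no information at index `0`; the second maps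
    -- isomorphically to the image of `stepHom`.
    have := P.isIso_image_ι_zero S
    have := P.isIso_J
    have h3 : biprod.inr ≫ factorThruImage (P.stepHom S 0) =
        S.X₂ ◁ P.J 0 ≫ inv (image.ι (P.stepHom S 0)) := by
      rw [IsIso.eq_comp_inv, Category.assoc, image.fac, stepHom, biprod.inr_desc]
    rw [← Category.assoc, h3] at h2
    rwa [← cancel_epi (S.X₂ ◁ P.J 0 ≫ inv (image.ι (P.stepHom S 0))), comp_zero]
  | succ k =>
    have : Epi (P.wm (k + 1)) := P.epi_w k
    have := epi_whiskerLeft S.X₁ (P.wm (k + 1))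
    have h1 : biprod.inl ≫ factorThruImage (P.stepHom S (k + 1)) ≫ h = 0 := by
      rw [← cancel_epi (S.X₁ ◁ P.wm (k + 1)), comp_zero, ← Category.assoc, ← P.inl_sourceHom,
        Category.assoc, hh, comp_zero]
    rw [← cancel_epi (factorThruImage (P.stepHom S (k + 1))), comp_zero]
    ext
    · rw [h1, comp_zero]
    · rw [h2, comp_zero]

variable {S} (hS : S.ShortExact)

noncomputable def imageTrans (_ : S.ShortExact) (k : ℕ) :
    image (P.stepHom S (k + 1)) ⟶ image (P.stepHom S k) :=
  image.lift ⟨image (P.stepHom S k), image.ι _, P.transHom S k ≫ factorThruImage _,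
    by rw [Category.assoc, image.fac, P.transHom_stepHom]⟩

omit [MonoidalPreadditive A] [BiexactTensor A] in
theorem imageTrans_ι (k : ℕ) :
    P.imageTrans hS k ≫ image.ι (P.stepHom S k) = image.ι (P.stepHom S (k + 1)) :=
  image.lift_fac _

noncomputable def imageGraded (k : ℕ) :
    image (P.stepHom S k) ⟶ (S.X₁ ⊗ P.Gm k) ⊞ (S.X₃ ⊗ P.G k) :=
  Abelian.epiDesc (factorThruImage (P.stepHom S k)) (P.gradedHom S k)
    (P.stepHom_zero_imp hS _ (by
      have h := kernel.condition (factorThruImage (P.stepHom S k)) =≫ image.ι (P.stepHom S k)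
      rwa [Category.assoc, image.fac, zero_comp] at h))

theorem factorThruImage_imageGraded (k : ℕ) :
    factorThruImage (P.stepHom S k) ≫ P.imageGraded hS k = P.gradedHom S k :=
  Abelian.comp_epiDesc _ _ _

theorem factorThruImage_imageTrans (k : ℕ) :
    factorThruImage (P.stepHom S (k + 1)) ≫ P.imageTrans hS k =
      P.transHom S k ≫ factorThruImage (P.stepHom S k) := by
  rw [← cancel_mono (image.ι (P.stepHom S k)), Category.assoc, imageTrans_ι, image.fac,
    Category.assoc, image.fac, P.transHom_stepHom]

theorem imageTrans_imageGraded (k : ℕ) : P.imageTrans hS k ≫ P.imageGraded hS k = 0 := by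
  rw [← cancel_epi (factorThruImage (P.stepHom S (k + 1))), comp_zero, ← Category.assoc,
    factorThruImage_imageTrans, Category.assoc, factorThruImage_imageGraded,
    P.transHom_gradedHom]

/-- A generalized element of the image killed by the projection is lifted to the source of
`stepHom`, where `gradedHom_exact` shows that it comes from the next step. -/
theorem image_shortExact (k : ℕ) :
    (ShortComplex.mk (P.imageTrans hS k) (P.imageGraded hS k)
      (P.imageTrans_imageGraded hS k)).ShortExact := by
  have hm : Mono (P.imageTrans hS k) := by
    have : Mono (P.imageTrans hS k ≫ image.ι (P.stepHom S k)) := by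
      rw [imageTrans_ι]; infer_instance
    exact mono_of_mono _ (image.ι (P.stepHom S k))
  have he : Epi (P.imageGraded hS k) := by
    have h1 : Epi (P.q k) := (P.exact k).epi_g
    have h2 : Epi (P.qm k) := (P.exact_m k).epi_g
    have := epi_whiskerLeft S.X₁ (P.qm k)
    have := hS.epi_g
    have := epi_whiskerRight (P.F k) S.g
    have := epi_whiskerLeft S.X₃ (P.q k)
    have h3 : Epi (S.g ⊗ₘ P.q k) := by
      rw [MonoidalCategory.tensorHom_def]; infer_instance
    have : Epi (P.gradedHom S k) := by
      rw [gradedHom]; infer_instance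
    have : Epi (factorThruImage (P.stepHom S k) ≫ P.imageGraded hS k) := by
      rw [factorThruImage_imageGraded]; infer_instance
    exact epi_of_epi (factorThruImage (P.stepHom S k)) _
  refine ShortComplex.ShortExact.mk' ?_ hm he
  rw [ShortComplex.exact_iff_exact_up_to_refinements]
  intro T x₂ hx₂
  change T ⟶ image (P.stepHom S k) at x₂
  change x₂ ≫ P.imageGraded hS k = 0 at hx₂
  obtain ⟨T₁, π₁, _, z, hz⟩ :=
    surjective_up_to_refinements_of_epi (factorThruImage (P.stepHom S k)) x₂
  have hzg : z ≫ P.gradedHom S k = 0 := by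
    rw [← P.factorThruImage_imageGraded hS, ← Category.assoc, ← hz, Category.assoc, hx₂, comp_zero]
  obtain ⟨x, y, rfl⟩ : ∃ x y, z = biprod.lift x y :=
    ⟨z ≫ biprod.fst, z ≫ biprod.snd, by ext <;> simp⟩
  rw [gradedHom, biprod_lift_comp_map] at hzg
  have hx : x ≫ S.X₁ ◁ P.qm k = 0 := by simpa using hzg =≫ biprod.fst
  have hy : y ≫ (S.g ⊗ₘ P.q k) = 0 := by simpa using hzg =≫ biprod.snd
  obtain ⟨T₂, π₂, _, t, ht⟩ := P.gradedHom_exact hS x y hx hy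
  refine ⟨T₂, π₂ ≫ π₁, inferInstance, t ≫ factorThruImage (P.stepHom S (k + 1)), ?_⟩
  change (π₂ ≫ π₁) ≫ x₂ = (t ≫ factorThruImage _) ≫ P.imageTrans hS k
  rw [← cancel_mono (image.ι (P.stepHom S k)), Category.assoc π₂, hz]
  simp only [Category.assoc, image.fac, ht, P.imageTrans_ι]

/-- The filtration of a tensor product induced by a short exact sequence and a filtration of the
second factor. -/
noncomputable def step : SplitGradedFiltration
    (fun k => ((biprod.fst ≫ S.f) ⊗ₘ shiftHom Φ k) + (biprod.snd ⊗ₘ Φ k) :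
      ℕ → ((S.X₁ ⊞ S.X₂) ⊗ W ⟶ S.X₂ ⊗ B))
    (fun k => ((biprod.fst ≫ biprod.inl) ⊗ₘ shiftHom Ψ k) +
      ((biprod.snd ≫ S.g ≫ biprod.inr) ⊗ₘ Ψ k) :
      ℕ → ((S.X₁ ⊞ S.X₂) ⊗ W ⟶ (S.X₁ ⊞ S.X₃) ⊗ C))
    (fun k => ((biprod.fst ≫ biprod.inl) ⊗ₘ shiftHom ω k) + ((biprod.snd ≫ biprod.inr) ⊗ₘ ω k)) where
  F k := image (P.stepHom S k)
  G k := (S.X₁ ⊗ P.Gm k) ⊞ (S.X₃ ⊗ P.G k)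
  J k := image.ι (P.stepHom S k)
  j := P.imageTrans hS
  q := P.imageGraded hS
  g := P.gradedι S
  r := P.gradedπ S
  w k := P.sourceHom S k ≫ factorThruImage (P.stepHom S k)
  mono_J _ := inferInstance
  epi_w := P.epi_sourceHom_factorThruImage S
  isIso_J := P.isIso_image_ι_zero S
  j_J := P.imageTrans_ι hS
  g_r := P.gradedι_gradedπ S
  r_g := P.gradedπ_gradedι S
  w_J k := by rw [Category.assoc, image.fac, sourceHom_stepHom]
  w_q k := by
    rw [Category.assoc, ← Category.assoc (factorThruImage _), P.factorThruImage_imageGraded hS,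
      sourceHom_gradedHom]
  zero := P.imageTrans_imageGraded hS
  exact := P.image_shortExact hS

/-- The trivial filtration of the unit object. -/
noncomputable def base (X : A) : SplitGradedFiltration
    (fun k => if k = 0 then 𝟙 X else 0) (fun k => if k = 0 then 𝟙 X else 0)
    (fun k => if k = 0 then 𝟙 X else 0) where
  F k := if k = 0 then X else 0
  G k := if k = 0 then X else 0
  J
  | 0 => 𝟙 X
  | _ + 1 => (0 : (0 : A) ⟶ X)
  j
  | 0 => (0 : (0 : A) ⟶ X)
  | _ + 1 => 𝟙 (0 : A)
  q
  | 0 => 𝟙 X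
  | _ + 1 => 𝟙 (0 : A)
  g
  | 0 => 𝟙 X
  | _ + 1 => (0 : (0 : A) ⟶ X)
  r
  | 0 => 𝟙 X
  | _ + 1 => (0 : X ⟶ (0 : A))
  w
  | 0 => 𝟙 X
  | _ + 1 => (0 : X ⟶ (0 : A))
  mono_J
  | 0 => inferInstanceAs (Mono (𝟙 X))
  | _ + 1 => inferInstanceAs (Mono (0 : (0 : A) ⟶ X))
  epi_w
  | 0 => inferInstanceAs (Epi (𝟙 X))
  | _ + 1 => inferInstanceAs (Epi (0 : X ⟶ (0 : A)))
  isIso_J := inferInstanceAs (IsIso (𝟙 X))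
  j_J
  | 0 => Category.comp_id _
  | _ + 1 => comp_zero
  g_r
  | 0 => Category.comp_id _
  | _ + 1 => (isZero_zero A).eq_of_src _ _
  r_g
  | 0 => Category.comp_id _
  | _ + 1 => comp_zero
  w_J
  | 0 => Category.comp_id _
  | _ + 1 => comp_zero
  w_q
  | 0 => (Category.id_comp _).trans (Category.id_comp _)
  | _ + 1 => zero_comp
  zero
  | 0 => (isZero_zero A).eq_of_src _ _
  | _ + 1 => (isZero_zero A).eq_of_src _ _
  exact
  | 0 => ShortComplex.Splitting.shortExact ⟨(0 : X ⟶ (0 : A)), 𝟙 X,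
      (isZero_zero A).eq_of_src _ _, Category.comp_id (𝟙 X), by
        change (0 : X ⟶ (0 : A)) ≫ (0 : (0 : A) ⟶ X) + 𝟙 X ≫ 𝟙 X = 𝟙 X
        simp⟩
  | _ + 1 => ShortComplex.Splitting.shortExact ⟨𝟙 (0 : A), 𝟙 (0 : A),
      (isZero_zero A).eq_of_src _ _, (isZero_zero A).eq_of_src _ _, (isZero_zero A).eq_of_src _ _⟩

end
end SplitGradedFiltration

/-! ### The filtration of tensor powers. -/

section
variable {A : Type u} [Category.{v} A] [Abelian A] [MonoidalCategory A] [MonoidalPreadditive A]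
  [BiexactTensor A] {S : ShortComplex A}

/-- By `wt_zero` and `wt_succ` the weights have the form produced by `base` and `step`. The object
`W` is the power of `X₁ ⊞ X₂`, on which the symmetric group acts and commutes with all weights; this
makes the filtration equivariant without an action on its steps being part of the data. -/
theorem tensorPow.nonempty_splitGradedFiltration (hS : S.ShortExact) : ∀ n : ℕ,
    Nonempty (SplitGradedFiltration
      (tensorPow.wt (biprod.fst ≫ S.f) biprod.snd n :
        ℕ → (tensorPow (S.X₁ ⊞ S.X₂) n ⟶ tensorPow S.X₂ n))
      (tensorPow.wt (biprod.fst ≫ biprod.inl) (biprod.snd ≫ S.g ≫ biprod.inr) n :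
        ℕ → (tensorPow (S.X₁ ⊞ S.X₂) n ⟶ tensorPow (S.X₁ ⊞ S.X₃) n))
      (tensorPow.wt (biprod.fst ≫ biprod.inl) (biprod.snd ≫ biprod.inr) n :
        ℕ → (tensorPow (S.X₁ ⊞ S.X₃) n ⟶ tensorPow (S.X₁ ⊞ S.X₃) n)))
  | 0 => by
    simp only [funext (tensorPow.wt_zero _ _)]
    exact ⟨SplitGradedFiltration.base (𝟙_ A)⟩
  | n + 1 => by
    obtain ⟨P⟩ := nonempty_splitGradedFiltration hS n
    simp only [funext (tensorPow.wt_succ _ _ n)]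
    exact ⟨P.step hS⟩

variable [SymmetricCategory A] [Linear ℚ A]

/-- Group algebra elements commute with the weights, so `clIm_eq_sum` applies. The sum stops at
weight `n` because a word of length `n` has at most `n` letters of one kind. -/
theorem K0.clIm_act_eq_sum (hS : S.ShortExact) {n : ℕ}
    {e : MonoidAlgebra ℚ (Equiv.Perm (Fin n))} (he : e * e = e) :
    K0.clIm (tensorPow.act S.X₂ e) = ∑ k ∈ Finset.range (n + 1),
      K0.clIm (tensorPow.wt (biprod.fst ≫ biprod.inl) (biprod.snd ≫ biprod.inr) n k ≫
        tensorPow.act (S.X₁ ⊞ S.X₃) e) := by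
  obtain ⟨P⟩ := tensorPow.nonempty_splitGradedFiltration hS n
  have hact : ∀ X : A, tensorPow.act X e ≫ tensorPow.act X e = tensorPow.act X e := fun X => by
    rw [← tensorPow.act_mul, he]
  exact P.clIm_eq_sum (eW := tensorPow.act _ e) (hact _) (hact _)
    (fun k => tensorPow.act_comp_wt _ _ n k e) (fun k => tensorPow.act_comp_wt _ _ n k e)
    (fun k => tensorPow.act_comp_wt _ _ n k e) (tensorPow.wt_eq_zero _ _ (Nat.lt_succ_self n))

end

/-! ### Tensor powers of two subobjects -/

theorem Equiv.Perm.viaEmbedding_swap {α β : Type*} [DecidableEq α] [DecidableEq β] (ι : α ↪ β)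
    (x y : α) : Equiv.Perm.viaEmbedding (Equiv.swap x y) ι = Equiv.swap (ι x) (ι y) := by
  ext z
  by_cases hz : z ∈ Set.range ι
  · obtain ⟨z, rfl⟩ := hz
    rw [Equiv.Perm.viaEmbedding_apply, ι.injective.swap_apply]
  · rw [Equiv.Perm.viaEmbedding_apply_of_notMem _ _ _ hz, Equiv.swap_apply_of_ne_of_ne]
    · rintro rfl; exact hz ⟨_, rfl⟩
    · rintro rfl; exact hz ⟨_, rfl⟩

theorem PermLift.act_of_apply_zero {M : ℕ → Type*} [∀ n, Monoid (M n)]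
    (ι : ∀ n, M n →* M (n + 1)) (b : ∀ n, M (n + 2)) {n : ℕ} {σ : Equiv.Perm (Fin (n + 1))}
    (h : σ 0 = 0) {τ : Equiv.Perm (Fin n)} (hτ : PermLift.rem σ = τ) :
    PermLift.act ι b (n + 1) σ = ι n (PermLift.act ι b n τ) := by
  rw [PermLift.act, h, hτ]
  simp [PermLift.cyc]

namespace tensorPow

section
variable {C : Type u} [Category.{v} C] [MonoidalCategory C]

/-- The tensor product of powers of two morphisms with a common target. -/
def join {X Z U : C} (a : X ⟶ U) (b : Z ⟶ U) (l : ℕ) :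
    ∀ k : ℕ, tensorPow X k ⊗ tensorPow Z l ⟶ tensorPow U (l + k)
  | 0 => (λ_ (tensorPow Z l)).hom ≫ map l fun _ => b
  | k + 1 => (α_ X (tensorPow X k) (tensorPow Z l)).hom ≫ (a ⊗ₘ join a b l k)

/-- The tensor product of powers of two morphisms with a common source. -/
def split {X Z U : C} (a : U ⟶ X) (b : U ⟶ Z) (l : ℕ) :
    ∀ k : ℕ, tensorPow U (l + k) ⟶ tensorPow X k ⊗ tensorPow Z l
  | 0 => (map l fun _ => b) ≫ (λ_ (tensorPow Z l)).inv
  | k + 1 => (a ⊗ₘ split a b l k) ≫ (α_ X (tensorPow X k) (tensorPow Z l)).inv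

theorem map_const_id (X : C) : ∀ n, map n (fun _ => 𝟙 X) = 𝟙 (tensorPow X n)
  | 0 => rfl
  | n + 1 => by rw [map_succ, map_const_id X n, cons_id]

theorem join_split {X Z U : C} {a : X ⟶ U} {b : Z ⟶ U} {a' : U ⟶ X} {b' : U ⟶ Z}
    (ha : a ≫ a' = 𝟙 X) (hb : b ≫ b' = 𝟙 Z) (l : ℕ) :
    ∀ k, join a b l k ≫ split a' b' l k = 𝟙 _
  | 0 => by
    change ((λ_ (tensorPow Z l)).hom ≫ map l fun _ => b) ≫ (map l fun _ => b') ≫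
      (λ_ (tensorPow Z l)).inv = 𝟙 _
    have h := map_comp l (fun _ => b) (fun _ => b')
    rw [Category.assoc, reassoc_of% h]
    simp only [hb, map_const_id, Category.id_comp, Iso.hom_inv_id]
  | k + 1 => by
    change ((α_ X (tensorPow X k) (tensorPow Z l)).hom ≫ (a ⊗ₘ join a b l k)) ≫
      (a' ⊗ₘ split a' b' l k) ≫ (α_ X (tensorPow X k) (tensorPow Z l)).inv = 𝟙 _
    rw [Category.assoc, tensorHom_comp_tensorHom_assoc, ha, join_split ha hb l k]
    simp

theorem split_join {X Z U : C} (a : X ⟶ U) (b : Z ⟶ U) (a' : U ⟶ X) (b' : U ⟶ Z) (l : ℕ) :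
    ∀ k, split a' b' l k ≫ join a b l k =
      map (l + k) fun i => bif decide (i.val < k) then a' ≫ a else b' ≫ b
  | 0 => by
    change ((map l fun _ => b') ≫ (λ_ (tensorPow Z l)).inv) ≫ (λ_ (tensorPow Z l)).hom ≫
      (map l fun _ => b) = _
    rw [Category.assoc, Iso.inv_hom_id_assoc, map_comp]
    simp
  | k + 1 => by
    change ((a' ⊗ₘ split a' b' l k) ≫ (α_ X (tensorPow X k) (tensorPow Z l)).inv) ≫
      (α_ X (tensorPow X k) (tensorPow Z l)).hom ≫ (a ⊗ₘ join a b l k) = _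
    rw [Category.assoc, Iso.inv_hom_id_assoc, tensorHom_comp_tensorHom, split_join a b a' b' l k]
    change cons _ _ = map ((l + k) + 1) _
    rw [map_succ]
    simp

variable [SymmetricCategory C]

/-- The endomorphism of a tensor power given by a permutation. -/
def perm (X : C) (n : ℕ) (σ : Equiv.Perm (Fin n)) : tensorPow X n ⟶ tensorPow X n :=
  permHom X n σ

theorem perm_one (X : C) (n : ℕ) : perm X n 1 = 𝟙 _ := map_one (permHom X n)

theorem perm_mul (X : C) (n : ℕ) (σ τ : Equiv.Perm (Fin n)) :
    perm X n (σ * τ) = perm X n τ ≫ perm X n σ := map_mul (permHom X n) σ τ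

theorem perm_of_apply_zero (X : C) {n : ℕ} {σ : Equiv.Perm (Fin (n + 1))} (h : σ 0 = 0)
    {τ : Equiv.Perm (Fin n)} (hτ : ∀ i, σ i.succ = (τ i).succ) :
    perm X (n + 1) σ = X ◁ perm X n τ := by
  have hr : PermLift.rem σ = τ := PermLift.rem_eq σ 0 τ h (by simpa using hτ)
  exact PermLift.act_of_apply_zero (M := fun n => End (tensorPow X n)) _ _ h hr

theorem perm_swap_zero_one (X : C) (n : ℕ) :
    perm X (n + 2) (Equiv.swap 0 1) = braidFirst X (tensorPow X n) := permHom_swap_zero_one X n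

theorem perm_swap_succ (X : C) (n : ℕ) (i : Fin n) :
    perm X (n + 2) (Equiv.swap i.succ.castSucc i.succ.succ) =
      X ◁ perm X (n + 1) (Equiv.swap i.castSucc i.succ) := permHom_swap_succ X n i

theorem perm_comp_map {X Y : C} (n : ℕ) (σ : Equiv.Perm (Fin n)) (f : Fin n → (X ⟶ Y)) :
    perm X n σ ≫ map n f = map n (f ∘ σ) ≫ perm Y n σ := permHom_comp_map n σ f

omit [SymmetricCategory C] in
theorem whiskerLeft_associator_tensorHom {X T Z U V : C} (a : X ⟶ U) {j : T ⊗ Z ⟶ V}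
    {t : Z ⟶ Z} {p : V ⟶ V} (h : T ◁ t ≫ j = j ≫ p) :
    (X ⊗ T) ◁ t ≫ (α_ X T Z).hom ≫ (a ⊗ₘ j) = ((α_ X T Z).hom ≫ (a ⊗ₘ j)) ≫ U ◁ p := by
  rw [Category.assoc, ← id_tensorHom U, tensorHom_comp_tensorHom, ← h, ← id_tensorHom,
    ← id_tensorHom_id, Category.comp_id, associator_naturality_assoc, tensorHom_comp_tensorHom,
    Category.id_comp, id_tensorHom]

omit [SymmetricCategory C] in
theorem whiskerRight_associator_tensorHom {X T Z U V : C} (a : X ⟶ U) {j : T ⊗ Z ⟶ V}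
    {t : T ⟶ T} {p : V ⟶ V} (h : t ▷ Z ≫ j = j ≫ p) :
    (X ◁ t) ▷ Z ≫ (α_ X T Z).hom ≫ (a ⊗ₘ j) = ((α_ X T Z).hom ≫ (a ⊗ₘ j)) ≫ U ◁ p := by
  rw [Category.assoc, ← id_tensorHom U, tensorHom_comp_tensorHom, ← h, ← tensorHom_id,
    ← id_tensorHom, Category.comp_id, associator_naturality_assoc, tensorHom_comp_tensorHom,
    Category.id_comp, tensorHom_id]

theorem braidFirst_associator_tensorHom {X T Z U V : C} (a : X ⟶ U) (j : T ⊗ Z ⟶ V) :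
    braidFirst X T ▷ Z ≫ (α_ X (X ⊗ T) Z).hom ≫ (a ⊗ₘ ((α_ X T Z).hom ≫ (a ⊗ₘ j))) =
      ((α_ X (X ⊗ T) Z).hom ≫ (a ⊗ₘ ((α_ X T Z).hom ≫ (a ⊗ₘ j)))) ≫ braidFirst U V := by
  have h : (a ⊗ₘ ((α_ X T Z).hom ≫ (a ⊗ₘ j))) = X ◁ (α_ X T Z).hom ≫ (a ⊗ₘ a ⊗ₘ j) := by
    rw [← id_tensorHom X, tensorHom_comp_tensorHom, Category.id_comp]
  have h2 : braidFirst X T ▷ Z ≫ (α_ X (X ⊗ T) Z).hom ≫ X ◁ (α_ X T Z).hom =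
      ((α_ X (X ⊗ T) Z).hom ≫ X ◁ (α_ X T Z).hom) ≫ braidFirst X (T ⊗ Z) := by
    simp only [braidFirst]
    monoidal
  rw [h, Category.assoc, Category.assoc, ← braidFirst_tensorHom a a]
  simpa only [Category.assoc] using h2 =≫ (a ⊗ₘ a ⊗ₘ j)

/-- Each new factor `X` stands in front and is fixed, so the induction step is whiskering. -/
theorem perm_right_comp_join {X Z U : C} (a : X ⟶ U) (b : Z ⟶ U) (l : ℕ)
    (τ : Equiv.Perm (Fin l)) : ∀ k : ℕ,
    (tensorPow X k ◁ perm Z l τ) ≫ join a b l k =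
      join a b l k ≫ perm U (l + k) (τ.viaEmbedding (Fin.addNatEmb k))
  | 0 => by
    have : τ.viaEmbedding (Fin.addNatEmb 0) = τ := by
      ext i
      exact congrArg Fin.val (Equiv.Perm.viaEmbedding_apply τ (Fin.addNatEmb 0) i)
    rw [this]
    change (𝟙_ C ◁ perm Z l τ) ≫ (λ_ (tensorPow Z l)).hom ≫ (map l fun _ => b) =
      ((λ_ (tensorPow Z l)).hom ≫ map l fun _ => b) ≫ perm U l τ
    rw [leftUnitor_naturality_assoc, perm_comp_map, Category.assoc]
    rfl
  | k + 1 => by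
    have h0 : τ.viaEmbedding (Fin.addNatEmb (k + 1)) (0 : Fin (l + k + 1)) = 0 := by
      apply Equiv.Perm.viaEmbedding_apply_of_notMem
      rintro ⟨i, hi⟩
      have := congrArg Fin.val hi
      simp at this
    have h1 : ∀ i : Fin (l + k), τ.viaEmbedding (Fin.addNatEmb (k + 1)) i.succ =
        (τ.viaEmbedding (Fin.addNatEmb k) i).succ := by
      intro i
      by_cases hi : i ∈ Set.range (Fin.addNatEmb k : Fin l ↪ Fin (l + k))
      · obtain ⟨j, rfl⟩ := hi
        rw [Equiv.Perm.viaEmbedding_apply]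
        exact Equiv.Perm.viaEmbedding_apply τ (Fin.addNatEmb (k + 1)) j
      · rw [Equiv.Perm.viaEmbedding_apply_of_notMem _ _ _ hi]
        apply Equiv.Perm.viaEmbedding_apply_of_notMem
        rintro ⟨j, hj⟩
        refine hi ⟨j, Fin.succ_injective _ ?_⟩
        rw [← hj]
        rfl
    have h2 : perm U (l + (k + 1)) (τ.viaEmbedding (Fin.addNatEmb (k + 1))) =
        U ◁ perm U (l + k) (τ.viaEmbedding (Fin.addNatEmb k)) := perm_of_apply_zero U h0 h1
    rw [h2]
    exact whiskerLeft_associator_tensorHom a (perm_right_comp_join a b l τ k)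

/-- It is enough to treat adjacent transpositions. The one of the two front factors is handled by
coherence and naturality of the symmetry, and the others are whiskered from one factor fewer. -/
theorem perm_left_comp_join {X Z U : C} (a : X ⟶ U) (b : Z ⟶ U) (l : ℕ) : ∀ (k : ℕ)
    (σ : Equiv.Perm (Fin k)), (perm X k σ ▷ tensorPow Z l) ≫ join a b l k =
      join a b l k ≫ perm U (l + k) (σ.viaEmbedding (Fin.castLEEmb (Nat.le_add_left k l)))
  | 0, σ => by
    have h : σ = 1 := Subsingleton.elim _ _
    have h1 : (1 : Equiv.Perm (Fin 0)).viaEmbedding (Fin.castLEEmb (Nat.le_add_left 0 l)) = 1 :=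
      map_one (Equiv.Perm.viaEmbeddingHom _)
    rw [h, h1, perm_one, perm_one]
    simp
  | k + 1, σ => by
    have hσ : σ ∈ Submonoid.closure
        (Set.range fun i : Fin k => Equiv.swap i.castSucc i.succ) := by
      rw [Equiv.Perm.mclosure_swap_castSucc_succ]; trivial
    induction hσ using Submonoid.closure_induction with
    | mem x hx =>
      obtain ⟨i, rfl⟩ := hx
      rw [Equiv.Perm.viaEmbedding_swap]
      cases k with
      | zero => exact i.elim0
      | succ k =>
        refine Fin.cases ?_ (fun i => ?_) i
        · change perm X (k + 2) (Equiv.swap 0 1) ▷ _ ≫ _ =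
            _ ≫ perm U (l + k + 2) (Equiv.swap 0 1)
          rw [perm_swap_zero_one, perm_swap_zero_one]
          exact braidFirst_associator_tensorHom a (join a b l k)
        · have ih := perm_left_comp_join a b l (k + 1) (Equiv.swap i.castSucc i.succ)
          rw [Equiv.Perm.viaEmbedding_swap] at ih
          change _ = _ ≫ perm U (l + k + 2) (Equiv.swap
            (Fin.castLE (Nat.le_add_left k l) i).succ.castSucc
            (Fin.castLE (Nat.le_add_left k l) i).succ.succ)
          rw [perm_swap_succ, perm_swap_succ]
          exact whiskerRight_associator_tensorHom a ih
    | one =>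
      have h1 : (1 : Equiv.Perm (Fin (k + 1))).viaEmbedding
          (Fin.castLEEmb (Nat.le_add_left (k + 1) l)) = 1 :=
        map_one (Equiv.Perm.viaEmbeddingHom _)
      rw [h1, perm_one, perm_one]
      simp
    | mul x y _ _ hx hy =>
      have h1 : (x * y).viaEmbedding (Fin.castLEEmb (Nat.le_add_left (k + 1) l)) = _ :=
        map_mul (Equiv.Perm.viaEmbeddingHom _) x y
      rw [h1, perm_mul, perm_mul, comp_whiskerRight, Category.assoc, hx, ← Category.assoc, hy,
        Category.assoc]
      rfl

/-- Powers of two complementary summands of `U` in a power of `U`. -/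
theorem exists_split {X Z U : C} {a : X ⟶ U} {b : Z ⟶ U} {a' : U ⟶ X} {b' : U ⟶ Z}
    (ha : a ≫ a' = 𝟙 X) (hb : b ≫ b' = 𝟙 Z) (k l : ℕ) :
    ∃ (j : tensorPow X k ⊗ tensorPow Z l ⟶ tensorPow U (k + l))
      (r : tensorPow U (k + l) ⟶ tensorPow X k ⊗ tensorPow Z l), j ≫ r = 𝟙 _ ∧
      (r ≫ j = map (k + l) fun i => bif decide (i.val < k) then a' ≫ a else b' ≫ b) ∧
      ∀ σ τ, (perm X k σ ⊗ₘ perm Z l τ) ≫ j = j ≫ perm U (k + l) (blockHom k l (σ, τ)) := by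
  -- The maps `join` and `split` live on the power `l + k`, where their recursion on `k` is
  -- definitional. A general exponent `N`, with the permutation described by its values, moves the
  -- result to `k + l` without casts.
  suffices H : ∀ N (h : l + k = N), ∃ (j : tensorPow X k ⊗ tensorPow Z l ⟶ tensorPow U N)
      (r : tensorPow U N ⟶ tensorPow X k ⊗ tensorPow Z l), j ≫ r = 𝟙 _ ∧
      (r ≫ j = map N fun i => bif decide (i.val < k) then a' ≫ a else b' ≫ b) ∧
      ∀ σ τ (g : Equiv.Perm (Fin N)),
        (∀ i : Fin k, (g ⟨i, by omega⟩).val = σ i) →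
        (∀ i : Fin l, (g ⟨k + i, by omega⟩).val = k + τ i) →
        (perm X k σ ⊗ₘ perm Z l τ) ≫ j = j ≫ perm U N g by
    obtain ⟨j, r, h1, h2, h3⟩ := H (k + l) (Nat.add_comm _ _)
    refine ⟨j, r, h1, h2, fun σ τ => h3 σ τ _ (fun i => ?_) fun i => ?_⟩
    · exact congrArg Fin.val (blockHom_castAdd σ τ i)
    · exact congrArg Fin.val (blockHom_natAdd σ τ i)
  rintro N rfl
  refine ⟨join a b l k, split a' b' l k, join_split ha hb l k, split_join a b a' b' l k,
    fun σ τ g h1 h2 => ?_⟩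
  -- A block permutation is the product of its two blocks, each extended by the identity.
  have hg : g = τ.viaEmbedding (Fin.addNatEmb k) *
      σ.viaEmbedding (Fin.castLEEmb (Nat.le_add_left k l)) := by
    ext i
    rw [Equiv.Perm.mul_apply]
    by_cases hi : i.val < k
    · have h3 : σ.viaEmbedding (Fin.castLEEmb (Nat.le_add_left k l)) i = _ :=
        Equiv.Perm.viaEmbedding_apply σ (Fin.castLEEmb (Nat.le_add_left k l)) ⟨i, hi⟩
      rw [h3, Equiv.Perm.viaEmbedding_apply_of_notMem]
      · exact h1 ⟨i, hi⟩
      · rintro ⟨j, hj⟩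
        have := congrArg Fin.val hj
        simp at this
        omega
    · have h3 : σ.viaEmbedding (Fin.castLEEmb (Nat.le_add_left k l)) i = i := by
        apply Equiv.Perm.viaEmbedding_apply_of_notMem
        rintro ⟨j, hj⟩
        have := congrArg Fin.val hj
        simp at this
        omega
      have h4 : i = Fin.addNatEmb k ⟨i - k, by omega⟩ := by
        ext
        simp
        omega
      have h5 : (⟨k + (i.val - k), by omega⟩ : Fin (l + k)) = i := by
        ext
        simp
        omega
      have h6 := h2 ⟨i - k, by omega⟩
      simp only [h5] at h6
      have h7 : τ.viaEmbedding (Fin.addNatEmb k) i = Fin.addNatEmb k (τ ⟨i - k, by omega⟩) :=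
        (congrArg _ h4).trans (Equiv.Perm.viaEmbedding_apply _ _ _)
      rw [h3, h6, h7, Nat.add_comm k]
      rfl
  rw [hg, perm_mul, ← Category.assoc, ← perm_left_comp_join, Category.assoc,
    ← perm_right_comp_join, ← Category.assoc, MonoidalCategory.tensorHom_def]

end
end tensorPow

/-! ### Endomorphisms of a group algebra over a subgroup -/

namespace MonoidAlgebra
variable {G : Type*} [Group G] (H : Subgroup G)

/-- The group algebra of a subgroup, as a subspace. -/
noncomputable def spanSubgroup : Submodule ℚ (MonoidAlgebra ℚ G) :=
  Submodule.span ℚ {x | ∃ h ∈ H, x = single h 1}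

open Classical in
/-- The projection to the group algebra of a subgroup. -/
noncomputable def restrict : MonoidAlgebra ℚ G →ₗ[ℚ] MonoidAlgebra ℚ G :=
  (groupBasis G).constr ℚ fun g => if g ∈ H then single g 1 else 0

variable {H}

theorem single_mem_spanSubgroup {h : G} (hh : h ∈ H) : single h (1 : ℚ) ∈ spanSubgroup H :=
  Submodule.subset_span ⟨h, hh, rfl⟩

open Classical in
theorem restrict_single_eq (g : G) :
    restrict H (single g (1 : ℚ)) = if g ∈ H then single g 1 else 0 := by
  exact (groupBasis G).constr_basis ℚ _ g

theorem restrict_single {h : G} (hh : h ∈ H) :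
    restrict H (single h (1 : ℚ)) = single h 1 := by
  rw [restrict_single_eq, if_pos hh]

theorem restrict_single_of_notMem {g : G} (hg : g ∉ H) : restrict H (single g (1 : ℚ)) = 0 := by
  rw [restrict_single_eq, if_neg hg]

theorem restrict_mem (x : MonoidAlgebra ℚ G) : restrict H x ∈ spanSubgroup H := by
  induction x using linear_induction with
  | hzero => rw [map_zero]; exact zero_mem _
  | hadd x y hx hy => rw [map_add]; exact add_mem hx hy
  | hsmul r x hx => rw [map_smul]; exact Submodule.smul_mem _ _ hx
  | hsingle g =>
    by_cases hg : g ∈ H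
    · rw [restrict_single hg]; exact single_mem_spanSubgroup hg
    · rw [restrict_single_of_notMem hg]; exact zero_mem _

theorem restrict_of_mem {x : MonoidAlgebra ℚ G} (hx : x ∈ spanSubgroup H) :
    restrict H x = x := by
  induction hx using Submodule.span_induction with
  | mem x hx => obtain ⟨h, hh, rfl⟩ := hx; exact restrict_single hh
  | zero => exact map_zero _
  | add x y _ _ hx hy => rw [map_add, hx, hy]
  | smul r x _ hx => rw [map_smul, hx]

theorem restrict_mul_single (x : MonoidAlgebra ℚ G) {h : G} (hh : h ∈ H) :
    restrict H (x * single h 1) = restrict H x * single h 1 := by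
  induction x using linear_induction with
  | hzero => simp
  | hadd x y hx hy => rw [add_mul, map_add, map_add, add_mul, hx, hy]
  | hsmul r x hx => rw [smul_mul_assoc, map_smul, map_smul, smul_mul_assoc, hx]
  | hsingle g =>
    rw [single_mul_single, one_mul]
    by_cases hg : g ∈ H
    · rw [restrict_single hg, restrict_single (H.mul_mem hg hh), single_mul_single, one_mul]
    · rw [restrict_single_of_notMem hg, restrict_single_of_notMem
        fun h' => hg ((H.mul_mem_cancel_right hh).1 h'), zero_mul]

/-- For a group element `u` in place of `y`, the term of `g` is `u` when `g` lies in the coset `uH`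
and zero otherwise. The formula serves as a resolution of the identity. -/
theorem sum_single_mul_restrict [Fintype G] (y : MonoidAlgebra ℚ G) :
    ∑ g : G, single g (1 : ℚ) * restrict H (single g⁻¹ 1 * y) = (Nat.card H : ℚ) • y := by
  classical
  induction y using linear_induction with
  | hzero => simp
  | hadd x y hx hy =>
    rw [smul_add, ← hx, ← hy, ← Finset.sum_add_distrib]
    exact Finset.sum_congr rfl fun g _ => by rw [mul_add, map_add, mul_add]
  | hsmul r x hx =>
    rw [smul_comm, ← hx, Finset.smul_sum]
    exact Finset.sum_congr rfl fun g _ => by rw [mul_smul_comm, map_smul, mul_smul_comm]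
  | hsingle u =>
    have h : ∀ g : G, single g (1 : ℚ) * restrict H (single g⁻¹ 1 * single u 1) =
        if g⁻¹ * u ∈ H then single u 1 else 0 := by
      intro g
      rw [single_mul_single, one_mul, restrict_single_eq]
      split_ifs
      · rw [single_mul_single, one_mul, mul_inv_cancel_left]
      · rw [mul_zero]
    rw [Finset.sum_congr rfl fun g _ => h g,
      ← Equiv.sum_comp ((Equiv.inv G).trans (Equiv.mulLeft u))]
    simp only [Equiv.trans_apply, Equiv.inv_apply, Equiv.coe_mulLeft, mul_inv_rev, inv_inv,
      inv_mul_cancel_right]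
    rw [← Finset.sum_filter, Finset.sum_const, Nat.card_eq_fintype_card, Fintype.card_subtype,
      Nat.cast_smul_eq_nsmul]

variable (H) in
/-- The endomorphisms of the group algebra commuting with right multiplications by `H`. -/
noncomputable def relEnd : Subalgebra ℚ (Module.End ℚ (MonoidAlgebra ℚ G)) :=
  Subalgebra.centralizer ℚ {f | ∃ h ∈ H, f = LinearMap.mulRight ℚ (single h 1)}

theorem mem_relEnd {d : Module.End ℚ (MonoidAlgebra ℚ G)} :
    d ∈ relEnd H ↔ ∀ h ∈ H, ∀ x, d (x * single h 1) = d x * single h 1 := by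
  rw [relEnd, Subalgebra.mem_centralizer_iff]
  constructor
  · intro h g hg x
    exact (LinearMap.congr_fun (h _ ⟨g, hg, rfl⟩) x).symm
  · rintro h _ ⟨g, hg, rfl⟩
    exact LinearMap.ext fun x => (h g hg x).symm

namespace relEnd

instance [Finite G] : Module.Finite ℚ (relEnd H) :=
  FiniteDimensional.finiteDimensional_subalgebra _

theorem apply_mul (d : relEnd H) (x : MonoidAlgebra ℚ G) {y : MonoidAlgebra ℚ G}
    (hy : y ∈ spanSubgroup H) : d.1 (x * y) = d.1 x * y := by
  induction hy using Submodule.span_induction with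
  | mem y hy => obtain ⟨h, hh, rfl⟩ := hy; exact mem_relEnd.1 d.2 h hh x
  | zero => simp
  | add y z _ _ hy hz => rw [mul_add, map_add, hy, hz, mul_add]
  | smul r y _ hy => rw [mul_smul_comm, map_smul, hy, mul_smul_comm]

variable (H) in
/-- Left multiplications. -/
noncomputable def left : MonoidAlgebra ℚ G →ₐ[ℚ] relEnd H :=
  (Algebra.lmul ℚ (MonoidAlgebra ℚ G)).codRestrict _ fun x => mem_relEnd.2 fun h _ y => by
    simp [mul_assoc]

variable (H) in
/-- The projection to the group algebra of the subgroup. -/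
noncomputable def proj : relEnd H := ⟨restrict H, mem_relEnd.2 fun _ hh x =>
  restrict_mul_single x hh⟩

theorem proj_apply (x : MonoidAlgebra ℚ G) : (proj H).1 x = restrict H x := rfl

theorem smul_apply (r : ℚ) (d : relEnd H) (x : MonoidAlgebra ℚ G) : (r • d).1 x = r • d.1 x := rfl

theorem ext {d d' : relEnd H} (h : ∀ x, d.1 x = d'.1 x) : d = d' :=
  Subtype.ext (LinearMap.ext h)

theorem apply_eq (d : relEnd H) {x : MonoidAlgebra ℚ G} (hx : x ∈ spanSubgroup H) :
    d.1 x = d.1 1 * x := by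
  rw [← apply_mul d 1 hx, one_mul]

theorem mul_mem {x y : MonoidAlgebra ℚ G} (hx : x ∈ spanSubgroup H) (hy : y ∈ spanSubgroup H) :
    x * y ∈ spanSubgroup H := by
  rw [← restrict_of_mem hx, ← proj_apply, ← apply_mul _ _ hy]
  exact restrict_mem _

theorem proj_mul_left {x : MonoidAlgebra ℚ G} (hx : x ∈ spanSubgroup H) :
    proj H * left H x * proj H = left H x * proj H :=
  ext fun y => by
    change restrict H (x * restrict H y) = x * restrict H y
    exact restrict_of_mem (mul_mem hx (restrict_mem y))

variable {σ : Type*} {f : σ → MonoidAlgebra ℚ G} (hmem : ∀ s, f s ∈ spanSubgroup H)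
include hmem

/-- The idempotent `proj H` generates the unit ideal of `relEnd H` and its corner is a copy of
`ℚ[H]`, so a split family for `ℚ[H]` becomes one for `relEnd H`, as under a Morita equivalence. -/
theorem isSplitFamily [Fintype G] (idem : ∀ s, f s * f s = f s)
    (orth : ∀ s t, s ≠ t → ∀ a ∈ spanSubgroup H, f s * a * f t = 0)
    (prim : ∀ s, ∀ a ∈ spanSubgroup H, ∃ k : ℚ, f s * a * f s = k • f s)
    (full : (1 : MonoidAlgebra ℚ G) ∈ Submodule.span ℚ {x | ∃ s, ∃ a ∈ spanSubgroup H,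
      ∃ b ∈ spanSubgroup H, x = a * f s * b}) :
    IsSplitFamily fun s => left H (f s) * proj H := by
  -- As `d` is right `ℚ[H]`-linear, between two projections it acts as left multiplication by the
  -- part of `d 1` in `ℚ[H]`.
  have key : ∀ s t (d : relEnd H), ∃ a ∈ spanSubgroup H,
      left H (f s) * proj H * d * (left H (f t) * proj H) = left H (f s * a * f t) * proj H := by
    intro s t d
    refine ⟨restrict H (d.1 1), restrict_mem _, ext fun x => ?_⟩
    change f s * restrict H (d.1 (f t * restrict H x)) =
      f s * restrict H (d.1 1) * f t * restrict H x
    have h1 := mul_mem (hmem t) (restrict_mem (H := H) x)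
    rw [apply_eq d h1, ← proj_apply, apply_mul _ _ h1, proj_apply]
    simp only [mul_assoc]
  refine ⟨fun s => ?_, fun s t hst d => ?_, fun s d => ?_, ?_⟩
  · rw [mul_assoc, ← mul_assoc (proj H), proj_mul_left (hmem s), ← mul_assoc, ← map_mul, idem]
  · obtain ⟨a, ha, h⟩ := key s t d
    rw [h, orth s t hst a ha, map_zero, zero_mul]
  · obtain ⟨a, ha, h⟩ := key s s d
    obtain ⟨k, hk⟩ := prim s a ha
    exact ⟨k, by rw [h, hk, map_smul, smul_mul_assoc]⟩
  · set I := Submodule.span ℚ {x : relEnd H | ∃ s a b, x = a * (left H (f s) * proj H) * b} with hI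
    have hmulI : ∀ a b, ∀ x ∈ I, a * x * b ∈ I := by
      intro a b x hx
      induction hx using Submodule.span_induction with
      | mem x hx =>
        obtain ⟨s, c, d, rfl⟩ := hx
        exact Submodule.subset_span ⟨s, a * c, d * b, by simp only [mul_assoc]⟩
      | zero => simp
      | add x y _ _ hx hy => rw [mul_add, add_mul]; exact add_mem hx hy
      | smul r x _ hx => rw [mul_smul_comm, smul_mul_assoc]; exact Submodule.smul_mem _ _ hx
    have hproj : ∀ x ∈ Submodule.span ℚ {x | ∃ s, ∃ a ∈ spanSubgroup H,
        ∃ b ∈ spanSubgroup H, x = a * f s * b}, left H x * proj H ∈ I := by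
      intro x hx
      induction hx using Submodule.span_induction with
      | mem x hx =>
        obtain ⟨s, a, -, b, hb, rfl⟩ := hx
        refine Submodule.subset_span ⟨s, left H a, left H b * proj H, ?_⟩
        have h := proj_mul_left hb
        simp only [map_mul, mul_assoc] at h ⊢
        rw [h]
      | zero => simp
      | add x y _ _ hx hy => rw [map_add, add_mul]; exact add_mem hx hy
      | smul r x _ hx => rw [map_smul, smul_mul_assoc]; exact Submodule.smul_mem _ _ hx
    have h1 : proj H ∈ I := by simpa using hproj 1 full
    -- The unit is a multiple of the sum of all conjugates of `proj H`, so the ideal generated by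
    -- `proj H` contains it.
    have h2 : ((Nat.card H : ℚ)⁻¹ • ∑ g : G, left H (single g 1) * proj H *
        left H (single g⁻¹ 1)) = 1 := by
      refine ext fun x => ?_
      have hc : (Nat.card H : ℚ) ≠ 0 := Nat.cast_ne_zero.2 Nat.card_pos.ne'
      have h3 := sum_single_mul_restrict (H := H) x
      rw [smul_apply]
      have h4 : (∑ g : G, left H (single g 1) * proj H * left H (single g⁻¹ 1)).1 x =
          ∑ g : G, single g (1 : ℚ) * restrict H (single g⁻¹ 1 * x) := by
        rw [AddSubmonoidClass.coe_finsetSum, LinearMap.sum_apply]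
        rfl
      rw [h4, h3, smul_smul, inv_mul_cancel₀ hc, one_smul]
      rfl
    rw [← h2]
    exact Submodule.smul_mem _ _ (Submodule.sum_mem _ fun g _ => hmulI _ _ _ h1)

/-- Evaluation at `1` identifies the two corners; an element `x` of `e ℚ[G] f_s` comes from `left H
x * proj H`. -/
theorem finrank_corner (idem : ∀ s, f s * f s = f s) {e : MonoidAlgebra ℚ G} (he : e * e = e)
    (s : σ) : Module.finrank ℚ (corner (left H e) (left H (f s) * proj H)) =
      Module.finrank ℚ (corner e (f s)) := by
  have he' : left H e * left H e = left H e := by rw [← map_mul, he]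
  have hf' : left H (f s) * proj H * (left H (f s) * proj H) = left H (f s) * proj H := by
    rw [mul_assoc, ← mul_assoc (proj H), proj_mul_left (hmem s), ← mul_assoc, ← map_mul, idem]
  have hone : restrict H (1 : MonoidAlgebra ℚ G) = 1 := restrict_single H.one_mem
  refine LinearEquiv.finrank_eq (LinearEquiv.ofBijective
    (LinearMap.restrict (((LinearMap.applyₗ (1 : MonoidAlgebra ℚ G)).comp
      (relEnd H).val.toLinearMap)) fun d hd => ?_ :
      corner (left H e) (left H (f s) * proj H) →ₗ[ℚ] corner e (f s)) ⟨?_, ?_⟩)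
  · obtain ⟨h1, h2⟩ := (mem_corner he' hf').1 hd
    refine (mem_corner he (idem s)).2 ⟨?_, ?_⟩
    · exact congrArg (fun d => d.1 (1 : MonoidAlgebra ℚ G)) h1
    · change d.1 1 * f s = d.1 1
      rw [← apply_eq d (hmem s)]
      conv_rhs => rw [← h2]
      change _ = d.1 (f s * restrict H 1)
      rw [hone, mul_one]
  · rintro ⟨d, hd⟩ ⟨d', hd'⟩ h
    have h0 : d.1 1 = d'.1 1 := congrArg Subtype.val h
    obtain ⟨-, h2⟩ := (mem_corner he' hf').1 hd
    obtain ⟨-, h2'⟩ := (mem_corner he' hf').1 hd'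
    refine Subtype.ext (ext fun x => ?_)
    change d.1 x = d'.1 x
    rw [← h2, ← h2']
    change d.1 (f s * restrict H x) = d'.1 (f s * restrict H x)
    have h3 := mul_mem (hmem s) (restrict_mem (H := H) x)
    rw [apply_eq d h3, apply_eq d' h3, h0]
  · rintro ⟨x, hx⟩
    obtain ⟨h1, h2⟩ := (mem_corner he (idem s)).1 hx
    refine ⟨⟨left H x * proj H, (mem_corner he' hf').2 ⟨?_, ?_⟩⟩, Subtype.ext ?_⟩
    · rw [← mul_assoc, ← map_mul, h1]
    · rw [mul_assoc, ← mul_assoc (proj H), proj_mul_left (hmem s), ← mul_assoc, ← map_mul, h2]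
    · change x * restrict H 1 = x
      rw [hone, mul_one]

end relEnd

/-! ### Relative endomorphisms acting on an induced module. -/

section action
variable {Q : Type*} [Ring Q] [Algebra ℚ Q] (F : MonoidAlgebra ℚ G →ₐ[ℚ] Q) {ε : Q}
  [Fintype G]

/-- The average of the conjugates of an element over the cosets of a subgroup. -/
noncomputable def average (H : Subgroup G) (ε : Q) : Q :=
  (Nat.card H : ℚ)⁻¹ • ∑ g : G, F (single g 1) * ε * F (single g⁻¹ 1)

variable (hε : ε * ε = ε) (hcomm : ∀ h ∈ H, ε * F (single h 1) = F (single h 1) * ε)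
  (hzero : ∀ g, g ∉ H → ε * F (single g 1) * ε = 0)
include hε hcomm hzero

-- The hypotheses describe an induced module: `ε` projects to a piece stable under `H`, and the
-- translate of this piece by any `g ∉ H` is killed by `ε`. Hence `ε` sees only the part of `x` in
-- `ℚ[H]`.
omit [Fintype G] in
theorem mul_map_mul (x : MonoidAlgebra ℚ G) : ε * F x * ε = F (restrict H x) * ε := by
  induction x using linear_induction with
  | hzero => simp
  | hadd x y hx hy => simp only [map_add, mul_add, add_mul, hx, hy]
  | hsmul r x hx => simp only [map_smul, mul_smul_comm, smul_mul_assoc, hx]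
  | hsingle g =>
    by_cases hg : g ∈ H
    · rw [restrict_single hg, hcomm g hg, mul_assoc, hε]
    · rw [restrict_single_of_notMem hg, hzero g hg, map_zero, zero_mul]

/-- The action of the relative endomorphism algebra on an induced module. -/
noncomputable def relEnd.action : relEnd H →ₙ+* Q where
  toFun d := (Nat.card H : ℚ)⁻¹ • ∑ g : G, F (d.1 (single g 1)) * ε * F (single g⁻¹ 1)
  map_zero' := by
    change (Nat.card H : ℚ)⁻¹ • ∑ g : G, F (0 : MonoidAlgebra ℚ G) * ε * F (single g⁻¹ 1) = 0
    simp
  map_add' d d' := by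
    rw [← smul_add, ← Finset.sum_add_distrib]
    congr 1
    refine Finset.sum_congr rfl fun g _ => ?_
    rw [← add_mul, ← add_mul, ← map_add]
    rfl
  map_mul' d d' := by
    have hc : (Nat.card H : ℚ) ≠ 0 := Nat.cast_ne_zero.2 Nat.card_pos.ne'
    rw [smul_mul_smul_comm, Finset.sum_mul_sum, Finset.sum_comm, mul_smul]
    refine congrArg ((Nat.card H : ℚ)⁻¹ • ·) ?_
    rw [Finset.smul_sum]
    refine Finset.sum_congr rfl fun g' _ => ?_
    -- The inner factor `ε F(y) ε` depends only on the part of `y` in `ℚ[H]`, which can be moved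
    -- inside `d`. The sum over `g` is then given by `sum_single_mul_restrict`, whose factor `|H|`
    -- cancels one of the two normalizations.
    have h1 : ∀ g : G, F (d.1 (single g 1)) * ε * F (single g⁻¹ 1) *
        (F (d'.1 (single g' 1)) * ε * F (single g'⁻¹ 1)) =
        F (d.1 (single g 1 * restrict H (single g⁻¹ 1 * d'.1 (single g' 1)))) *
          (ε * F (single g'⁻¹ 1)) := by
      intro g
      have h2 := mul_map_mul F hε hcomm hzero (single g⁻¹ 1 * d'.1 (single g' 1))
      rw [relEnd.apply_mul d _ (restrict_mem _), map_mul]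
      calc _ = F (d.1 (single g 1)) * (ε * (F (single g⁻¹ 1) * F (d'.1 (single g' 1))) * ε) *
            F (single g'⁻¹ 1) := by simp only [mul_assoc]
        _ = _ := by rw [← map_mul, h2]; simp only [mul_assoc]
    rw [Finset.sum_congr rfl fun g _ => h1 g, ← Finset.sum_mul, ← map_sum, ← map_sum,
      sum_single_mul_restrict, map_smul, map_smul, smul_mul_assoc, smul_smul, inv_mul_cancel₀ hc,
      one_smul, ← mul_assoc]
    rfl

/-- In particular the unit acts as `average F H ε`, the projector to the whole induced module, which
is why the action is only a non-unital homomorphism. -/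
theorem relEnd.action_left (x : MonoidAlgebra ℚ G) :
    relEnd.action F hε hcomm hzero (relEnd.left H x) = F x * average F H ε := by
  change (Nat.card H : ℚ)⁻¹ • ∑ g : G, F (x * single g 1) * ε * F (single g⁻¹ 1) = _
  rw [average, mul_smul_comm, Finset.mul_sum]
  simp only [map_mul, mul_assoc]

theorem relEnd.action_left_mul_proj (x : MonoidAlgebra ℚ G) :
    relEnd.action F hε hcomm hzero (relEnd.left H x * relEnd.proj H) = F x * ε := by
  classical
  have hc : (Nat.card H : ℚ) ≠ 0 := Nat.cast_ne_zero.2 Nat.card_pos.ne'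
  change (Nat.card H : ℚ)⁻¹ • ∑ g : G, F (x * restrict H (single g 1)) * ε * F (single g⁻¹ 1) = _
  have h : ∀ g : G, F (x * restrict H (single g 1)) * ε * F (single g⁻¹ 1) =
      if g ∈ H then F x * ε else 0 := by
    intro g
    split_ifs with hg
    · rw [restrict_single hg, mul_assoc, hcomm _ (H.inv_mem hg), ← mul_assoc, ← map_mul, mul_assoc,
        single_mul_single, mul_inv_cancel, one_mul, ← one_def, mul_one]
    · rw [restrict_single_of_notMem hg, mul_zero, map_zero, zero_mul, zero_mul]
  rw [Finset.sum_congr rfl fun g _ => h g, ← Finset.sum_filter, Finset.sum_const,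
    ← Fintype.card_subtype, ← Nat.card_eq_fintype_card, ← Nat.cast_smul_eq_nsmul ℚ, smul_smul]
  rw [show Nat.card {x // x ∈ H} = Nat.card H from rfl, inv_mul_cancel₀ hc, one_smul]

end action
end MonoidAlgebra

namespace K0
variable {A : Type u} [Category.{v} A] [Abelian A] [Linear ℚ A]

-- A form of Frobenius reciprocity. On the induced module `left H e` acts as `e`, and `left H (f s)
-- * proj H` has as image the `f s`-part of the piece cut out by `ε`. Decomposing the first along
-- the second inside `relEnd H` gives the multiplicities `dim e ℚ[G] f_s`.
open MonoidAlgebra in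
theorem clIm_induced {G σ : Type*} [Group G] [Fintype G] [Fintype σ] {H : Subgroup G} {T : A}
    (F : MonoidAlgebra ℚ G →ₐ[ℚ] End T) {ε : End T} (hε : ε * ε = ε)
    (hcomm : ∀ h ∈ H, ε * F (single h 1) = F (single h 1) * ε)
    (hzero : ∀ g, g ∉ H → ε * F (single g 1) * ε = 0)
    {f : σ → MonoidAlgebra ℚ G} (hmem : ∀ s, f s ∈ spanSubgroup H)
    (idem : ∀ s, f s * f s = f s)
    (orth : ∀ s t, s ≠ t → ∀ a ∈ spanSubgroup H, f s * a * f t = 0)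
    (prim : ∀ s, ∀ a ∈ spanSubgroup H, ∃ k : ℚ, f s * a * f s = k • f s)
    (full : (1 : MonoidAlgebra ℚ G) ∈ Submodule.span ℚ {x | ∃ s, ∃ a ∈ spanSubgroup H,
      ∃ b ∈ spanSubgroup H, x = a * f s * b})
    {e : MonoidAlgebra ℚ G} (he : e * e = e) :
    clIm (F e * average F H ε : End T) =
      ∑ s, Module.finrank ℚ (corner e (f s)) • clIm (F (f s) * ε : End T) := by
  have he' : relEnd.left H e * relEnd.left H e = relEnd.left H e := by rw [← map_mul, he]
  have h := clIm_eq_sum_finrank (relEnd.isSplitFamily hmem idem orth prim full)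
    (relEnd.action F hε hcomm hzero) he'
  simp only [relEnd.action_left, relEnd.action_left_mul_proj,
    relEnd.finrank_corner hmem idem he] at h
  exact h

end K0

/-! ### Words in two letters -/

section words
variable {ι : Type*} [Fintype ι]

/-- The permutations preserving a word. -/
def wordStabilizer (s : ι → Bool) : Subgroup (Equiv.Perm ι) where
  carrier := {g | ∀ i, s (g i) = s i}
  one_mem' _ := rfl
  mul_mem' {g h} hg hh i := (hg (h i)).trans (hh i)
  inv_mem' {g} hg i := by
    have := hg (g⁻¹ i)
    rw [show g (g⁻¹ i) = i from g.apply_symm_apply i] at this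
    exact this.symm

omit [Fintype ι] in
theorem mem_wordStabilizer {s : ι → Bool} {g : Equiv.Perm ι} :
    g ∈ wordStabilizer s ↔ ∀ i, s (g i) = s i := Iff.rfl

theorem sum_toNat_eq_card (s : ι → Bool) : ∑ i, (s i).toNat = Fintype.card {i // s i = true} := by
  rw [Fintype.card_subtype, Finset.card_filter]
  exact Finset.sum_congr rfl fun i _ => by cases s i <;> rfl

theorem exists_perm_of_sum_eq {s t : ι → Bool} (h : ∑ i, (s i).toNat = ∑ i, (t i).toNat) :
    ∃ g : Equiv.Perm ι, ∀ i, t (g i) = s i := by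
  classical
  rw [sum_toNat_eq_card, sum_toNat_eq_card] at h
  let e := Fintype.equivOfCardEq h
  refine ⟨e.extendSubtype, fun i => ?_⟩
  cases hi : s i with
  | true => exact e.extendSubtype_mem i hi
  | false =>
    have := e.extendSubtype_not_mem i (by simp [hi])
    simpa using this

/-- The permutations carrying one word to another form a coset of the stabilizer as soon as both
words have equally many letters `true`. -/
theorem card_filter_comp_perm [DecidableEq ι] (s t : ι → Bool) :
    (Finset.univ.filter fun g : Equiv.Perm ι => t ∘ g = s).card =
      if ∑ i, (s i).toNat = ∑ i, (t i).toNat then Nat.card (wordStabilizer t) else 0 := by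
  split_ifs with h
  · obtain ⟨g₀, hg₀⟩ := exists_perm_of_sum_eq h
    rw [← Fintype.card_subtype, ← Nat.card_eq_fintype_card]
    refine Nat.card_congr ⟨fun g => ⟨g.1 * g₀⁻¹, fun i => ?_⟩, fun g => ⟨g.1 * g₀, ?_⟩, ?_, ?_⟩
    · have := congrFun g.2 (g₀⁻¹ i)
      rw [← hg₀] at this
      simpa using this
    · funext i
      simp [mem_wordStabilizer.1 g.2, hg₀]
    · intro g; simp
    · intro g; simp
  · rw [Finset.card_eq_zero, Finset.filter_eq_empty_iff]
    rintro g - rfl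
    exact h (Equiv.sum_comp g fun i => (t i).toNat)

end words

theorem exists_blockHom_eq {p q : ℕ} {g : Equiv.Perm (Fin (p + q))}
    (hg : g ∈ wordStabilizer fun i : Fin (p + q) => decide (i.val < p)) :
    ∃ σ τ, g = blockHom p q (σ, τ) := by
  have h : Set.MapsTo (finSumFinEquiv.symm.permCongr g) (Set.range Sum.inl)
      (Set.range (Sum.inl : Fin p → Fin p ⊕ Fin q)) := by
    rintro _ ⟨i, rfl⟩
    have h1 := hg (Fin.castAdd q i)
    simp only [Fin.val_castAdd, i.2, decide_true, decide_eq_true_eq] at h1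
    refine ⟨⟨_, h1⟩, ?_⟩
    rw [Equiv.permCongr_apply, Equiv.eq_symm_apply]
    ext
    simp
  obtain ⟨⟨σ, τ⟩, hστ⟩ := Equiv.Perm.mem_sumCongrHom_range_of_perm_mapsTo_inl h
  refine ⟨σ, τ, ?_⟩
  have h2 : g = finSumFinEquiv.permCongr (finSumFinEquiv.symm.permCongr g) := by
    ext; simp
  rw [h2, ← hστ]
  rfl

theorem blockHom_mem {p q : ℕ} (σ : Equiv.Perm (Fin p)) (τ : Equiv.Perm (Fin q)) :
    blockHom p q (σ, τ) ∈ wordStabilizer fun i : Fin (p + q) => decide (i.val < p) := by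
  intro i
  induction i using Fin.addCases with
  | left i => rw [blockHom_castAdd]; simp
  | right i => rw [blockHom_natAdd]; simp

/-! ### Products of split families for two blocks. -/

section block
open MonoidAlgebra
variable {p q : ℕ}

theorem blockMul_mem (a : MonoidAlgebra ℚ (Equiv.Perm (Fin p)))
    (b : MonoidAlgebra ℚ (Equiv.Perm (Fin q))) : blockMul a b ∈
      spanSubgroup (wordStabilizer fun i : Fin (p + q) => decide (i.val < p)) := by
  rw [← blockMulLin_apply]
  induction a using MonoidAlgebra.linear_induction with
  | hzero => simp
  | hadd x y hx hy => rw [map_add]; exact add_mem hx hy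
  | hsmul r x hx => rw [map_smul]; exact Submodule.smul_mem _ _ hx
  | hsingle σ =>
    induction b using MonoidAlgebra.linear_induction with
    | hzero => simp
    | hadd x y hx hy => rw [map_add]; exact add_mem hx hy
    | hsmul r x hx => rw [map_smul]; exact Submodule.smul_mem _ _ hx
    | hsingle τ =>
      rw [blockMulLin_apply, blockMul_single]
      exact single_mem_spanSubgroup (blockHom_mem σ τ)

theorem blockMul_induction {P : MonoidAlgebra ℚ (Equiv.Perm (Fin (p + q))) → Prop}
    {x : MonoidAlgebra ℚ (Equiv.Perm (Fin (p + q)))}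
    (hx : x ∈ spanSubgroup (wordStabilizer fun i : Fin (p + q) => decide (i.val < p)))
    (hzero : P 0) (hadd : ∀ x y, P x → P y → P (x + y)) (hsmul : ∀ (r : ℚ) x, P x → P (r • x))
    (hmul : ∀ a b, P (blockMul a b)) : P x := by
  induction hx using Submodule.span_induction with
  | mem x hx =>
    obtain ⟨h, hh, rfl⟩ := hx
    obtain ⟨σ, τ, rfl⟩ := exists_blockHom_eq hh
    rw [← blockMul_single]
    exact hmul _ _
  | zero => exact hzero
  | add x y _ _ hx hy => exact hadd x y hx hy
  | smul r x _ hx => exact hsmul r x hx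

variable {ι κ : Type*} {f : ι → MonoidAlgebra ℚ (Equiv.Perm (Fin p))}
  {g : κ → MonoidAlgebra ℚ (Equiv.Perm (Fin q))} (hf : IsSplitFamily f) (hg : IsSplitFamily g)
include hf hg

theorem blockMul_orth (s t : ι × κ) (hst : s ≠ t)
    {a : MonoidAlgebra ℚ (Equiv.Perm (Fin (p + q)))}
    (ha : a ∈ spanSubgroup (wordStabilizer fun i : Fin (p + q) => decide (i.val < p))) :
    blockMul (f s.1) (g s.2) * a * blockMul (f t.1) (g t.2) = 0 := by
  refine blockMul_induction (P := fun a => blockMul (f s.1) (g s.2) * a *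
    blockMul (f t.1) (g t.2) = 0) ha ?_ ?_ ?_ ?_
  · simp
  · intro x y hx hy
    rw [mul_add, add_mul, hx, hy, add_zero]
  · intro r x hx
    rw [mul_smul_comm, smul_mul_assoc, hx, smul_zero]
  · intro a b
    rw [blockMul_mul_blockMul, blockMul_mul_blockMul]
    by_cases h : s.1 = t.1
    · rw [hg.orth _ _ fun h' => hst (Prod.ext h h'), ← blockMulLin_apply, map_zero]
    · rw [hf.orth _ _ h, ← blockMulLin_apply, map_zero, LinearMap.zero_apply]

theorem blockMul_prim (s : ι × κ) {a : MonoidAlgebra ℚ (Equiv.Perm (Fin (p + q)))}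
    (ha : a ∈ spanSubgroup (wordStabilizer fun i : Fin (p + q) => decide (i.val < p))) :
    ∃ k : ℚ, blockMul (f s.1) (g s.2) * a * blockMul (f s.1) (g s.2) =
      k • blockMul (f s.1) (g s.2) := by
  refine blockMul_induction (P := fun a => ∃ k : ℚ, blockMul (f s.1) (g s.2) * a *
    blockMul (f s.1) (g s.2) = k • blockMul (f s.1) (g s.2)) ha ?_ ?_ ?_ ?_
  · exact ⟨0, by simp⟩
  · rintro x y ⟨k, hk⟩ ⟨l, hl⟩
    exact ⟨k + l, by rw [mul_add, add_mul, hk, hl, add_smul]⟩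
  · rintro r x ⟨k, hk⟩
    exact ⟨r * k, by rw [mul_smul_comm, smul_mul_assoc, hk, mul_smul]⟩
  · intro a b
    obtain ⟨k, hk⟩ := hf.prim s.1 a
    obtain ⟨l, hl⟩ := hg.prim s.2 b
    refine ⟨k * l, ?_⟩
    rw [blockMul_mul_blockMul, blockMul_mul_blockMul, hk, hl, ← blockMulLin_apply, map_smul,
      map_smul, LinearMap.smul_apply, smul_smul, mul_comm, blockMulLin_apply]

theorem blockMul_full : (1 : MonoidAlgebra ℚ (Equiv.Perm (Fin (p + q)))) ∈
    Submodule.span ℚ {x | ∃ s : ι × κ,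
      ∃ a ∈ spanSubgroup (wordStabilizer fun i : Fin (p + q) => decide (i.val < p)),
      ∃ b ∈ spanSubgroup (wordStabilizer fun i : Fin (p + q) => decide (i.val < p)),
      x = a * blockMul (f s.1) (g s.2) * b} := by
  have h1 : (1 : MonoidAlgebra ℚ (Equiv.Perm (Fin (p + q)))) = blockMulLin p q 1 1 := by
    rw [blockMulLin_apply, blockMul, map_one, map_one, one_mul]
  rw [h1]
  have h2 := Submodule.apply_mem_map₂ (blockMulLin p q) hf.full hg.full
  rw [Submodule.map₂_span_span] at h2
  refine Submodule.span_mono ?_ h2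
  rintro _ ⟨_, ⟨s, a, b, rfl⟩, _, ⟨t, c, d, rfl⟩, rfl⟩
  refine ⟨(s, t), blockMul a c, blockMul_mem a c, blockMul b d, blockMul_mem b d, ?_⟩
  simp only [blockMulLin_apply, blockMul_mul_blockMul]

end block

/-! ### Words and weight projectors. -/

namespace tensorPow

section
variable {C : Type u} [Category.{v} C] [Preadditive C] [MonoidalCategory C]
  [MonoidalPreadditive C]

theorem map_eq_zero {X Y : C} : ∀ {n : ℕ} {f : Fin n → (X ⟶ Y)} (i : Fin n), f i = 0 →
    map n f = 0
  | 0, _, i, _ => i.elim0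
  | n + 1, f, i, h => by
    rw [map_succ]
    cases i using Fin.cases with
    | zero => rw [h, zero_cons]
    | succ i => rw [map_eq_zero (f := fun i => f i.succ) i h, cons_zero]

/-- The tensor product of morphisms along a word in two letters. -/
def word {X Y : C} (a b : X ⟶ Y) {n : ℕ} (s : Fin n → Bool) : tensorPow X n ⟶ tensorPow Y n :=
  map n fun i => bif s i then a else b

omit [MonoidalPreadditive C] in
theorem wt_eq_sum_word {X Y : C} (a b : X ⟶ Y) (n k : ℕ) :
    wt a b n k = ∑ s : Fin n → Bool, if ∑ i, (s i).toNat = k then word a b s else 0 := rfl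

variable {U : C} {a b : U ⟶ U} (ha : a ≫ a = a) (hb : b ≫ b = b) (hab : a ≫ b = 0)
  (hba : b ≫ a = 0)

omit [Preadditive C] [MonoidalPreadditive C] in
include ha hb in
theorem word_comp_self {n : ℕ} (s : Fin n → Bool) : word a b s ≫ word a b s = word a b s := by
  rw [word, map_comp]
  congr 1
  funext i
  cases s i
  exacts [hb, ha]

include hab hba in
theorem word_comp_word {n : ℕ} {s t : Fin n → Bool} (h : s ≠ t) :
    word a b s ≫ word a b t = 0 := by
  obtain ⟨i, hi⟩ := Function.ne_iff.1 h
  rw [word, word, map_comp]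
  refine map_eq_zero i ?_
  revert hi
  cases s i <;> cases t i <;> simp [hab, hba]

omit [Preadditive C] [MonoidalPreadditive C] in
theorem perm_comp_word [SymmetricCategory C] {X Y : C} (a b : X ⟶ Y) {n : ℕ}
    (σ : Equiv.Perm (Fin n)) (s : Fin n → Bool) :
    perm X n σ ≫ word a b s = word a b (s ∘ σ) ≫ perm Y n σ := perm_comp_map n σ _

end

section
variable {A : Type u} [Category.{v} A] [Abelian A] [Linear ℚ A] [MonoidalCategory A]
  [SymmetricCategory A] [MonoidalPreadditive A]

open MonoidAlgebra

-- Conjugation by `g` permutes the letters of the word. Every word with the same number of letters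
-- `a` arises from as many `g` as the stabilizer has elements, so the average is the full weight
-- component.
omit [MonoidalPreadditive A] in
theorem average_word {U : A} (a b : U ⟶ U) {n : ℕ} (s : Fin n → Bool) :
    average (algHom U n) (wordStabilizer s) (show End (tensorPow U n) from word a b s) =
      wt a b n (∑ i, (s i).toNat) := by
  classical
  have hc : (Nat.card (wordStabilizer s) : ℚ) ≠ 0 := Nat.cast_ne_zero.2 Nat.card_pos.ne'
  have h : ∀ g : Equiv.Perm (Fin n), algHom U n (single g 1) *
      (show End (tensorPow U n) from word a b s) * algHom U n (single g⁻¹ 1) =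
      word a b (s ∘ (g⁻¹ : Equiv.Perm (Fin n))) := by
    intro g
    rw [algHom_single, algHom_single]
    change perm U n g⁻¹ ≫ word a b s ≫ perm U n g = _
    rw [← Category.assoc, perm_comp_word, Category.assoc, ← perm_mul, mul_inv_cancel, perm_one,
      Category.comp_id]
  have h2 : ∑ g : Equiv.Perm (Fin n), word a b (s ∘ g) =
      (Nat.card (wordStabilizer s) : ℚ) • wt a b n (∑ i, (s i).toNat) := by
    rw [wt_eq_sum_word, Finset.smul_sum, ← Finset.sum_fiberwise Finset.univ
      (fun g : Equiv.Perm (Fin n) => s ∘ g)]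
    refine Finset.sum_congr rfl fun t _ => ?_
    rw [Finset.sum_congr rfl (g := fun _ => word a b t) fun g hg => by
      rw [(Finset.mem_filter.1 hg).2], Finset.sum_const, card_filter_comp_perm]
    split_ifs with h
    · rw [Nat.cast_smul_eq_nsmul]
    · rw [zero_smul, smul_zero]
  rw [average, Finset.sum_congr rfl fun g _ => h g, inv_smul_eq_iff₀ hc, ← h2]
  exact Equiv.sum_comp (Equiv.inv (Equiv.Perm (Fin n))) fun g => word a b (s ∘ g)

end
end tensorPow

/-! ### The classes of the weight components -/

section
variable {A : Type u} [Category.{v} A] [Abelian A] [Linear ℚ A] [MonoidalCategory A]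
  [SymmetricCategory A] [MonoidalPreadditive A] [MonoidalLinear ℚ A]

theorem tensorPow.act_tensorHom_comp {X Z U : A} {k l : ℕ}
    {j : tensorPow X k ⊗ tensorPow Z l ⟶ tensorPow U (k + l)}
    (hj : ∀ σ τ, (perm X k σ ⊗ₘ perm Z l τ) ≫ j = j ≫ perm U (k + l) (blockHom k l (σ, τ)))
    (a : MonoidAlgebra ℚ (Equiv.Perm (Fin k))) (b : MonoidAlgebra ℚ (Equiv.Perm (Fin l))) :
    (act X a ⊗ₘ act Z b) ≫ j = j ≫ act U (blockMul a b) := by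
  rw [← blockMulLin_apply]
  induction a using MonoidAlgebra.linear_induction with
  | hzero => simp [act_zero]
  | hadd x y hx hy =>
    rw [act_add, MonoidalPreadditive.add_tensor, Preadditive.add_comp, hx, hy, map_add,
      LinearMap.add_apply, act_add, Preadditive.comp_add]
  | hsmul r x hx =>
    rw [act_smul, MonoidalCategory.tensorHom_def, MonoidalLinear.smul_whiskerRight, Linear.smul_comp, ← MonoidalCategory.tensorHom_def,
      Linear.smul_comp, hx, map_smul, LinearMap.smul_apply, act_smul, Linear.comp_smul]
  | hsingle σ =>
    induction b using MonoidAlgebra.linear_induction with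
    | hzero => simp [act_zero]
    | hadd x y hx hy =>
      rw [act_add, MonoidalPreadditive.tensor_add, Preadditive.add_comp, hx, hy, map_add, act_add,
        Preadditive.comp_add]
    | hsmul r x hx =>
      rw [act_smul, MonoidalCategory.tensorHom_def, MonoidalLinear.whiskerLeft_smul, Linear.comp_smul,
        ← MonoidalCategory.tensorHom_def, Linear.smul_comp, hx, map_smul, act_smul, Linear.comp_smul]
    | hsingle τ =>
      rw [blockMulLin_apply, blockMul_single, act_single, act_single, act_single]
      exact hj σ τ

variable [BiexactTensor A]

-- The weight `k` piece is induced from the summand of the word whose first `k` letters are `X`,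
-- that is, from `X^{⊗k} ⊗ Z^{⊗l}` with its action of `Σ_k × Σ_l`. So `K0.clIm_induced` applies,
-- with the products of Young idempotents of the two blocks as split family.
open MonoidAlgebra in
theorem K0.clIm_wt_comp_act (X Z : A) (k l : ℕ)
    {e : MonoidAlgebra ℚ (Equiv.Perm (Fin (k + l)))} (he : e * e = e) :
    K0.clIm (tensorPow.wt (biprod.fst ≫ biprod.inl) (biprod.snd ≫ biprod.inr) (k + l) k ≫
      tensorPow.act (X ⊞ Z) e) = ∑ s : k.Partition × l.Partition,
        Module.finrank ℚ (corner e (blockMul s.1.youngIdempotent s.2.youngIdempotent)) •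
          (K0.cl (schurObj s.1 X) * K0.cl (schurObj s.2 Z)) := by
  let a : X ⊞ Z ⟶ X ⊞ Z := biprod.fst ≫ biprod.inl
  let b : X ⊞ Z ⟶ X ⊞ Z := biprod.snd ≫ biprod.inr
  have ha : a ≫ a = a := by simp [a]
  have hb : b ≫ b = b := by simp [b]
  have hab : a ≫ b = 0 := by simp [a, b]
  have hba : b ≫ a = 0 := by simp [a, b]
  let w : Fin (k + l) → Bool := fun i => decide (i.val < k)
  let ε : End (tensorPow (X ⊞ Z) (k + l)) := tensorPow.word a b w
  have hw : ∑ i, (w i).toNat = k := by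
    rw [Fin.sum_univ_add]
    simp [w]
  have hε : ε * ε = ε := tensorPow.word_comp_self ha hb w
  have hcomm : ∀ g ∈ wordStabilizer w, ε * tensorPow.algHom (X ⊞ Z) (k + l) (single g 1) =
      tensorPow.algHom (X ⊞ Z) (k + l) (single g 1) * ε := by
    intro g hg
    rw [tensorPow.algHom_single]
    have h := tensorPow.perm_comp_word a b g w
    rwa [show w ∘ g = w from funext hg] at h
  have hzero : ∀ g, g ∉ wordStabilizer w →
      ε * tensorPow.algHom (X ⊞ Z) (k + l) (single g 1) * ε = 0 := by
    intro g hg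
    rw [tensorPow.algHom_single]
    change tensorPow.word a b w ≫ tensorPow.perm (X ⊞ Z) (k + l) g ≫ tensorPow.word a b w = 0
    rw [tensorPow.perm_comp_word, ← Category.assoc,
      tensorPow.word_comp_word hab hba (s := w) (t := w ∘ g)
        fun h => hg fun i => (congrFun h i).symm, zero_comp]
  have hk := Nat.Partition.isSplitFamily_youngIdempotent k
  have hl := Nat.Partition.isSplitFamily_youngIdempotent l
  have h := K0.clIm_induced (tensorPow.algHom (X ⊞ Z) (k + l)) hε hcomm hzero
    (f := fun s : k.Partition × l.Partition => blockMul s.1.youngIdempotent s.2.youngIdempotent)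
    (fun s => blockMul_mem _ _) (fun s => by rw [blockMul_mul_blockMul, hk.idem, hl.idem])
    (fun s t hst _ ha => blockMul_orth hk hl s t hst ha) (fun s _ ha => blockMul_prim hk hl s ha)
    (blockMul_full hk hl) he
  rw [tensorPow.average_word, hw] at h
  refine h.trans (Finset.sum_congr rfl fun s _ => ?_)
  congr 1
  -- It remains to compare the image of the product idempotent on the summand of the word with
  -- `S_α(X) ⊗ S_β(Z)`, through the inclusion `j` and the retraction `r` of this summand.
  obtain ⟨j, r, h1, h2, h3⟩ := tensorPow.exists_split (X := X) (Z := Z) (U := X ⊞ Z)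
    (a := biprod.inl) (b := biprod.inr) (a' := biprod.fst) (b' := biprod.snd)
    (by simp) (by simp) k l
  have hX : tensorPow.act X s.1.youngIdempotent ≫ tensorPow.act X s.1.youngIdempotent =
      tensorPow.act X s.1.youngIdempotent := by rw [← tensorPow.act_mul, hk.idem]
  have hZ : tensorPow.act Z s.2.youngIdempotent ≫ tensorPow.act Z s.2.youngIdempotent =
      tensorPow.act Z s.2.youngIdempotent := by rw [← tensorPow.act_mul, hl.idem]
  have h4 := tensorPow.act_tensorHom_comp h3 s.1.youngIdempotent s.2.youngIdempotent
  rw [K0.cl_mul_cl]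
  change _ = K0.cl (image (tensorPow.act X s.1.youngIdempotent) ⊗
    image (tensorPow.act Z s.2.youngIdempotent))
  refine K0.clIm_eq_of_retract
    ((image.ι (tensorPow.act X s.1.youngIdempotent) ⊗ₘ
      image.ι (tensorPow.act Z s.2.youngIdempotent)) ≫ j)
    (r ≫ (factorThruImage (tensorPow.act X s.1.youngIdempotent) ⊗ₘ
      factorThruImage (tensorPow.act Z s.2.youngIdempotent))) ?_ ?_
  · rw [Category.assoc, reassoc_of% h1, tensorHom_comp_tensorHom,
      K0.image_ι_factorThruImage hX, K0.image_ι_factorThruImage hZ, id_tensorHom_id]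
  · rw [Category.assoc, tensorHom_comp_tensorHom_assoc, image.fac, image.fac, h4, ← Category.assoc,
      h2]
    rfl

/-! ### The series attached to an object -/

omit [MonoidalLinear ℚ A] in
theorem coeff_lambdaSigma (X : A) (n : ℕ) : PowerSeries.coeff n (lambdaSigma X) =
    ∑ μ : n.Partition, K0.cl (schurObj μ X) ⊗ₜ[ℤ] DirectSum.of RepK0 n (K0.cl μ.specht) :=
  PowerSeries.coeff_mk _ _

/-- The multiplicity of `S_α(X) ⊗ S_β(Z)` in the `e_π`-part of the weight piece and that of `V_π` in
`Ind (V_α ⊗ V_β)` are the same corner dimension, so it can be moved from one side of the tensor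
product over `ℤ` to the other. -/
theorem sum_clIm_wt_tmul (X Z : A) {n k l : ℕ} (h : k + l = n) :
    ∑ π : n.Partition, K0.clIm (tensorPow.wt (biprod.fst ≫ biprod.inl)
      (biprod.snd ≫ biprod.inr) n k ≫ tensorPow.act (X ⊞ Z) π.youngIdempotent) ⊗ₜ[ℤ]
        DirectSum.of RepK0 n (K0.cl π.specht) =
      PowerSeries.coeff k (lambdaSigma X) * PowerSeries.coeff l (lambdaSigma Z) := by
  subst h
  have h1 : ∀ (α : k.Partition) (β : l.Partition),
      DirectSum.of RepK0 k (K0.cl α.specht) * DirectSum.of RepK0 l (K0.cl β.specht) =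
      ∑ π : (k + l).Partition, Module.finrank ℚ (corner π.youngIdempotent
        (blockMul α.youngIdempotent β.youngIdempotent)) •
          DirectSum.of RepK0 (k + l) (K0.cl π.specht) := by
    intro α β
    rw [DirectSum.of_mul_of]
    change DirectSum.of RepK0 (k + l) (RepK0.mulHom k l _ _) = _
    rw [RepK0.mulHom_cl, cl_indProd_specht, map_sum]
    exact Finset.sum_congr rfl fun π _ => map_nsmul _ _ _
  rw [coeff_lambdaSigma, coeff_lambdaSigma, Finset.sum_mul_sum, ← Finset.sum_product',
    Finset.univ_product_univ]
  simp only [Algebra.TensorProduct.tmul_mul_tmul, h1, TensorProduct.tmul_sum]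
  rw [Finset.sum_comm]
  refine Finset.sum_congr rfl fun π _ => ?_
  rw [K0.clIm_wt_comp_act X Z k l π.youngIdempotent_mul_self, TensorProduct.sum_tmul]
  refine Finset.sum_congr rfl fun s _ => ?_
  rw [← natCast_zsmul, ← natCast_zsmul, TensorProduct.smul_tmul]

/-- The graded piece of weight `k` accounts for the product of the coefficients of `t^k` and
`t^{n-k}`. -/
theorem lambdaSigma_eq_mul {S : ShortComplex A} (hS : S.ShortExact) :
    lambdaSigma S.X₂ = lambdaSigma S.X₁ * lambdaSigma S.X₃ := by
  ext n
  rw [PowerSeries.coeff_mul, coeff_lambdaSigma,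
    Finset.Nat.sum_antidiagonal_eq_sum_range_succ fun k l =>
      PowerSeries.coeff k (lambdaSigma S.X₁) * PowerSeries.coeff l (lambdaSigma S.X₃)]
  rw [Finset.sum_congr rfl fun k hk => (sum_clIm_wt_tmul S.X₁ S.X₃
    (Nat.add_sub_of_le (Nat.lt_succ_iff.1 (Finset.mem_range.1 hk)))).symm, Finset.sum_comm]
  refine Finset.sum_congr rfl fun π _ => ?_
  rw [schurObj_eq, K0.clIm_act_eq_sum hS π.youngIdempotent_mul_self, TensorProduct.sum_tmul]

end

/-! ### The constant coefficient. -/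

theorem Nat.Partition.youngIdempotent_zero (μ : Nat.Partition 0) : μ.youngIdempotent = 1 := by
  have h1 : μ.youngSymmetrizer = 1 := by
    have h := μ.youngSymmetrizer_coeff_one
    refine MonoidAlgebra.ext (Finsupp.ext fun g => ?_)
    rw [Subsingleton.elim g 1, h]
    simp [MonoidAlgebra.one_def]
  have h2 : μ.spechtSubmodule = ⊤ := by
    rw [spechtSubmodule, h1, LinearMap.range_eq_top]
    exact fun x => ⟨x, by simp⟩
  rw [youngIdempotent, h1, h2, finrank_top,
    Module.finrank_eq_card_basis (MonoidAlgebra.groupBasis (Equiv.Perm (Fin 0)))]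
  simp

/-- The group algebra of the trivial group is `ℚ`, spanned by `1`. -/
theorem Nat.Partition.cl_specht_zero (μ : Nat.Partition 0) : K0.cl μ.specht = RepK0.unit := by
  have hx : ∀ x : MonoidAlgebra ℚ (Equiv.Perm (Fin 0)), x = x.coeff 1 • 1 := by
    intro x
    refine MonoidAlgebra.ext (Finsupp.ext fun g => ?_)
    rw [Subsingleton.elim g 1]
    simp [MonoidAlgebra.one_def]
  have hg : ∀ g : Equiv.Perm (Fin 0), MonoidAlgebra.single g (1 : ℚ) = 1 := fun g => by
    rw [Subsingleton.elim g 1, MonoidAlgebra.one_def]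
  rw [← clIm_regularEnd_youngIdempotent, RepK0.unit]
  refine FDRep.clIm_regularEnd _ (LinearMap.toSpanSingleton ℚ _ 1)
    ((MonoidAlgebra.groupBasis (Equiv.Perm (Fin 0))).coord 1) ?_ ?_ ?_ ?_
  · intro g v
    rw [hg, one_mul]
    rfl
  · intro g x
    rw [hg, one_mul]
    rfl
  · intro v
    simp [MonoidAlgebra.groupBasis_repr, MonoidAlgebra.one_def]
  · intro x
    rw [youngIdempotent_zero, mul_one]
    conv_rhs => rw [hx x]
    rfl

section
variable {A : Type u} [Category.{v} A] [Abelian A] [Linear ℚ A] [MonoidalCategory A]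
  [SymmetricCategory A] [MonoidalPreadditive A] [MonoidalLinear ℚ A] [BiexactTensor A]

omit [MonoidalLinear ℚ A] in
theorem constantCoeff_lambdaSigma (X : A) :
    PowerSeries.constantCoeff (lambdaSigma X) = 1 := by
  rw [← PowerSeries.coeff_zero_eq_constantCoeff_apply, coeff_lambdaSigma, Fintype.sum_unique,
    schurObj_eq, Nat.Partition.youngIdempotent_zero, Nat.Partition.cl_specht_zero,
    tensorPow.act_one, K0.clIm_id, Algebra.TensorProduct.one_def]
  rfl

end

/-- The formula of `K0.clIm_act_eq_sum` has the same right-hand side for the given sequence and for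
the split sequence with the same ends. The weight pieces need not be known for this. -/
theorem cl_schurObj_eq {A : Type u} [Category.{v} A] [Abelian A] [Linear ℚ A]
    [MonoidalCategory A] [SymmetricCategory A] [MonoidalPreadditive A] [BiexactTensor A]
    {S : ShortComplex A} (hS : S.ShortExact) {n : ℕ} (π : n.Partition) :
    K0.cl (schurObj π S.X₂) = K0.cl (schurObj π (S.X₁ ⊞ S.X₃)) := by
  have h := K0.clIm_act_eq_sum (S := ShortComplex.mk (biprod.inl : S.X₁ ⟶ S.X₁ ⊞ S.X₃) biprod.snd
    (by simp)) (ShortComplex.Splitting.shortExact ⟨biprod.fst, biprod.inr, by simp, by simp,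
      by simp⟩) π.youngIdempotent_mul_self
  rw [schurObj_eq, schurObj_eq, K0.clIm_act_eq_sum hS π.youngIdempotent_mul_self]
  exact h.symm

/-- Constant coefficient `1` makes each series a unit, multiplicativity on short exact sequences
lets the assignment descend to `K0`, and uniqueness holds because classes of objects generate `K0`.
-/
theorem K0.existsUnique_hom_powerSeries {A : Type u} [Category.{v} A] [Abelian A] {R : Type*}
    [CommRing R] {F : A → PowerSeries R} (h1 : ∀ X, PowerSeries.constantCoeff (F X) = 1)
    (hF : ∀ S : ShortComplex A, S.ShortExact → F S.X₂ = F S.X₁ * F S.X₃) :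
    ∃! L : Multiplicative (K0 A) →* (PowerSeries R)ˣ,
      ∀ X : A, (L (Multiplicative.ofAdd (K0.cl X)) : PowerSeries R) = F X := by
  have hu : ∀ X, IsUnit (F X) := fun X => by
    rw [PowerSeries.isUnit_iff_constantCoeff, h1]
    exact isUnit_one
  let φ : K0 A →+ Additive (PowerSeries R)ˣ :=
    K0.lift (fun X => Additive.ofMul (hu X).unit) fun S hS => by
      rw [← ofMul_mul]
      exact congrArg Additive.ofMul (Units.ext (hF S hS))
  have hφ : ∀ X, φ (K0.cl X) = Additive.ofMul (hu X).unit := K0.lift_cl _ _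
  refine ⟨AddMonoidHom.toMultiplicativeLeft φ, fun X => ?_, fun L hL => ?_⟩
  · exact congrArg (fun u => (Additive.toMul u).1) (hφ X)
  · rw [← Equiv.symm_apply_eq]
    refine K0.hom_ext fun X => ?_
    rw [hφ]
    exact congrArg Additive.ofMul (Units.ext (hL X))

theorem mainTheorem7 {A : Type u} [Category.{v} A] [Abelian A] [Linear ℚ A]
    [MonoidalCategory A] [SymmetricCategory A] [MonoidalPreadditive A] [MonoidalLinear ℚ A]
    [BiexactTensor A] :
    (∀ S : ShortComplex A, S.ShortExact → ∀ (n : ℕ) (π : n.Partition),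
      K0.cl (schurObj π S.X₂) = K0.cl (schurObj π (S.X₁ ⊞ S.X₃))) ∧
    ∃! L : Multiplicative (K0 A) →* (PowerSeries (K0 A ⊗[ℤ] RepRing))ˣ,
      ∀ X : A, (L (Multiplicative.ofAdd (K0.cl X)) : PowerSeries (K0 A ⊗[ℤ] RepRing)) =
        lambdaSigma X := by
  refine ⟨fun S hS n π => cl_schurObj_eq hS π, ?_⟩
  exact K0.existsUnique_hom_powerSeries (A := A) (R := K0 A ⊗[ℤ] RepRing) (F := lambdaSigma)
    constantCoeff_lambdaSigma fun S hS => lambdaSigma_eq_mul hS
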